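/- **Subadditivity of the multipartite squashed entanglements.** *Conventions.* Systems are Hilbert spaces of arbitrary (finite or infinite) dimension, a state is a positive operator of trace one, and $H(\rho)=-\operatorname{Tr}\{\rho\log\rho\}\in[0,\infty]$ is the von Neumann entropy (natural logarithm; the choice of base does not affect the claim). For a state $\omega_{A_1\cdots A_nE}$ with all the entropies below finite put $H(A_J|E)_\omega=H(A_JE)_\omega-H(E)_\omega$ for $J\subseteq[n]=\{1,\dots,n\}$, where $A_J$ is the collection of the systems $A_j$ with $j\in J$ and entropies are those of the reduced states, and $$I(A_1;\cdots;A_n|E)_\omega=\sum_{i=1}^nH(A_i|E)_\omega-H(A_1\cdots A_n|E)_\omega,$$ $$\widetilde I(A_1;\cdots;A_n|E)_\omega=\sum_{i=1}^nH(A_{[n]\setminus\{i\}}|E)_\omega-(n-1)H(A_1\cdots A_n|E)_\omega .$$ For a state $\rho_{A_1\cdots A_n}$ let $$E_{\mathrm{sq}}(A_1;\cdots;A_n)_\rho=\tfrac12\inf_\omega I(A_1;\cdots;A_n|E)_\omega,\qquad \widetilde E_{\mathrm{sq}}(A_1;\cdots;A_n)_\rho=\tfrac12\inf_\omega\widetilde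 I(A_1;\cdots;A_n|E)_\omega,$$ where the infima are over all systems $E$ and all extensions $\omega_{A_1\cdots A_nE}$ of $\rho$ (states with $\operatorname{Tr}_E\omega=\rho$) for which all the entropies $H(A_JE)_\omega$, $J\subseteq[n]$, are finite, so that $I$ and $\widetilde I$ are defined; the infimum is $+\infty$ if there is no such extension. A party may hold several systems, which is written by juxtaposition (e.g. $P_iQ_i$), and a system that is held by no party is traced out first. *Statement.* Let $m\ge0$ and let $\psi_{SP_1\cdots P_mQ_1\cdots Q_mE_1E_2}$ be a pure state of $2m+3$ systems. Write $P_{[m]}=P_1\cdots P_m$ and $Q_{[m]}=Q_1\cdots Q_m$. Then $$E_{\mathrm{sq}}(S;P_1Q_1;\cdots;P_mQ_m)_\psi\le E_{\mathrm{sq}}(SQ_{[m]}E_2;P_1;\cdots;P_m)_\psi+E_{\mathrm{sq}}(SP_{[m]}E_1;Q_1;\cdots;Q_m)_\psi,$$ $$\widetilde E_{\mathrm{sq}}(S;P_1Q_1;\cdots;P_mQ_m)_\psi\le\widetilde E_{\mathrm{sq}}(SQ_{[m]}E_2;P_1;\cdots;P_m)_\psi+\widetilde E_{\mathrm{sq}}(SP_{[m]}E_1;Q_1;\cdots;Q_m)_\psi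 .$$ -/

import Mathlib

open Set

/-!
# Multipartite squashed entanglements

Every Hilbert space has an orthonormal basis, so a quantum system is given here by the index set `X`
of a basis, and its Hilbert space is `ℓ²(X)`.  The set `X` may be infinite.  The tensor product of
`ℓ²(X)` and `ℓ²(Y)` is `ℓ²(X × Y)`, and the tensor product of a finite family of systems `A k` is
`ℓ²(∀ k, A k)`.
-/

namespace Squashed

universe u v

/-- The Hilbert space `ℓ²(X)` of the system with basis labels `X`. -/
def Hilb (X : Type u) : Type u := lp (fun _ : X => ℂ) 2

noncomputable instance (X : Type u) : NormedAddCommGroup (Hilb X) :=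
  inferInstanceAs (NormedAddCommGroup (lp (fun _ : X => ℂ) 2))

noncomputable instance (X : Type u) : InnerProductSpace ℂ (Hilb X) :=
  inferInstanceAs (InnerProductSpace ℂ (lp (fun _ : X => ℂ) 2))

instance (X : Type u) : CompleteSpace (Hilb X) :=
  inferInstanceAs (CompleteSpace (lp (fun _ : X => ℂ) 2))

/-- Bounded operators on the system with basis labels `X`. -/
abbrev Op (X : Type u) : Type u := Hilb X →L[ℂ] Hilb X

/-- The standard Hilbert basis of `ℓ²(X)`. -/
noncomputable def stdBasis (X : Type u) : HilbertBasis X ℂ (Hilb X) :=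
  HilbertBasis.ofRepr (LinearIsometryEquiv.refl ℂ (Hilb X))

/-- The standard basis vector with label `x`. -/
noncomputable def ket {X : Type u} (x : X) : Hilb X := stdBasis X x

theorem orthonormal_ket (X : Type u) : Orthonormal ℂ (ket : X → Hilb X) :=
  (stdBasis X).orthonormal

/-- Density operators: positive operators of trace one. -/
def IsState {X : Type u} (T : Op X) : Prop :=
  T.IsPositive ∧ HasSum (fun x : X => inner ℂ (ket x) (T (ket x))) 1

/-- The operator `|ψ⟩⟨ψ|`. -/
noncomputable def ketbra {X : Type u} (ψ : Hilb X) : Op X := InnerProductSpace.rankOne ℂ ψ ψ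

/-- For a splitting `e` of the system `X` into the tensor product of `Y` and `Z`, the isometry
`φ ↦ φ ⊗ |z⟩` from `ℓ²(Y)` to `ℓ²(X)`. -/
noncomputable def slice {X : Type u} {Y : Type u} {Z : Type u} (e : X ≃ Y × Z) (z : Z) :
    Hilb Y →L[ℂ] Hilb X :=
  ((orthonormal_ket X).comp (fun y : Y => e.symm (y, z)) (fun a b h => by
    simpa using h)).orthogonalFamily.linearIsometry.toContinuousLinearMap.comp
      (stdBasis Y).repr.toContinuousLinearEquiv.toContinuousLinearMap

/-- The partial trace over `Z`, for a splitting `e` of the system `X` into `Y` and `Z`: the sum over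
`z` of `(1 ⊗ ⟨z|) T (1 ⊗ |z⟩)`.  For a density operator the sum converges absolutely in norm. -/
noncomputable def ptrace {X : Type u} {Y : Type u} {Z : Type u} (e : X ≃ Y × Z) (T : Op X) : Op Y :=
  ∑' z : Z, (ContinuousLinearMap.adjoint (slice e z)).comp (T.comp (slice e z))

/-- The operator `-T log T`, by the continuous functional calculus of a self-adjoint operator. -/
noncomputable def negMulLogOp {H : Type u} [NormedAddCommGroup H] [InnerProductSpace ℂ H]
    [CompleteSpace H] (T : H →L[ℂ] H) : H →L[ℂ] H :=
  cfc Real.negMulLog T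

/-- The von Neumann entropy `H(T) = -Tr(T log T)` in `[0, ∞]` of a density operator. -/
noncomputable def entropy {X : Type u} (T : Op X) : ENNReal :=
  ∑' x : X, ENNReal.ofReal (inner ℂ (ket x) (negMulLogOp T (ket x))).re

section Families

variable {K : Type v} {A : K → Type u}

open Classical in
/-- Splitting a family of systems into those in `J` and the other ones. -/
noncomputable def splitEquiv (A : K → Type u) (J : Set K) :
    (∀ k, A k) ≃ (∀ k : {k // k ∈ J}, A k) × (∀ k : {k // k ∉ J}, A k) :=
  Equiv.piEquivPiSubtypeProd (fun k => k ∈ J) A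

/-- The same in the presence of an additional system `E`, which goes with `J`. -/
noncomputable def splitEquivExt (A : K → Type u) (E : Type (max u v)) (J : Set K) :
    (∀ k, A k) × E ≃ ((∀ k : {k // k ∈ J}, A k) × E) × (∀ k : {k // k ∉ J}, A k) where
  toFun x := (((splitEquiv A J x.1).1, x.2), (splitEquiv A J x.1).2)
  invFun y := ((splitEquiv A J).symm (y.1.1, y.2), y.1.2)
  left_inv x := by simp
  right_inv y := by simp

/-- The reduced state on the systems in `J`. -/
noncomputable def reduced (J : Set K) (T : Op (∀ k, A k)) : Op (∀ k : {k // k ∈ J}, A k) :=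
  ptrace (splitEquiv A J) T

variable {E : Type (max u v)}

/-- The entropy `H(A_J E)_ω`; `H(E)_ω` is the case `J = ∅`. -/
noncomputable def entropyExt (ω : Op ((∀ k, A k) × E)) (J : Set K) : ENNReal :=
  entropy (ptrace (splitEquivExt A E J) ω)

/-- The conditional entropy `H(A_J | E)_ω = H(A_J E)_ω - H(E)_ω`. -/
noncomputable def condEntropy (ω : Op ((∀ k, A k) × E)) (J : Set K) : ℝ :=
  (entropyExt ω J).toReal - (entropyExt ω ∅).toReal

variable {ι : Type} [Fintype ι]

/-- The conditional multipartite information `I(G₁; ⋯; Gₙ | E)_ω`, where party `i` holds the systems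
in `G i`. -/
noncomputable def condInfo (G : ι → Set K) (ω : Op ((∀ k, A k) × E)) : ℝ :=
  ∑ i, condEntropy ω (G i) - condEntropy ω (⋃ i, G i)

/-- The conditional multipartite information `Ĩ(G₁; ⋯; Gₙ | E)_ω`. -/
noncomputable def condInfoTilde (G : ι → Set K) (ω : Op ((∀ k, A k) × E)) : ℝ :=
  ∑ i, condEntropy ω (⋃ j ∈ ({i}ᶜ : Set ι), G j)
    - ((Fintype.card ι : ℝ) - 1) * condEntropy ω (⋃ i, G i)

/-- All joint entropies of parties together with `E` are finite, so that the differences of entropies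
in `I` and `Ĩ` make sense.  (This is automatic for finite-dimensional systems.) -/
def FiniteEntropies (G : ι → Set K) (ω : Op ((∀ k, A k) × E)) : Prop :=
  ∀ t : Set ι, entropyExt ω (⋃ i ∈ t, G i) < ⊤

/-- `ω` is an extension of `ρ` by the system `E`. -/
def IsExtension (ρ : Op (∀ k, A k)) (ω : Op ((∀ k, A k) × E)) : Prop :=
  IsState ω ∧ ptrace (Equiv.refl ((∀ k, A k) × E)) ω = ρ

/-- `E_sq` of a state `ρ` of the systems `K`, where party `i` holds the systems in `G i` and every
system is held by exactly one party.  The infimum is over all extensions for which `I` is defined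
(`+∞` if there is none). -/
noncomputable def sqState (G : ι → Set K) (ρ : Op (∀ k, A k)) : EReal :=
  ⨅ (E : Type (max u v)) (ω : Op ((∀ k, A k) × E)) (_ : IsExtension ρ ω)
    (_ : FiniteEntropies G ω), ((1 / 2 * condInfo G ω : ℝ) : EReal)

/-- `Ẽ_sq` of a state `ρ` of the systems `K`, as for `sqState`. -/
noncomputable def sqTildeState (G : ι → Set K) (ρ : Op (∀ k, A k)) : EReal :=
  ⨅ (E : Type (max u v)) (ω : Op ((∀ k, A k) × E)) (_ : IsExtension ρ ω)
    (_ : FiniteEntropies G ω), ((1 / 2 * condInfoTilde G ω : ℝ) : EReal)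

/-- `E_sq(G₁; ⋯; Gₙ)_ρ` for pairwise disjoint sets `G i` of systems: the systems that no party holds
are traced out first. -/
noncomputable def Esq (G : ι → Set K) (ρ : Op (∀ k, A k)) : EReal :=
  sqState (fun i => {k : {k // k ∈ ⋃ j, G j} | k.1 ∈ G i}) (reduced (⋃ j, G j) ρ)

/-- `Ẽ_sq(G₁; ⋯; Gₙ)_ρ`, with the systems that no party holds traced out first. -/
noncomputable def EsqTilde (G : ι → Set K) (ρ : Op (∀ k, A k)) : EReal :=
  sqTildeState (fun i => {k : {k // k ∈ ⋃ j, G j} | k.1 ∈ G i}) (reduced (⋃ j, G j) ρ)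

end Families

/-- The names of the `2m + 3` systems `S, P₁, …, Pₘ, Q₁, …, Qₘ, E₁, E₂`. -/
inductive Sys (m : ℕ) : Type
  | S : Sys m
  | P : Fin m → Sys m
  | Q : Fin m → Sys m
  | E₁ : Sys m
  | E₂ : Sys m

/-- The list of parties `B; C₁; ⋯; Cₘ`. -/
def parties {K : Type} {m : ℕ} (B : Set K) (C : Fin m → Set K) : Fin (m + 1) → Set K :=
  Fin.cons (α := fun _ => Set K) B C

end Squashed

open Squashed

/-!
# Subadditivity of the multipartite squashed entanglements

Let `ω₁` be an extension, by a system `E`, of the reduced state of `ψ` on all systems but `E₁`, and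
let `ω₂` be an extension, by a system `E'`, of the reduced state on all systems but `E₂`; these are
the states over which the two infima on the right-hand side range.  Both can be obtained from one
pure state.  A purification of `ω₁`, by a further system `F`, has the same reduced state on all
systems but `E₁` as `ψ`, so it arises from `ψ` through a partial isometry from `E₁` to `E F`
(`exists_partialIsometry`); in the same way a purification of `ω₂` arises through a partial isometry
from `E₂` to `E' F'`.  The two partial isometries act on different systems, so they commute, and
applying both to `ψ` gives a pure state `Ψ` of the systems `S P Q E F E' F'` (`exists_glue`).  The
entropies of `ω₁` and `ω₂` are entropies of `Ψ`, where `E₂` in an entropy of `ω₁` is replaced by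
`E' F'`, and `E₁` in an entropy of `ω₂` by `E F`.  The reduced state of `Ψ` on `S P Q E E'` is an
extension of the reduced state of `ψ` on `S P Q` by the system `E E'`
(`exists_common_purification`).

The inequality `I(S; P₁Q₁; ⋯ | E E') ≤ I(S Q E₂; P₁; ⋯ | E) + I(S P E₁; Q₁; ⋯ | E')` between the
conditional informations is then a sum of instances of strong subadditivity for `Ψ`
(`info_le_info_add_info`).  The inequality for `Ĩ` is the same one for the complementary sets of
systems: for a pure state these have the same entropies, and complements exchange `E` with `F`,
`E'` with `F'`, and the two kinds of conditional information
(`infoTilde_le_infoTilde_add_infoTilde`).  The finiteness of the entropies of `ω₁` and `ω₂` implies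
that of all entropies of `Ψ` (`famEntropy_ne_top`), by a weak form of subadditivity that holds
without any finiteness assumption (`entropy_le_add_add_one`).  The conditional informations are
nonnegative (`condInfo_nonneg`, `condInfoTilde_nonneg`), so the sums of infima in the extended real
numbers are not of the form `∞ - ∞`.

Strong subadditivity in infinite dimensions, `H(ABD) - H(BD) ≤ H(AB) - H(B)`
(`toReal_entropy_sub_le`), is proved as follows.  If `T` is a state of `YZ` with eigenvalues `pᵢ`
and eigenvectors `uᵢ`, and its reduced state on `Y` has eigenvalues `qⱼ` and eigenvectors `vⱼ`, then
`H(YZ) - H(Y) = ∑ w log x`, where the weights `w = pᵢ |⟨vⱼ ⊗ z|uᵢ⟩|²` form a probability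
distribution and `x = qⱼ / pᵢ` (`exists_weights`).  As `log` is an integral of resolvents, it
suffices to compare the averages `∑ w x / (x + t)` for every `t > 0` (`tsum_mul_log_le`).  Such an
average is the infimum, over bounded operators `L`, of a quadratic functional that does not refer
to the eigenvectors (`condCost`), and the value of the functional of the larger system at `L ⊗ 1`
is the value of the functional of the smaller system at `L`.

A positive trace class operator is handled as a mixture, that is, a sum of operators `|vᵢ⟩⟨vᵢ|`
(`IsMixture`); a partial trace of a mixture is again one, whose vectors are the components of the
`vᵢ`.
-/

open Squashed
namespace Squashed
open scoped ENNReal InnerProductSpace ComplexOrder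
open ContinuousLinearMap (adjoint adjoint_inner_left adjoint_inner_right)

set_option linter.unusedSectionVars false

universe u

/-! ### Sums of squares in Hilbert spaces -/

section Hilbert

variable {H : Type*} [NormedAddCommGroup H] [InnerProductSpace ℂ H]
variable {H' : Type*} [NormedAddCommGroup H'] [InnerProductSpace ℂ H']
variable {ι κ : Type*}

theorem inner_self_eq_ofReal (x : H) : inner ℂ x x = ((‖x‖ ^ 2 : ℝ) : ℂ) := by
  rw [inner_self_eq_norm_sq_to_K]; push_cast; rfl

theorem enorm_sq_eq_ofReal {E : Type*} [SeminormedAddCommGroup E] (y : E) :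
    ‖y‖ₑ ^ 2 = ENNReal.ofReal (‖y‖ ^ 2) := by
  rw [← ofReal_norm, ENNReal.ofReal_pow (norm_nonneg _)]

/-- Parseval's identity, as an identity between sums in `[0, ∞]`. -/
theorem tsum_enorm_inner_sq (b : HilbertBasis ι ℂ H) (x : H) :
    ∑' i, ‖inner ℂ (b i) x‖ₑ ^ 2 = ‖x‖ₑ ^ 2 := by
  have h2 : HasSum (fun i => ‖inner ℂ (b i) x‖ ^ 2) (‖x‖ ^ 2) := by
    have := Complex.hasSum_re (b.hasSum_inner_mul_inner x x)
    rw [inner_self_eq_ofReal, Complex.ofReal_re] at this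
    convert this using 2 with i
    rw [← inner_conj_symm x (b i), mul_comm, Complex.mul_conj, Complex.normSq_eq_norm_sq,
      Complex.ofReal_re]
  simp_rw [enorm_sq_eq_ofReal]
  rw [← ENNReal.ofReal_tsum_of_nonneg (fun i => by positivity) h2.summable, h2.tsum_eq]

theorem enorm_inner_comm (x y : H) : ‖inner ℂ x y‖ₑ = ‖inner ℂ y x‖ₑ := by
  rw [← ofReal_norm, ← ofReal_norm, norm_inner_symm]

theorem enorm_inner_sq_le (x y : H) : ‖inner ℂ x y‖ₑ ^ 2 ≤ ‖x‖ₑ ^ 2 * ‖y‖ₑ ^ 2 := by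
  rw [← mul_pow]
  gcongr
  rw [← ofReal_norm, ← ofReal_norm, ← ofReal_norm, ← ENNReal.ofReal_mul (norm_nonneg _)]
  exact ENNReal.ofReal_le_ofReal (norm_inner_le_norm x y)

variable [CompleteSpace H] [CompleteSpace H']

open ContinuousLinearMap in
/-- The Hilbert–Schmidt norm may be computed from the adjoint, in any two bases. -/
theorem tsum_enorm_apply_sq (b : HilbertBasis ι ℂ H) (c : HilbertBasis κ ℂ H') (T : H →L[ℂ] H') :
    ∑' i, ‖T (b i)‖ₑ ^ 2 = ∑' j, ‖adjoint T (c j)‖ₑ ^ 2 := by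
  simp_rw [← tsum_enorm_inner_sq c, ← tsum_enorm_inner_sq b (adjoint T _)]
  rw [ENNReal.tsum_comm]
  refine tsum_congr fun j => tsum_congr fun i => ?_
  rw [adjoint_inner_right, enorm_inner_comm]

open ContinuousLinearMap in
/-- The operator norm is at most the Hilbert–Schmidt norm. -/
theorem enorm_apply_sq_le (b : HilbertBasis ι ℂ H) (T : H →L[ℂ] H') (x : H) :
    ‖T x‖ₑ ^ 2 ≤ (∑' i, ‖T (b i)‖ₑ ^ 2) * ‖x‖ₑ ^ 2 := by
  obtain ⟨w, c, -⟩ := exists_hilbertBasis ℂ H'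
  rw [tsum_enorm_apply_sq b c, ← tsum_enorm_inner_sq c, ← ENNReal.tsum_mul_right]
  refine ENNReal.tsum_le_tsum fun j => ?_
  rw [← adjoint_inner_left]
  exact enorm_inner_sq_le _ _

/-- A Hilbert–Schmidt operator is compact. -/
theorem isCompactOperator_of_tsum_ne_top (b : HilbertBasis ι ℂ H) (T : H →L[ℂ] H')
    (h : ∑' i, ‖T (b i)‖ₑ ^ 2 ≠ ⊤) : IsCompactOperator T := by
  classical
  -- `T` is the norm limit of the operators of finite rank that agree with `T` on the basis
  -- vectors in a finite set `s` and vanish on the other ones.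
  let F : Finset ι → H →L[ℂ] H' := fun s =>
    ∑ i ∈ s, (innerSL ℂ (b i)).smulRight (T (b i))
  have hF : ∀ s x, F s x = ∑ i ∈ s, inner ℂ (b i) x • T (b i) := by
    intro s x; simp [F]
  have hcpt : ∀ s, IsCompactOperator (F s) := by
    intro s
    refine (compactOperator (RingHom.id ℂ) H H').sum_mem fun i _ => ?_
    change IsCompactOperator ((innerSL ℂ (b i)).smulRight (T (b i)))
    have : IsCompactOperator (innerSL ℂ (b i)) :=
      isCompactOperator_of_locallyCompactSpace_dom (innerSL ℂ (b i))
    exact this.clm_comp ((ContinuousLinearMap.id ℂ ℂ).smulRight (T (b i)))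
  have hb : ∀ s i, (T - F s) (b i) = if i ∈ s then 0 else T (b i) := by
    intro s i
    rw [_root_.sub_apply, hF]
    simp_rw [orthonormal_iff_ite.1 b.orthonormal, ite_smul, one_smul, zero_smul]
    rw [Finset.sum_ite_eq' s i]
    split_ifs <;> simp
  have hbound : ∀ s, ‖T - F s‖ₑ ^ 2 ≤ ∑' i : {i // i ∉ s}, ‖T (b i)‖ₑ ^ 2 := by
    intro s
    have hs : ∑' i, ‖(T - F s) (b i)‖ₑ ^ 2 = ∑' i : {i // i ∉ s}, ‖T (b i)‖ₑ ^ 2 := by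
      rw [show (∑' i : {i // i ∉ s}, ‖T (b i)‖ₑ ^ 2) = ∑' i : ({i | i ∉ s} : Set ι),
        (fun i => ‖T (b i)‖ₑ ^ 2) i from rfl,
        tsum_subtype {i | i ∉ s} fun i => ‖T (b i)‖ₑ ^ 2]
      refine tsum_congr fun i => ?_
      rw [hb]
      by_cases hi : i ∈ s <;> simp [hi]
    rw [← hs]
    set C := ∑' i, ‖(T - F s) (b i)‖ₑ ^ 2 with hC
    have hCt : C ≠ ⊤ := ne_top_of_le_ne_top h (by
      rw [hC]
      refine ENNReal.tsum_le_tsum fun i => ?_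
      rw [hb]; split_ifs <;> simp)
    have : ‖T - F s‖ ≤ Real.sqrt C.toReal := by
      refine ContinuousLinearMap.opNorm_le_bound _ (Real.sqrt_nonneg _) fun x => ?_
      have := enorm_apply_sq_le b (T - F s) x
      rw [← hC, enorm_sq_eq_ofReal, enorm_sq_eq_ofReal, ← ENNReal.ofReal_toReal hCt,
        ← ENNReal.ofReal_mul ENNReal.toReal_nonneg,
        ENNReal.ofReal_le_ofReal_iff (by positivity)] at this
      rw [← Real.sqrt_sq (norm_nonneg ((T - F s) x)), ← Real.sqrt_sq (norm_nonneg x),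
        ← Real.sqrt_mul ENNReal.toReal_nonneg]
      exact Real.sqrt_le_sqrt this
    rw [enorm_sq_eq_ofReal, ← ENNReal.ofReal_toReal hCt]
    refine ENNReal.ofReal_le_ofReal ?_
    calc _ ≤ (Real.sqrt C.toReal) ^ 2 := by gcongr
      _ = _ := Real.sq_sqrt ENNReal.toReal_nonneg
  have hlim : Filter.Tendsto F Filter.atTop (nhds T) := by
    rw [tendsto_iff_edist_tendsto_0]
    have h1 := ENNReal.tendsto_tsum_compl_atTop_zero h
    have h2 : Filter.Tendsto (fun s => ‖T - F s‖ₑ ^ 2) Filter.atTop (nhds 0) :=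
      tendsto_of_tendsto_of_tendsto_of_le_of_le tendsto_const_nhds h1 (fun _ => zero_le) hbound
    have h3 := (ENNReal.continuous_rpow_const (y := (1/2 : ℝ))).tendsto 0 |>.comp h2
    rw [ENNReal.zero_rpow_of_pos (by norm_num)] at h3
    refine h3.congr fun s => ?_
    simp only [Function.comp]
    rw [← ENNReal.rpow_natCast, ← ENNReal.rpow_mul, edist_comm, edist_eq_enorm_sub]
    norm_num
  exact isCompactOperator_of_tendsto hlim (Filter.Eventually.of_forall hcpt)

/-! ### Positive operators as mixtures of vectors -/

/-- The positive operator `T` is the sum of the operators `|vᵢ⟩⟨vᵢ|`, in the sense of quadratic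
forms.  The index set is arbitrary, and the vectors need not be orthogonal or of finite total
weight. -/
def IsMixture (v : ι → H) (T : H →L[ℂ] H) : Prop :=
  T.IsPositive ∧ ∀ h, ENNReal.ofReal (inner ℂ h (T h)).re = ∑' i, ‖inner ℂ (v i) h‖ₑ ^ 2

theorem IsMixture.unique {v : ι → H} {T T' : H →L[ℂ] H} (hT : IsMixture v T)
    (hT' : IsMixture v T') : T = T' := by
  have key : ∀ h, inner ℂ (T h) h = inner ℂ (T' h) h := by
    intro h
    have h1 := (hT.2 h).trans (hT'.2 h).symm
    have p1 := hT.1.inner_nonneg_right h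
    have p2 := hT'.1.inner_nonneg_right h
    rw [Complex.nonneg_iff] at p1 p2
    rw [ENNReal.ofReal_eq_ofReal_iff p1.1 p2.1] at h1
    rw [← inner_conj_symm, ← inner_conj_symm (T' h)]
    congr 1
    exact Complex.ext h1 (p1.2.symm.trans p2.2)
  rw [← ContinuousLinearMap.coe_inj]
  exact (ext_inner_map _ _).1 (fun x => by simpa using key x)

open ContinuousLinearMap in
theorem isMixture_comp_adjoint (b : HilbertBasis ι ℂ H) (M : H →L[ℂ] H') :
    IsMixture (fun i => M (b i)) (M.comp (adjoint M)) := by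
  refine ⟨isPositive_self_comp_adjoint M, fun h => ?_⟩
  rw [comp_apply, ← adjoint_inner_left, inner_self_eq_ofReal, Complex.ofReal_re]
  simp_rw [← adjoint_inner_right]
  rw [tsum_enorm_inner_sq, enorm_sq_eq_ofReal]

open ContinuousLinearMap in
theorem IsMixture.conj {v : ι → H} {T : H →L[ℂ] H} (hT : IsMixture v T) (S : H →L[ℂ] H') :
    IsMixture (fun i => S (v i)) (S.comp (T.comp (adjoint S))) := by
  refine ⟨hT.1.conj_adjoint S, fun h => ?_⟩
  rw [comp_apply, comp_apply, ← adjoint_inner_left, hT.2]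
  simp_rw [adjoint_inner_right]

theorem IsMixture.reindex {v : ι → H} {T : H →L[ℂ] H} (hT : IsMixture v T) (e : κ ≃ ι) :
    IsMixture (fun i => v (e i)) T :=
  ⟨hT.1, fun h => by rw [hT.2, ← e.tsum_eq]⟩

theorem isMixture_rankOne (x : H) :
    IsMixture (fun _ : Unit => x) (InnerProductSpace.rankOne ℂ x x) := by
  refine ⟨InnerProductSpace.isPositive_rankOne_self x, fun h => ?_⟩
  have e : inner ℂ h (InnerProductSpace.rankOne ℂ x x h) = ((‖inner ℂ x h‖ ^ 2 : ℝ) : ℂ) := by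
    rw [InnerProductSpace.rankOne_apply, inner_smul_right, ← inner_conj_symm h x, Complex.mul_conj,
      Complex.normSq_eq_norm_sq]
  rw [e, Complex.ofReal_re, tsum_fintype, Finset.sum_const, ← enorm_sq_eq_ofReal]
  simp

/-- The trace of a mixture. -/
theorem IsMixture.tsum_inner {v : ι → H} {T : H →L[ℂ] H} (hT : IsMixture v T)
    (b : HilbertBasis κ ℂ H) :
    ∑' k, ENNReal.ofReal (inner ℂ (b k) (T (b k))).re = ∑' i, ‖v i‖ₑ ^ 2 := by
  simp_rw [hT.2]
  rw [ENNReal.tsum_comm]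
  simp_rw [enorm_inner_comm (v _), tsum_enorm_inner_sq]

/-- The operator norm of a mixture is at most its trace. -/
theorem IsMixture.enorm_le {v : ι → H} {T : H →L[ℂ] H} (hT : IsMixture v T) :
    ‖T‖ₑ ≤ ∑' i, ‖v i‖ₑ ^ 2 := by
  by_cases htop : ∑' i, ‖v i‖ₑ ^ 2 = ⊤
  · rw [htop]; exact le_top
  have h0 : 0 ≤ T := (ContinuousLinearMap.nonneg_iff_isPositive T).2 hT.1
  set C := ∑' i, ‖v i‖ₑ ^ 2
  have : ‖T‖ ≤ C.toReal := by
    rw [CStarAlgebra.norm_le_iff_le_algebraMap T ENNReal.toReal_nonneg h0,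
      ContinuousLinearMap.le_def, ContinuousLinearMap.isPositive_iff_complex]
    intro x
    have hx : ENNReal.ofReal (inner ℂ x (T x)).re ≤ C * ‖x‖ₑ ^ 2 := by
      rw [hT.2, ← ENNReal.tsum_mul_right]
      exact ENNReal.tsum_le_tsum fun i => enorm_inner_sq_le _ _
    rw [enorm_sq_eq_ofReal, ← ENNReal.ofReal_toReal htop,
        ← ENNReal.ofReal_mul ENNReal.toReal_nonneg,
        ENNReal.ofReal_le_ofReal_iff (by positivity)] at hx
    have hp := hT.1.inner_nonneg_left x
    have hs : inner ℂ (T x) x = inner ℂ x (T x) := hT.1.inner_left_eq_inner_right x x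
    rw [Complex.nonneg_iff] at hp
    have e : inner ℂ ((algebraMap ℝ (H →L[ℂ] H) C.toReal - T) x) x
        = ((C.toReal * ‖x‖ ^ 2 - (inner ℂ x (T x)).re : ℝ) : ℂ) := by
      rw [_root_.sub_apply, inner_sub_left, Algebra.algebraMap_eq_smul_one]
      simp only [_root_.smul_apply, one_apply_eq_self]
      rw [show (C.toReal • x : H) = ((C.toReal : ℂ) • x) from (Complex.coe_smul _ _).symm,
        inner_smul_left, inner_self_eq_ofReal, ← hs]
      apply Complex.ext
      · simp [-Complex.ofReal_pow]
      · simp [-Complex.ofReal_pow, ← hp.2]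
    rw [e]
    rw [RCLike.re_eq_complex_re, Complex.ofReal_re]
    exact ⟨rfl, sub_nonneg.2 hx⟩
  rw [← ofReal_norm, ← ENNReal.ofReal_toReal htop]
  exact ENNReal.ofReal_le_ofReal this

/-- A family of mixtures of finite total weight is summable in norm, and its sum is a mixture. -/
theorem IsMixture.tsum {v : κ → ι → H} {T : κ → H →L[ℂ] H} (hT : ∀ k, IsMixture (v k) (T k))
    (hv : ∑' k, ∑' i, ‖v k i‖ₑ ^ 2 ≠ ⊤) :
    Summable T ∧ IsMixture (fun p : κ × ι => v p.1 p.2) (∑' k, T k) := by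
  have hsum : Summable T := by
    have : ∑' k, ‖T k‖ₑ ≠ ⊤ :=
      ne_top_of_le_ne_top hv (ENNReal.tsum_le_tsum fun k => (hT k).enorm_le)
    refine Summable.of_norm ?_
    have h2 := ENNReal.summable_toReal this
    simpa using h2
  have hq : ∀ h, HasSum (fun k => inner ℂ h (T k h)) (inner ℂ h ((∑' k, T k) h)) := by
    intro h
    have h1 := hsum.hasSum.mapL (ContinuousLinearMap.apply ℂ H h)
    exact h1.mapL (innerSL ℂ h)
  refine ⟨hsum, ?_, fun h => ?_⟩
  · rw [ContinuousLinearMap.isPositive_iff_complex]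
    intro x
    have h0 : 0 ≤ inner ℂ x ((∑' k, T k) x) :=
      (hq x).nonneg fun k => (hT k).1.inner_nonneg_right x
    rw [Complex.nonneg_iff] at h0
    rw [← inner_conj_symm ((∑' k, T k) x) x, RCLike.re_eq_complex_re]
    refine ⟨?_, by simpa only [Complex.conj_re] using h0.1⟩
    apply Complex.ext
    · simp only [Complex.ofReal_re, Complex.conj_re]
    · simp only [Complex.ofReal_im, Complex.conj_im, ← h0.2, neg_zero]
  · have h1 := Complex.hasSum_re (hq h)
    have h0 : ∀ k, 0 ≤ (inner ℂ h (T k h)).re := fun k =>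
      (Complex.nonneg_iff.1 ((hT k).1.inner_nonneg_right h)).1
    rw [← h1.tsum_eq, ENNReal.ofReal_tsum_of_nonneg h0 h1.summable, ENNReal.tsum_prod']
    exact tsum_congr fun k => (hT k).2 h

end Hilbert

/-! ### Eigenbases and entropy -/

section Spectral

variable {H : Type u} [NormedAddCommGroup H] [InnerProductSpace ℂ H] [CompleteSpace H]
variable {H' : Type*} [NormedAddCommGroup H'] [InnerProductSpace ℂ H']
variable {ι : Type*}

theorem hilbertBasis_clm_ext (b : HilbertBasis ι ℂ H) {f g : H →L[ℂ] H'}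
    (h : ∀ i, f (b i) = g (b i)) : f = g := by
  refine ContinuousLinearMap.ext_on (s := range b) ?_ ?_
  · exact Submodule.dense_iff_topologicalClosure_eq_top.2 b.dense_span
  · rintro _ ⟨i, rfl⟩
    exact h i

/-- A compact positive operator has a Hilbert basis of eigenvectors. -/
theorem exists_eigenbasis {T : H →L[ℂ] H} (hT : T.IsPositive) (hc : IsCompactOperator T) :
    ∃ (I : Type u) (b : HilbertBasis I ℂ H) (p : I → ℝ),
      (∀ i, 0 ≤ p i) ∧ ∀ i, T (b i) = (p i : ℂ) • b i := by
  let E : ℂ → Submodule ℂ H := fun μ => Module.End.eigenspace (T : Module.End ℂ H) μ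
  have hE : ∀ μ x, x ∈ E μ ↔ T x = μ • x := fun μ x => Module.End.mem_eigenspace_iff
  have hcl : ∀ μ, IsClosed (E μ : Set H) := by
    intro μ
    have : (E μ : Set H) = {x | T x = μ • x} := by ext x; exact hE μ x
    rw [this]
    exact isClosed_eq T.continuous (continuous_const_smul μ)
  have : ∀ μ, CompleteSpace (E μ) := fun μ => (hcl μ).completeSpace_coe
  choose w c hwc using fun μ => exists_hilbertBasis ℂ (E μ)
  have hsym := hT.isSymmetric
  have hfam := hsym.orthogonalFamily_eigenspaces
  have hon : Orthonormal ℂ (fun a : Σ μ, w μ => ((c a.1 a.2 : E a.1) : H)) :=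
    hfam.orthonormal_sigma_orthonormal (v_family := fun μ i => c μ i) fun μ => (c μ).orthonormal
  have hbot : (Submodule.span ℂ (range fun a : Σ μ, w μ => ((c a.1 a.2 : E a.1) : H)))ᗮ = ⊥ := by
    rw [eq_bot_iff, ← ContinuousLinearMap.orthogonalComplement_iSup_eigenspaces_eq_bot hc hsym]
    intro x hx
    rw [← Submodule.iInf_orthogonal, Submodule.mem_iInf]
    intro μ
    rw [Submodule.mem_orthogonal']
    have h0 : (innerSL ℂ x).comp (E μ).subtypeL = 0 := by
      refine hilbertBasis_clm_ext (c μ) fun i => ?_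
      rw [Submodule.mem_orthogonal'] at hx
      simpa using hx _ (Submodule.subset_span ⟨⟨μ, i⟩, rfl⟩)
    intro y hy
    simpa using DFunLike.congr_fun h0 ⟨y, hy⟩
  let b := HilbertBasis.mkOfOrthogonalEqBot hon hbot
  have hb : ∀ a : Σ μ, w μ, b a = ((c a.1 a.2 : E a.1) : H) := fun a => by
    simp only [b, HilbertBasis.coe_mkOfOrthogonalEqBot]
  have hTb : ∀ a, T (b a) = a.1 • b a := fun a => by
    rw [hb]; exact (hE _ _).1 (c a.1 a.2).2
  have hμ : ∀ a : Σ μ, w μ, inner ℂ (b a) (T (b a)) = a.1 := fun a => by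
    rw [hTb, inner_smul_right, inner_self_eq_ofReal, b.orthonormal.1]; simp
  have hnn : ∀ a : Σ μ, w μ, 0 ≤ a.1 := fun a => by
    rw [← hμ a]; exact hT.inner_nonneg_right _
  refine ⟨_, b, fun a => a.1.re, fun a => (Complex.nonneg_iff.1 (hnn a)).1, fun a => ?_⟩
  rw [hTb]
  congr 1
  exact Complex.ext rfl (by simpa using (Complex.nonneg_iff.1 (hnn a)).2.symm)

/-- The continuous functional calculus acts on eigenvectors through the eigenvalue. -/
theorem cfc_apply_eigenvector {T : H →L[ℂ] H} (hT : IsSelfAdjoint T) {f : ℝ → ℝ}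
    (hf : Continuous f) {x : H} {p : ℝ} (hx : T x = (p : ℂ) • x) :
    cfc f T x = (f p : ℂ) • x := by
  have hpoly : ∀ q : Polynomial ℝ, Polynomial.aeval T q x = ((q.eval p : ℝ) : ℂ) • x := by
    intro q
    induction q using Polynomial.induction_on' with
    | add q r hq hr => simp [hq, hr, add_smul]
    | monomial n a =>
      have hn : ∀ n : ℕ, (T ^ n) x = ((p : ℂ) ^ n) • x := by
        intro n
        induction n with
        | zero => simp
        | succ n ih => rw [pow_succ', mul_apply_eq_comp, ih, map_smul, hx, smul_smul,
            ← pow_succ]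
      rw [Polynomial.aeval_monomial, Algebra.algebraMap_eq_smul_one, smul_mul_assoc, one_mul]
      simp only [_root_.smul_apply, hn, Polynomial.eval_monomial]
      rw [← Complex.coe_smul, smul_smul]
      push_cast; rfl
  refine eq_of_sub_eq_zero (norm_le_zero_iff.1 (le_of_forall_pos_le_add fun ε hε => ?_))
  set R := max ‖T‖ |p|
  set δ := ε / (2 * (‖x‖ + 1))
  have hδ : 0 < δ := by positivity
  -- The claim holds for polynomials, and `f` is approximated by a polynomial `q` uniformly on
  -- `[-R, R]`, which contains the spectrum of `T` and the point `p`.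
  obtain ⟨q, hq⟩ := exists_polynomial_near_of_continuousOn (-R) R f hf.continuousOn δ hδ
  have h1 : ‖cfc f T - Polynomial.aeval T q‖ ≤ δ := by
    rw [← cfc_polynomial q T hT, ← cfc_sub f (fun t => q.eval t) T hf.continuousOn
      q.continuous.continuousOn]
    refine norm_cfc_le hδ.le fun t ht => ?_
    have : ‖t‖ ≤ ‖T‖ := by
      by_cases hs : Subsingleton H
      · exfalso
        have : Subsingleton (H →L[ℂ] H) := ⟨fun a b => by ext y; exact Subsingleton.elim _ _⟩
        rw [spectrum.of_subsingleton] at ht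
        exact ht
      · have : Nontrivial H := not_subsingleton_iff_nontrivial.1 hs
        exact spectrum.norm_le_norm_of_mem ht
    rw [norm_sub_rev, Real.norm_eq_abs]
    refine (hq t ?_).le
    rw [Real.norm_eq_abs, abs_le] at this
    exact ⟨by linarith [le_max_left ‖T‖ |p|], by linarith [le_max_left ‖T‖ |p|]⟩
  have h2 : |q.eval p - f p| ≤ δ := (hq p (abs_le.1 (le_max_right _ _))).le
  have h3 : cfc f T x - (f p : ℂ) • x = (cfc f T - Polynomial.aeval T q) x
      + ((q.eval p - f p : ℝ) : ℂ) • x := by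
    rw [_root_.sub_apply, hpoly]; push_cast; rw [sub_smul]; abel
  rw [h3, zero_add]
  calc _ ≤ ‖(cfc f T - Polynomial.aeval T q) x‖ + ‖((q.eval p - f p : ℝ) : ℂ) • x‖ :=
        norm_add_le _ _
    _ ≤ δ * ‖x‖ + δ * ‖x‖ := by
        gcongr
        · exact (ContinuousLinearMap.le_opNorm _ _).trans (by gcongr)
        · rw [norm_smul, Complex.norm_real, Real.norm_eq_abs]; gcongr
    _ ≤ ε := by
        have : δ * (2 * (‖x‖ + 1)) = ε := by simp only [δ]; field_simp
        nlinarith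

end Spectral

/-- The entropy of a self-adjoint operator in terms of an eigenbasis. -/
theorem entropy_eq_tsum {X : Type u} {I : Type*} {T : Op X} (hT : IsSelfAdjoint T)
    (b : HilbertBasis I ℂ (Hilb X)) {p : I → ℝ} (hp : ∀ i, 0 ≤ Real.negMulLog (p i))
    (hb : ∀ i, T (b i) = (p i : ℂ) • b i) :
    entropy T = ∑' i, ENNReal.ofReal (Real.negMulLog (p i)) := by
  set N := negMulLogOp T with hN
  have hNb : ∀ i, N (b i) = (Real.negMulLog (p i) : ℂ) • b i := fun i =>
    cfc_apply_eigenvector hT Real.continuous_negMulLog (hb i)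
  have hNs : IsSelfAdjoint N := cfc_predicate _ _
  have hq : ∀ h, HasSum (fun i => Real.negMulLog (p i) * ‖inner ℂ (b i) h‖ ^ 2)
      (inner ℂ h (N h)).re := by
    intro h
    have := Complex.hasSum_re (b.hasSum_inner_mul_inner h (N h))
    convert this using 2 with i
    have : inner ℂ (b i) (N h) = inner ℂ (N (b i)) h := by
      rw [← ContinuousLinearMap.adjoint_inner_left, ← ContinuousLinearMap.star_eq_adjoint,
        hNs.star_eq]
    rw [this, hNb, inner_smul_left, Complex.conj_ofReal, mul_left_comm,
      ← inner_conj_symm h (b i), mul_comm ((starRingEnd ℂ) _), Complex.mul_conj,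
      Complex.normSq_eq_norm_sq, ← Complex.ofReal_mul, Complex.ofReal_re]
  have hq' : ∀ h, ENNReal.ofReal (inner ℂ h (N h)).re
      = ∑' i, ENNReal.ofReal (Real.negMulLog (p i)) * ‖inner ℂ (b i) h‖ₑ ^ 2 := by
    intro h
    rw [← (hq h).tsum_eq, ENNReal.ofReal_tsum_of_nonneg
      (fun i => mul_nonneg (hp i) (by positivity)) (hq h).summable]
    refine tsum_congr fun i => ?_
    rw [ENNReal.ofReal_mul (hp i), enorm_sq_eq_ofReal]
  simp only [entropy, ← hN, hq']
  rw [ENNReal.tsum_comm]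
  refine tsum_congr fun i => ?_
  rw [ENNReal.tsum_mul_left]
  simp_rw [enorm_inner_comm (b i)]
  rw [show ∑' x, ‖inner ℂ (ket x) (b i)‖ₑ ^ 2 = ‖b i‖ₑ ^ 2 from
    tsum_enorm_inner_sq (stdBasis X) (b i), enorm_sq_eq_ofReal, b.orthonormal.1]
  simp

/-! ### Vectors and operators on `ℓ²(X)` -/

section Basic

variable {X X' Y Z ι : Type u}
variable {H : Type*} [NormedAddCommGroup H] [InnerProductSpace ℂ H] [CompleteSpace H]

theorem hilb_ext {φ ψ : Hilb X} (h : ∀ x, inner ℂ (ket x) φ = inner ℂ (ket x) ψ) : φ = ψ := by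
  apply (stdBasis X).repr.injective
  ext x
  rw [HilbertBasis.repr_apply_apply, HilbertBasis.repr_apply_apply]
  exact h x

theorem clm_ext_ket {S T : Hilb X →L[ℂ] H} (h : ∀ x, S (ket x) = T (ket x)) : S = T :=
  hilbertBasis_clm_ext (stdBasis X) h

theorem tsum_enorm_ket_sq (φ : Hilb X) : ∑' x, ‖inner ℂ (ket x) φ‖ₑ ^ 2 = ‖φ‖ₑ ^ 2 :=
  tsum_enorm_inner_sq (stdBasis X) φ

theorem inner_ket_ket [DecidableEq X] (x y : X) :
    inner ℂ (ket x) (ket y) = if x = y then 1 else 0 :=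
  orthonormal_iff_ite.1 (orthonormal_ket X) x y

/-- The isometry from `ℓ²(I)` that maps the standard basis to an orthonormal family. -/
noncomputable def onIso {I : Type*} {v : I → H} (hv : Orthonormal ℂ v) : Hilb I →ₗᵢ[ℂ] H :=
  hv.orthogonalFamily.linearIsometry.comp (stdBasis I).repr.toLinearIsometry

theorem onIso_ket {I : Type*} {v : I → H} (hv : Orthonormal ℂ v) (i : I) :
    onIso hv (ket i) = v i := by
  classical
  have : (stdBasis I).repr (ket i) = lp.single 2 i (1 : ℂ) := (stdBasis I).repr_self i
  change hv.orthogonalFamily.linearIsometry ((stdBasis I).repr (ket i)) = v i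
  rw [this, OrthogonalFamily.linearIsometry_apply_single]
  simp

/-- Square summable coefficients define a vector. -/
theorem exists_hilb (f : X → ℂ) (hf : Summable fun x => ‖f x‖ ^ 2) :
    ∃ φ : Hilb X, ∀ x, inner ℂ (ket x) φ = f x := by
  have hm : Memℓp f 2 := memℓp_gen (by simpa using hf)
  refine ⟨(stdBasis X).repr.symm ⟨f, hm⟩, fun x => ?_⟩
  have := (stdBasis X).repr_apply_apply ((stdBasis X).repr.symm ⟨f, hm⟩) x
  rw [LinearIsometryEquiv.apply_symm_apply] at this
  exact this.symm

theorem summable_coef_sq (φ : Hilb X) : Summable fun x => ‖inner ℂ (ket x) φ‖ ^ 2 := by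
  have h := tsum_enorm_ket_sq φ
  have h2 := ENNReal.summable_toReal (f := fun x => ‖inner ℂ (ket x) φ‖ₑ ^ 2)
    (by rw [h]; simp)
  simpa using h2

theorem hasSum_inner_ket (φ ψ : Hilb X) :
    HasSum (fun x => inner ℂ φ (ket x) * inner ℂ (ket x) ψ) (inner ℂ φ ψ) :=
  (stdBasis X).hasSum_inner_mul_inner φ ψ

theorem exists_conj (φ : Hilb X) :
    ∃ φ' : Hilb X, ∀ x, inner ℂ (ket x) φ' = starRingEnd ℂ (inner ℂ (ket x) φ) :=
  exists_hilb _ (by simp_rw [RCLike.norm_conj]; exact summable_coef_sq φ)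

/-- Complex conjugation of the coefficients of a vector. -/
noncomputable def conjV (φ : Hilb X) : Hilb X :=
  (exists_conj φ).choose

theorem inner_ket_conjV (φ : Hilb X) (x : X) :
    inner ℂ (ket x) (conjV φ) = starRingEnd ℂ (inner ℂ (ket x) φ) :=
  (exists_conj φ).choose_spec x

theorem inner_conjV_conjV (φ ψ : Hilb X) : inner ℂ (conjV φ) (conjV ψ) = inner ℂ ψ φ := by
  refine (hasSum_inner_ket _ _).unique ?_
  convert hasSum_inner_ket ψ φ using 2 with x
  rw [← inner_conj_symm, inner_ket_conjV, inner_ket_conjV, Complex.conj_conj, mul_comm,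
    inner_conj_symm]

theorem conjV_conjV (φ : Hilb X) : conjV (conjV φ) = φ :=
  hilb_ext fun x => by rw [inner_ket_conjV, inner_ket_conjV, Complex.conj_conj]

theorem conjV_smul_ofReal (r : ℝ) (φ : Hilb X) : conjV ((r : ℂ) • φ) = (r : ℂ) • conjV φ :=
  hilb_ext fun x => by
    rw [inner_ket_conjV, inner_smul_right, inner_smul_right, inner_ket_conjV, map_mul,
      Complex.conj_ofReal]

theorem conjV_ket (x : X) : conjV (ket x) = ket x := by
  classical
  refine hilb_ext fun y => ?_
  rw [inner_ket_conjV, inner_ket_ket]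
  split_ifs <;> simp

/-- A mixture is of the form `M M†`, where `M` maps the standard basis to the given vectors. -/
theorem IsMixture.exists_factor {v : ι → H} {T : H →L[ℂ] H} (hT : IsMixture v T) :
    ∃ M : Hilb ι →L[ℂ] H, (∀ i, M (ket i) = v i) ∧ T = M.comp (adjoint M) := by
  have hs : ∀ h, Summable fun i => ‖inner ℂ (v i) h‖ ^ 2 := fun h => by
    have h2 := ENNReal.summable_toReal (f := fun i => ‖inner ℂ (v i) h‖ₑ ^ 2)
      (by rw [← hT.2]; simp)
    simpa using h2
  choose A hA using fun h => exists_hilb (fun i => inner ℂ (v i) h) (hs h)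
  let A' : H →ₗ[ℂ] Hilb ι :=
    { toFun := A
      map_add' := fun x y => hilb_ext fun i => by
        rw [hA, inner_add_right, inner_add_right, hA, hA]
      map_smul' := fun c x => hilb_ext fun i => by
        rw [hA, inner_smul_right, RingHom.id_apply, inner_smul_right, hA] }
  have hb : ∀ h, ‖A' h‖ ≤ Real.sqrt ‖T‖ * ‖h‖ := fun h => by
    have h1 : ‖A h‖ₑ ^ 2 = ENNReal.ofReal (inner ℂ h (T h)).re := by
      rw [hT.2, ← tsum_enorm_ket_sq]; simp_rw [hA]
    rw [enorm_sq_eq_ofReal, ENNReal.ofReal_eq_ofReal_iff (by positivity)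
      (Complex.nonneg_iff.1 (hT.1.inner_nonneg_right h)).1] at h1
    have h2 : ‖A h‖ ^ 2 ≤ ‖T‖ * ‖h‖ ^ 2 := by
      rw [h1]
      calc _ ≤ ‖inner ℂ h (T h)‖ := Complex.re_le_norm _
        _ ≤ ‖h‖ * ‖T h‖ := norm_inner_le_norm _ _
        _ ≤ ‖h‖ * (‖T‖ * ‖h‖) := by gcongr; exact T.le_opNorm h
        _ = _ := by ring
    calc ‖A h‖ = Real.sqrt (‖A h‖ ^ 2) := (Real.sqrt_sq (norm_nonneg _)).symm
      _ ≤ Real.sqrt (‖T‖ * ‖h‖ ^ 2) := Real.sqrt_le_sqrt h2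
      _ = _ := by rw [Real.sqrt_mul (norm_nonneg _), Real.sqrt_sq (norm_nonneg _)]
  let B : H →L[ℂ] Hilb ι := A'.mkContinuous _ hb
  have hB : ∀ i, adjoint B (ket i) = v i := fun i => by
    refine ext_inner_right ℂ fun h => ?_
    rw [adjoint_inner_left]
    exact hA h i
  refine ⟨adjoint B, hB, hT.unique ?_⟩
  have := isMixture_comp_adjoint (stdBasis ι) (adjoint B)
  convert this using 2 with i
  exact (hB i).symm

theorem IsMixture.hasSum_inner {v : ι → H} {T : H →L[ℂ] H} (hT : IsMixture v T) (k h : H) :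
    HasSum (fun i => inner ℂ k (v i) * inner ℂ (v i) h) (inner ℂ k (T h)) := by
  obtain ⟨M, hM, rfl⟩ := hT.exists_factor
  have := hasSum_inner_ket (adjoint M k) (adjoint M h)
  rw [adjoint_inner_left, ← ContinuousLinearMap.comp_apply] at this
  refine this.congr_fun fun i => ?_
  rw [adjoint_inner_left, adjoint_inner_right, hM]

/-- Mixtures of finite total weight are compact, since they factor through a Hilbert–Schmidt
operator. -/
theorem IsMixture.isCompactOperator {v : ι → H} {T : H →L[ℂ] H} (hT : IsMixture v T)
    (hv : ∑' i, ‖v i‖ₑ ^ 2 ≠ ⊤) : IsCompactOperator T := by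
  obtain ⟨M, hM, rfl⟩ := hT.exists_factor
  have : IsCompactOperator M := isCompactOperator_of_tsum_ne_top (stdBasis ι) M (by
    simp_rw [← hM] at hv
    exact hv)
  exact this.comp_clm (adjoint M)

/-- The eigenvalues of a mixture of total weight one form a probability distribution. -/
theorem IsMixture.exists_eigenbasis {H : Type u} [NormedAddCommGroup H] [InnerProductSpace ℂ H]
    [CompleteSpace H] {v : ι → H} {T : H →L[ℂ] H} (hT : IsMixture v T)
    (hv : ∑' i, ‖v i‖ₑ ^ 2 = 1) :
    ∃ (I : Type u) (b : HilbertBasis I ℂ H) (p : I → ℝ), (∀ i, 0 ≤ p i) ∧ (∀ i, p i ≤ 1) ∧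
      ∑' i, ENNReal.ofReal (p i) = 1 ∧ ∀ i, T (b i) = (p i : ℂ) • b i := by
  obtain ⟨I, b, p, hp, hb⟩ := Squashed.exists_eigenbasis hT.1 (hT.isCompactOperator (by simp [hv]))
  have hsum : ∑' i, ENNReal.ofReal (p i) = 1 := by
    rw [← hv, ← hT.tsum_inner b]
    refine tsum_congr fun i => ?_
    rw [hb, inner_smul_right, inner_self_eq_ofReal, b.orthonormal.1]
    simp
  refine ⟨I, b, p, hp, fun i => ?_, hsum, hb⟩
  have := ENNReal.le_tsum (f := fun i => ENNReal.ofReal (p i)) i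
  rw [hsum] at this
  simpa using this

/-- The entropy is determined by an orthonormal family of eigenvectors, which need not be
complete, if the operator vanishes on the orthogonal complement of the family. -/
theorem entropy_eq_of_orthonormal {J : Type*} {T : Op X} (hT : IsSelfAdjoint T) {s : J → Hilb X}
    (hs : Orthonormal ℂ s) {p : J → ℝ} (hp : ∀ j, 0 ≤ Real.negMulLog (p j))
    (hTs : ∀ j, T (s j) = (p j : ℂ) • s j)
    (hT0 : ∀ h, (∀ j, inner ℂ (s j) h = 0) → T h = 0) :
    entropy T = ∑' j, ENNReal.ofReal (Real.negMulLog (p j)) := by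
  classical
  have hinj : Function.Injective s := hs.linearIndependent.injective
  -- Complete the family to a Hilbert basis; the additional eigenvalues are `0` and contribute
  -- nothing.
  obtain ⟨w, b, hw, hb⟩ := (hs.toSubtypeRange).exists_hilbertBasis_extension
  let g : J → w := fun j => ⟨s j, hw ⟨j, rfl⟩⟩
  have hg : Function.Injective g := fun i j h => hinj (Subtype.ext_iff.1 h)
  let q : w → ℝ := Function.extend g p 0
  have hqg : ∀ j, q (g j) = p j := fun j => hg.extend_apply _ _ _
  have hq0 : ∀ x, x ∉ range g → q x = 0 := fun x hx =>
    Function.extend_apply' _ _ _ (by simpa using hx)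
  rw [entropy_eq_tsum hT b (p := q)]
  · rw [← hg.tsum_eq]
    · simp_rw [hqg]
    · intro x hx
      by_contra h
      exact hx (by simp [hq0 x h])
  · intro x
    by_cases h : x ∈ range g
    · obtain ⟨j, rfl⟩ := h; rw [hqg]; exact hp j
    · simp [hq0 x h]
  · intro x
    by_cases h : x ∈ range g
    · obtain ⟨j, rfl⟩ := h
      rw [hqg, hb]; exact hTs j
    · rw [hq0 x h]
      simp only [Complex.ofReal_zero, zero_smul]
      refine hT0 _ fun j => ?_
      have : s j = b (g j) := by rw [hb]
      rw [this]
      exact b.orthonormal.2 fun e => h ⟨j, e⟩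

/-- `M M†` and `M† M` have the same entropy. -/
theorem entropy_comp_adjoint (M : Hilb Y →L[ℂ] Hilb Z) (hM : ∑' y, ‖M (ket y)‖ₑ ^ 2 = 1) :
    entropy (M.comp (adjoint M)) = entropy ((adjoint M).comp M) := by
  have hmix : IsMixture (fun y => M (ket y)) (M.comp (adjoint M)) :=
    isMixture_comp_adjoint (stdBasis Y) M
  obtain ⟨I, b, p, hp0, hp1, -, hb⟩ := hmix.exists_eigenbasis hM
  let J := {i // p i ≠ 0}
  have hη : ∀ i, 0 ≤ Real.negMulLog (p i) := fun i => Real.negMulLog_nonneg (hp0 i) (hp1 i)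
  have h1 := entropy_eq_of_orthonormal (T := M.comp (adjoint M)) hmix.1.isSelfAdjoint
    (s := fun i : J => b i) (b.orthonormal.comp _ Subtype.val_injective) (p := fun i => p i)
    (fun j => hη j) (fun j => hb j) (fun h hh => by
      refine (b.repr.injective (lp.ext (funext fun i => ?_)))
      rw [HilbertBasis.repr_apply_apply, map_zero, ← hmix.1.inner_left_eq_inner_right, hb,
        inner_smul_left]
      by_cases hi : p i = 0
      · simp [hi]
      · simp [hh ⟨i, hi⟩])
  have hin : ∀ i j, inner ℂ (adjoint M (b i)) (adjoint M (b j)) = p j * inner ℂ (b i) (b j) := by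
    intro i j
    rw [adjoint_inner_left, ← inner_smul_right, ← hb]; rfl
  have h0 : ∀ i, p i = 0 → adjoint M (b i) = 0 := fun i hi => by
    rw [← inner_self_eq_zero (𝕜 := ℂ), hin, hi]; simp
  -- The normalised vectors `M† bᵢ` with `pᵢ ≠ 0` are eigenvectors of `M† M`.
  let s : J → Hilb Y := fun i => ((Real.sqrt (p i))⁻¹ : ℂ) • adjoint M (b i)
  have hsq : ∀ i : J, ((Real.sqrt (p i) : ℝ) : ℂ) ≠ 0 := fun i => by
    have : 0 < p i := lt_of_le_of_ne (hp0 _) (Ne.symm i.2)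
    exact_mod_cast (Real.sqrt_pos.2 this).ne'
  have hs : Orthonormal ℂ s := by
    classical
    rw [orthonormal_iff_ite]
    intro i j
    simp only [s, inner_smul_left, inner_smul_right, hin, map_inv₀, Complex.conj_ofReal]
    rw [orthonormal_iff_ite.1 b.orthonormal]
    by_cases hij : i = j
    · subst hij
      have : ((p i : ℝ) : ℂ) = (Real.sqrt (p i) : ℝ) * (Real.sqrt (p i) : ℝ) := by
        rw [← Complex.ofReal_mul, Real.mul_self_sqrt (hp0 _)]
      simp only [if_true]
      rw [this]
      field_simp [hsq i]
    · rw [if_neg hij, if_neg (fun h => hij (Subtype.ext h))]; simp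
  have h2 := entropy_eq_of_orthonormal (T := (adjoint M).comp M)
    (ContinuousLinearMap.isPositive_adjoint_comp_self M).isSelfAdjoint hs (p := fun i => p i)
    (fun j => hη j) (fun j => by
      simp only [s, map_smul]
      rw [smul_comm]
      congr 1
      rw [← map_smul, ← hb]; rfl) (fun h hh => by
      rw [ContinuousLinearMap.comp_apply]
      have : M h = 0 := by
        refine (b.repr.injective (lp.ext (funext fun i => ?_)))
        rw [HilbertBasis.repr_apply_apply, map_zero, ← adjoint_inner_left]
        by_cases hi : p i = 0
        · simp [h0 i hi]
        · have := hh ⟨i, hi⟩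
          simp only [s, inner_smul_left] at this
          rcases mul_eq_zero.1 this with h | h
          · exfalso
            simp only [map_inv₀, Complex.conj_ofReal, inv_eq_zero] at h
            exact hsq ⟨i, hi⟩ h
          · simpa using h
      rw [this, map_zero])
  rw [h1, h2]

/-- The complex conjugate of a state has the same entropy. -/
theorem entropy_conjV {v : ι → Hilb X} {T T' : Op X} (hT : IsMixture v T)
    (hT' : IsMixture (fun i => conjV (v i)) T') (hv : ∑' i, ‖v i‖ₑ ^ 2 = 1) :
    entropy T = entropy T' := by
  obtain ⟨I, b, p, hp0, hp1, -, hb⟩ := hT.exists_eigenbasis hv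
  have hη : ∀ i, 0 ≤ Real.negMulLog (p i) := fun i => Real.negMulLog_nonneg (hp0 i) (hp1 i)
  have hTc : ∀ h, T' (conjV h) = conjV (T h) := fun h => by
    refine hilb_ext fun x => ?_
    rw [← conjV_ket x, inner_conjV_conjV]
    refine (hT'.hasSum_inner _ _).unique ?_
    have := (hT.hasSum_inner (ket x) h).map (starRingEnd ℂ) Complex.continuous_conj
    rw [inner_conj_symm] at this
    convert this using 2 with i
    rw [inner_conjV_conjV, inner_conjV_conjV, Function.comp, map_mul, inner_conj_symm,
      inner_conj_symm]
  rw [entropy_eq_tsum hT.1.isSelfAdjoint b hη hb]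
  symm
  refine entropy_eq_of_orthonormal (s := fun i => conjV (b i)) hT'.1.isSelfAdjoint ?_ hη
    (fun i => by rw [hTc, hb, conjV_smul_ofReal]) fun h hh => ?_
  · classical
    rw [orthonormal_iff_ite]
    intro i j
    rw [inner_conjV_conjV, orthonormal_iff_ite.1 b.orthonormal]
    simp [eq_comm]
  · have : h = 0 := by
      rw [← conjV_conjV h]
      have : conjV h = 0 := by
        refine (b.repr.injective (lp.ext (funext fun i => ?_)))
        rw [HilbertBasis.repr_apply_apply, map_zero, ← conjV_conjV (b i), inner_conjV_conjV,
          ← inner_conj_symm, hh i]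
        simp
      rw [this]
      exact hilb_ext fun x => by rw [inner_ket_conjV]; simp
    rw [this, map_zero]

end Basic

/-! ### Partial traces of mixtures -/

section PartialTrace

variable {X X' Y Y' Z Z' ι : Type u}

theorem slice_ket (e : X ≃ Y × Z) (z : Z) (y : Y) : slice e z (ket y) = ket (e.symm (y, z)) :=
  onIso_ket (v := fun y : Y => (ket (e.symm (y, z)) : Hilb X))
    ((orthonormal_ket X).comp (fun y : Y => e.symm (y, z)) (fun a b h => by simpa using h)) y

/-- The component `⟨z|ψ` of a vector of a composite system. -/
noncomputable def component (e : X ≃ Y × Z) (ψ : Hilb X) (z : Z) : Hilb Y := adjoint (slice e z) ψ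

theorem inner_ket_component (e : X ≃ Y × Z) (ψ : Hilb X) (z : Z) (y : Y) :
    inner ℂ (ket y) (component e ψ z) = inner ℂ (ket (e.symm (y, z))) ψ := by
  rw [component, adjoint_inner_right, slice_ket]

theorem tsum_enorm_component_sq (e : X ≃ Y × Z) (ψ : Hilb X) :
    ∑' z, ‖component e ψ z‖ₑ ^ 2 = ‖ψ‖ₑ ^ 2 := by
  simp_rw [← tsum_enorm_ket_sq, inner_ket_component]
  rw [ENNReal.tsum_comm, ← ENNReal.tsum_prod, e.symm.tsum_eq (fun x => ‖inner ℂ (ket x) ψ‖ₑ ^ 2)]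

/-- The partial trace of a mixture is the mixture of the components of the vectors. -/
theorem IsMixture.ptrace (e : X ≃ Y × Z) {v : ι → Hilb X} {T : Op X} (hT : IsMixture v T)
    (hv : ∑' i, ‖v i‖ₑ ^ 2 ≠ ⊤) :
    IsMixture (fun p : Z × ι => component e (v p.2) p.1) (ptrace e T) := by
  have h1 : ∀ z, IsMixture (fun i => component e (v i) z)
      ((adjoint (slice e z)).comp (T.comp (slice e z))) := fun z => by
    have := hT.conj (adjoint (slice e z))
    rwa [ContinuousLinearMap.adjoint_adjoint] at this
  refine (IsMixture.tsum h1 ?_).2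
  rw [ENNReal.tsum_comm]
  simp_rw [tsum_enorm_component_sq]
  exact hv

/-- A pure state is a mixture of one vector. -/
theorem isMixture_ketbra (ψ : Hilb X) : IsMixture (fun _ : PUnit.{u+1} => ψ) (ketbra ψ) :=
  (isMixture_rankOne ψ).reindex (Equiv.ofUnique _ _)

/-- The reduced state of a pure state is the mixture of its components. -/
theorem isMixture_ptrace_ketbra (e : X ≃ Y × Z) (ψ : Hilb X) :
    IsMixture (component e ψ) (ptrace e (ketbra ψ)) :=
  ((isMixture_ketbra ψ).ptrace e (by simp)).reindex (Equiv.prodPUnit Z).symm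

theorem IsMixture.isState {v : ι → Hilb X} {T : Op X} (hT : IsMixture v T)
    (hv : ∑' i, ‖v i‖ₑ ^ 2 = 1) : IsState T := by
  refine ⟨hT.1, ?_⟩
  have h := hT.tsum_inner (stdBasis X)
  rw [hv] at h
  have h0 : ∀ x, 0 ≤ inner ℂ (ket x) (T (ket x)) := fun x => hT.1.inner_nonneg_right _
  have hre : ∀ x, inner ℂ (ket x) (T (ket x)) = ((inner ℂ (ket x) (T (ket x))).re : ℂ) := fun x =>
    Complex.ext rfl (by simpa using (Complex.nonneg_iff.1 (h0 x)).2.symm)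
  have h0' : ∀ x, 0 ≤ (inner ℂ (ket x) (T (ket x))).re := fun x => (Complex.nonneg_iff.1 (h0 x)).1
  have hs : Summable fun x => (inner ℂ (ket x) (T (ket x))).re := by
    have := ENNReal.summable_toReal
      (f := fun x => ENNReal.ofReal (inner ℂ (ket x) (T (ket x))).re) (by
        change (∑' x, ENNReal.ofReal (inner ℂ (stdBasis X x) (T (stdBasis X x))).re) ≠ ⊤
        simp [h])
    simpa only [ENNReal.toReal_ofReal (h0' _)] using this
  have h1 : ∑' x, (inner ℂ (ket x) (T (ket x))).re = 1 := by
    change ∑' x, ENNReal.ofReal (inner ℂ (ket x) (T (ket x))).re = 1 at h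
    rw [← ENNReal.ofReal_tsum_of_nonneg h0' hs] at h
    simpa using h
  have h2 := Complex.hasSum_ofReal (f := fun x => (inner ℂ (ket x) (T (ket x))).re) |>.2 hs.hasSum
  rw [h1] at h2
  simpa only [← hre, Complex.ofReal_one] using h2

/-- Every state is a mixture of vectors labelled by the basis. -/
theorem IsState.exists_isMixture {T : Op X} (hT : IsState T) :
    ∃ v : X → Hilb X, IsMixture v T ∧ ∑' i, ‖v i‖ₑ ^ 2 = 1 := by
  have h0 : 0 ≤ T := (ContinuousLinearMap.nonneg_iff_isPositive T).2 hT.1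
  set S := CFC.sqrt T
  have hS : S * S = T := CFC.sqrt_mul_sqrt_self T h0
  have hSs : adjoint S = S := by
    rw [← ContinuousLinearMap.star_eq_adjoint]
    exact (IsSelfAdjoint.of_nonneg (CFC.sqrt_nonneg T)).star_eq
  have hm := isMixture_comp_adjoint (stdBasis X) S
  rw [hSs] at hm
  change IsMixture _ (S * S) at hm
  rw [hS] at hm
  refine ⟨_, hm, ?_⟩
  rw [← hm.tsum_inner (stdBasis X)]
  have h1 := Complex.hasSum_re hT.2
  have h0' : ∀ x, 0 ≤ (inner ℂ (ket x) (T (ket x))).re := fun x =>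
    (Complex.nonneg_iff.1 (hT.1.inner_nonneg_right _)).1
  change ∑' x, ENNReal.ofReal (inner ℂ (ket x) (T (ket x))).re = 1
  rw [← ENNReal.ofReal_tsum_of_nonneg h0' h1.summable, h1.tsum_eq]
  simp

/-- A square summable family of vectors is the family of the components of a vector of a composite
system. -/
theorem exists_vector_of_components (v : Z → Hilb Y) (hv : ∑' z, ‖v z‖ₑ ^ 2 ≠ ⊤) (e : X ≃ Y × Z) :
    ∃ Φ : Hilb X, ∀ z, component e Φ z = v z := by
  obtain ⟨Φ, hΦ⟩ := exists_hilb (fun x : X => inner ℂ (ket (e x).1) (v (e x).2)) (by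
    have := ENNReal.summable_toReal
      (f := fun x => ‖inner ℂ (ket (e x).1) (v (e x).2)‖ₑ ^ 2) (by
        rw [e.tsum_eq (fun p : Y × Z => ‖inner ℂ (ket p.1) (v p.2)‖ₑ ^ 2),
          ENNReal.tsum_prod (f := fun y z => ‖inner ℂ (ket y) (v z)‖ₑ ^ 2), ENNReal.tsum_comm]
        simp_rw [tsum_enorm_ket_sq]
        exact hv)
    simpa using this)
  exact ⟨Φ, fun z => hilb_ext fun y => by simp [inner_ket_component, hΦ]⟩

/-! ### Entropies of the subsystems of a pure state -/

/-- The entropy of the subsystem `Y` of the system `X = Y × Z` in the pure state `ψ`. -/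
noncomputable def subEntropy (e : X ≃ Y × Z) (ψ : Hilb X) : ℝ≥0∞ := entropy (ptrace e (ketbra ψ))

/-- The two parts of a pure state have the same entropy: if `M` maps the basis vectors of `Z` to
the components of `ψ`, then the reduced states are `M M†` and the complex conjugate of `M† M`. -/
theorem subEntropy_swap (e : X ≃ Y × Z) {ψ : Hilb X} (hψ : ‖ψ‖ = 1) :
    subEntropy e ψ = subEntropy (e.trans (Equiv.prodComm Y Z)) ψ := by
  have hψ' : ‖ψ‖ₑ ^ 2 = 1 := by simp [enorm_sq_eq_ofReal, hψ]
  have h1 := isMixture_ptrace_ketbra e ψ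
  have h2 := isMixture_ptrace_ketbra (e.trans (Equiv.prodComm Y Z)) ψ
  obtain ⟨M, hM, hT⟩ := h1.exists_factor
  have hMn : ∑' z, ‖M (ket z)‖ₑ ^ 2 = 1 := by simp_rw [hM]; rw [tsum_enorm_component_sq, hψ']
  rw [subEntropy, hT, entropy_comp_adjoint M hMn]
  have h3 := isMixture_comp_adjoint (stdBasis Y) (adjoint M)
  rw [ContinuousLinearMap.adjoint_adjoint] at h3
  refine entropy_conjV h3 ?_ ?_
  · convert h2 using 1
    ext y
    refine hilb_ext fun z => ?_
    rw [inner_ket_conjV, inner_ket_component, adjoint_inner_right, hM, inner_conj_symm]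
    change inner ℂ (ket y) _ = _
    rw [inner_ket_component]
    rfl
  · rw [← tsum_enorm_apply_sq (stdBasis Z) (stdBasis Y)]
    exact hMn

/-- Isometries preserve the entropy. -/
theorem entropy_isometry {v : ι → Hilb Y} {T : Op Y} {T' : Op Y'} (U : Hilb Y →ₗᵢ[ℂ] Hilb Y')
    (hT : IsMixture v T) (hT' : IsMixture (fun i => U (v i)) T') (hv : ∑' i, ‖v i‖ₑ ^ 2 = 1) :
    entropy T = entropy T' := by
  obtain ⟨M, hM, rfl⟩ := hT.exists_factor
  set V : Hilb Y →L[ℂ] Hilb Y' := U.toContinuousLinearMap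
  have hVV : (adjoint V).comp V = ContinuousLinearMap.id ℂ _ := by
    ext1 x
    refine ext_inner_left ℂ fun y => ?_
    rw [ContinuousLinearMap.comp_apply, adjoint_inner_right]
    exact U.inner_map_map y x
  have h2 : T' = (V.comp M).comp (adjoint (V.comp M)) := by
    refine hT'.unique ?_
    convert isMixture_comp_adjoint (stdBasis ι) (V.comp M) using 2 with i
    exact congrArg U (hM i).symm
  have hMn : ∑' z, ‖M (ket z)‖ₑ ^ 2 = 1 := by simp_rw [hM]; exact hv
  have hVMn : ∑' z, ‖(V.comp M) (ket z)‖ₑ ^ 2 = 1 := by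
    rw [← hMn]
    refine tsum_congr fun z => ?_
    congr 1
    exact U.enorm_map _
  rw [h2, entropy_comp_adjoint _ hMn, entropy_comp_adjoint _ hVMn]
  congr 1
  rw [ContinuousLinearMap.adjoint_comp, ContinuousLinearMap.comp_assoc,
    ← ContinuousLinearMap.comp_assoc (adjoint V), hVV, ContinuousLinearMap.id_comp]

/-- The entropy of a subsystem does not depend on the labels of the basis. -/
theorem subEntropy_relabel (e : X ≃ Y × Z) (e' : X' ≃ Y' × Z') (σ : X ≃ X') (α : Y ≃ Y')
    (β : Z ≃ Z') (h : ∀ x, e' (σ x) = (α (e x).1, β (e x).2)) {ψ : Hilb X} {ψ' : Hilb X'}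
    (hψ : ‖ψ‖ = 1) (hσ : ∀ x, inner ℂ (ket (σ x)) ψ' = inner ℂ (ket x) ψ) :
    subEntropy e ψ = subEntropy e' ψ' := by
  have hψ' : ‖ψ‖ₑ ^ 2 = 1 := by simp [enorm_sq_eq_ofReal, hψ]
  let U := onIso ((orthonormal_ket Y').comp α α.injective)
  refine entropy_isometry U (isMixture_ptrace_ketbra e ψ) ?_ (by rw [tsum_enorm_component_sq, hψ'])
  convert (isMixture_ptrace_ketbra e' ψ').reindex β using 1
  ext z
  refine hilb_ext fun y' => ?_
  obtain ⟨y, rfl⟩ := α.surjective y'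
  have hU : U (ket y) = ket (α y) := onIso_ket _ y
  rw [← hU, U.inner_map_map, hU, inner_ket_component, inner_ket_component, ← hσ]
  congr 2
  rw [Equiv.eq_symm_apply, h]
  simp

/-- A relation between splittings which determines when they define the same subsystem. -/
theorem exists_equiv_of_kernel [Nonempty Z] [Nonempty Z'] (e : X ≃ Y × Z) (e' : X' ≃ Y' × Z')
    (σ : X ≃ X') (h : ∀ x x', (e x).1 = (e x').1 ↔ (e' (σ x)).1 = (e' (σ x')).1) :
    ∃ α : Y ≃ Y', ∀ x, α (e x).1 = (e' (σ x)).1 := by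
  let z₀ := Classical.arbitrary Z
  let z₀' := Classical.arbitrary Z'
  let f : Y → Y' := fun y => (e' (σ (e.symm (y, z₀)))).1
  have hf : ∀ x, f (e x).1 = (e' (σ x)).1 := fun x => (h _ _).1 (by simp)
  have hb : Function.Bijective f := by
    constructor
    · intro y₁ y₂ h12
      simpa using (h (e.symm (y₁, z₀)) (e.symm (y₂, z₀))).2 h12
    · intro y'
      refine ⟨(e (σ.symm (e'.symm (y', z₀')))).1, ?_⟩
      rw [hf]; simp
  exact ⟨Equiv.ofBijective f hb, hf⟩

/-- The entropy of a subsystem only depends on which basis labels agree on the subsystem, and which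
agree on the complementary system. -/
theorem subEntropy_congr (e : X ≃ Y × Z) (e' : X' ≃ Y' × Z') (σ : X ≃ X')
    (h₁ : ∀ x x', (e x).1 = (e x').1 ↔ (e' (σ x)).1 = (e' (σ x')).1)
    (h₂ : ∀ x x', (e x).2 = (e x').2 ↔ (e' (σ x)).2 = (e' (σ x')).2) {ψ : Hilb X} {ψ' : Hilb X'}
    (hψ : ‖ψ‖ = 1) (hσ : ∀ x, inner ℂ (ket (σ x)) ψ' = inner ℂ (ket x) ψ) :
    subEntropy e ψ = subEntropy e' ψ' := by
  have hX : Nonempty X := by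
    by_contra hX
    rw [not_nonempty_iff] at hX
    have : ψ = 0 := hilb_ext fun x => isEmptyElim x
    simp [this] at hψ
  obtain ⟨x₀⟩ := hX
  have : Nonempty Y := ⟨(e x₀).1⟩
  have : Nonempty Z := ⟨(e x₀).2⟩
  have : Nonempty Y' := ⟨(e' (σ x₀)).1⟩
  have : Nonempty Z' := ⟨(e' (σ x₀)).2⟩
  obtain ⟨α, hα⟩ := exists_equiv_of_kernel e e' σ h₁
  obtain ⟨β, hβ⟩ := exists_equiv_of_kernel (e.trans (Equiv.prodComm Y Z))
    (e'.trans (Equiv.prodComm Y' Z')) σ h₂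
  refine subEntropy_relabel e e' σ α β (fun x => ?_) hψ hσ
  rw [hα x]
  exact Prod.ext rfl (hβ x).symm

end PartialTrace

/-! ### The logarithm as an integral of resolvents -/

section Resolvents

open MeasureTheory

theorem hasDerivAt_log_ratio {x t : ℝ} (hx : 0 < x) (ht : 0 ≤ t) :
    HasDerivAt (fun t => Real.log (1 + t) - Real.log (x + t)) (1 / (1 + t) - 1 / (x + t)) t := by
  have h1 : HasDerivAt (fun t : ℝ => 1 + t) 1 t := (hasDerivAt_id t).const_add 1
  have h2 : HasDerivAt (fun t : ℝ => x + t) 1 t := (hasDerivAt_id t).const_add x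
  exact (h1.log (by positivity)).sub (h2.log (by positivity))

theorem tendsto_log_ratio {x : ℝ} (hx : 0 < x) :
    Filter.Tendsto (fun t => Real.log (1 + t) - Real.log (x + t)) Filter.atTop (nhds 0) := by
  have h : Filter.Tendsto (fun t : ℝ => (1 + t) / (x + t)) Filter.atTop (nhds 1) := by
    have h1 : Filter.Tendsto (fun t : ℝ => (1 - x) * (x + t)⁻¹) Filter.atTop (nhds 0) := by
      have := (tendsto_inv_atTop_zero.comp
        (Filter.tendsto_atTop_add_const_left Filter.atTop x Filter.tendsto_id)).const_mul (1 - x)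
      simpa using this
    have h2 := h1.const_add 1
    rw [add_zero] at h2
    refine h2.congr' ?_
    filter_upwards [Filter.eventually_gt_atTop 0] with t ht
    field_simp
    ring
  have h3 := h.log one_ne_zero
  rw [Real.log_one] at h3
  refine h3.congr' ?_
  filter_upwards [Filter.eventually_gt_atTop 0] with t ht
  rw [Real.log_div (by positivity) (by positivity)]

/-- The formula `log x = ∫₀^∞ (1 / (1 + t) - 1 / (x + t)) dt`.  The integrand has constant sign,
so the integral of its absolute value is `|log x|`. -/
theorem integrable_resolvent_and_integral {x : ℝ} (hx : 0 < x) :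
    IntegrableOn (fun t => 1 / (1 + t) - 1 / (x + t)) (Ioi 0) ∧
    ∫ t in Ioi (0 : ℝ), (1 / (1 + t) - 1 / (x + t)) = Real.log x ∧
    ∫ t in Ioi (0 : ℝ), ‖1 / (1 + t) - 1 / (x + t)‖ = |Real.log x| := by
  have hd : ∀ t ∈ Ici (0 : ℝ), HasDerivAt (fun t => Real.log (1 + t) - Real.log (x + t))
    (1 / (1 + t) - 1 / (x + t)) t := fun t ht => hasDerivAt_log_ratio hx ht
  have hl := tendsto_log_ratio hx
  rcases le_total 1 x with h1 | h1
  · have hp : ∀ t ∈ Ioi (0 : ℝ), 0 ≤ 1 / (1 + t) - 1 / (x + t) := fun t ht => by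
      have ht' : 0 < t := ht
      rw [sub_nonneg]
      exact one_div_le_one_div_of_le (by positivity) (by linarith)
    have hi := integral_Ioi_of_hasDerivAt_of_nonneg' hd hp hl
    simp only [add_zero, Real.log_one, zero_sub, neg_neg] at hi
    refine ⟨integrableOn_Ioi_deriv_of_nonneg' hd hp hl, hi, ?_⟩
    rw [abs_of_nonneg (Real.log_nonneg h1), ← hi]
    exact setIntegral_congr_fun measurableSet_Ioi fun t ht => Real.norm_of_nonneg (hp t ht)
  · have hp : ∀ t ∈ Ioi (0 : ℝ), 1 / (1 + t) - 1 / (x + t) ≤ 0 := fun t ht => by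
      have ht' : 0 < t := ht
      rw [sub_nonpos]
      exact one_div_le_one_div_of_le (by positivity) (by linarith)
    have hi := integral_Ioi_of_hasDerivAt_of_nonpos' hd hp hl
    simp only [add_zero, Real.log_one, zero_sub, neg_neg] at hi
    refine ⟨integrableOn_Ioi_deriv_of_nonpos' hd hp hl, hi, ?_⟩
    rw [abs_of_nonpos (Real.log_nonpos hx.le h1), ← hi, ← integral_neg]
    exact setIntegral_congr_fun measurableSet_Ioi fun t ht => Real.norm_of_nonpos (hp t ht)

/-- For a probability distribution `w`, the average of the integrand in the formula for `log x` is
an increasing affine function of the average of `x / (x + t)`. -/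
theorem hasSum_mul_resolvent {M : Type*} {w x : M → ℝ} {t : ℝ} (ht : 0 < t) (hw : ∀ i, 0 ≤ w i)
    (hx : ∀ i, 0 < x i) (h1 : HasSum w 1) :
    HasSum (fun i => w i * (1 / (1 + t) - 1 / (x i + t)))
      ((1 / (1 + t) - 1 / t) + t⁻¹ * ∑' i, w i * (x i / (x i + t))) := by
  have hterm : ∀ y : ℝ, 0 < y →
      1 / (1 + t) - 1 / (y + t) = (1 / (1 + t) - 1 / t) + t⁻¹ * (y / (y + t)) := fun y hy => by
    field_simp; ring
  have hsx : Summable fun i => w i * (x i / (x i + t)) := by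
    refine Summable.of_nonneg_of_le (fun i => ?_) (fun i => ?_) h1.summable
    · have := hw i; have := hx i; positivity
    · have := hx i
      exact mul_le_of_le_one_right (hw i) (by rw [div_le_one (by positivity)]; linarith)
  have := (h1.mul_left (1 / (1 + t) - 1 / t)).add (hsx.hasSum.mul_left t⁻¹)
  rw [mul_one] at this
  refine this.congr_fun fun i => ?_
  rw [hterm _ (hx i)]; ring

/-- Comparison of two averages of logarithms, from the comparison of the averages of the functions
`x ↦ x / (x + t)` for all `t > 0`. -/
theorem tsum_mul_log_le_of_countable {m m' : Type*} [Countable m] [Countable m'] {w x : m → ℝ}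
    {w' x' : m' → ℝ} (hw : ∀ i, 0 ≤ w i) (hx : ∀ i, 0 < x i) (hw' : ∀ i, 0 ≤ w' i)
    (hx' : ∀ i, 0 < x' i) (h1 : HasSum w 1) (h1' : HasSum w' 1)
    (hs : Summable fun i => w i * |Real.log (x i)|)
    (hs' : Summable fun i => w' i * |Real.log (x' i)|)
    (h : ∀ t > 0, ∑' i, w i * (x i / (x i + t)) ≤ ∑' i, w' i * (x' i / (x' i + t))) :
    ∑' i, w i * Real.log (x i) ≤ ∑' i, w' i * Real.log (x' i) := by
  -- Both sums as one sum over `m ⊕ m'`, with signed weights: the difference is the integral of a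
  -- function that is nonnegative by `h`.
  let W : m ⊕ m' → ℝ := Sum.elim (fun i => - w i) w'
  let V : m ⊕ m' → ℝ := Sum.elim x x'
  have hV : ∀ i, 0 < V i := by rintro (i | i); exacts [hx i, hx' i]
  let F : m ⊕ m' → ℝ → ℝ := fun i t => W i * (1 / (1 + t) - 1 / (V i + t))
  have hFi : ∀ i, IntegrableOn (F i) (Ioi 0) := fun i =>
    (integrable_resolvent_and_integral (hV i)).1.const_mul (W i)
  have hFv : ∀ i, ∫ t in Ioi (0 : ℝ), F i t = W i * Real.log (V i) := fun i => by
    rw [← (integrable_resolvent_and_integral (hV i)).2.1, ← integral_const_mul]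
  have hFn : ∀ i, ∫ t in Ioi (0 : ℝ), ‖F i t‖ = |W i| * |Real.log (V i)| := fun i => by
    rw [← (integrable_resolvent_and_integral (hV i)).2.2, ← integral_const_mul]
    simp only [F, norm_mul, Real.norm_eq_abs]
  have hsum : Summable fun i => ∫ t in Ioi (0 : ℝ), ‖F i t‖ := by
    simp_rw [hFn]
    refine Summable.sum _ ?_ ?_
    · simpa [Function.comp_def, W, V, abs_of_nonneg (hw _)] using hs
    · simpa [Function.comp_def, W, V, abs_of_nonneg (hw' _)] using hs'
  have key := hasSum_integral_of_summable_integral_norm hFi hsum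
  have hnn : 0 ≤ ∫ t in Ioi (0 : ℝ), ∑' i, F i t := by
    refine setIntegral_nonneg measurableSet_Ioi fun t ht => ?_
    have ht : 0 < t := ht
    have s1 := (hasSum_mul_resolvent ht hw hx h1).neg
    have s2 := hasSum_mul_resolvent ht hw' hx' h1'
    have : HasSum (fun i => F i t) _ := HasSum.sum (f := fun i => F i t)
      (by simpa [Function.comp_def, F, W, V] using s1)
      (by simpa [Function.comp_def, F, W, V] using s2)
    rw [this.tsum_eq]
    have := mul_le_mul_of_nonneg_left (h t ht) (inv_nonneg.2 ht.le)
    linarith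
  simp_rw [hFv] at key
  have a1 : Summable fun i => w i * Real.log (x i) := by
    refine Summable.of_norm ?_
    simpa [abs_mul, abs_of_nonneg (hw _)] using hs
  have a2 : Summable fun i => w' i * Real.log (x' i) := by
    refine Summable.of_norm ?_
    simpa [abs_mul, abs_of_nonneg (hw' _)] using hs'
  have : HasSum (fun i => W i * Real.log (V i)) _ := HasSum.sum
    (f := fun i => W i * Real.log (V i))
    (by simpa [Function.comp_def, W, V] using a1.hasSum.neg)
    (by simpa [Function.comp_def, W, V] using a2.hasSum)
  have e := key.unique this
  rw [e] at hnn
  linarith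

theorem tsum_support_mul {M : Type*} (w g : M → ℝ) :
    ∑' i : Function.support w, w i * g i = ∑' i, w i * g i :=
  tsum_subtype_eq_of_support_subset (f := fun i => w i * g i)
    (Function.support_mul_subset_left w g)

/-- In `tsum_mul_log_le_of_countable` the index sets may be arbitrary, because the supports of the
weights are countable, and `x` need only be positive where the weight is not zero. -/
theorem tsum_mul_log_le {m m' : Type*} {w x : m → ℝ}
    {w' x' : m' → ℝ} (hw : ∀ i, 0 ≤ w i) (hx : ∀ i, w i ≠ 0 → 0 < x i) (hw' : ∀ i, 0 ≤ w' i)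
    (hx' : ∀ i, w' i ≠ 0 → 0 < x' i) (h1 : HasSum w 1) (h1' : HasSum w' 1)
    (hs : Summable fun i => w i * |Real.log (x i)|)
    (hs' : Summable fun i => w' i * |Real.log (x' i)|)
    (h : ∀ t > 0, ∑' i, w i * (x i / (x i + t)) ≤ ∑' i, w' i * (x' i / (x' i + t))) :
    ∑' i, w i * Real.log (x i) ≤ ∑' i, w' i * Real.log (x' i) := by
  have c1 : Countable (Function.support w) := h1.summable.countable_support
  have c2 : Countable (Function.support w') := h1'.summable.countable_support
  have key := tsum_mul_log_le_of_countable (w := fun i : Function.support w => w i)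
    (x := fun i => x i) (w' := fun i : Function.support w' => w' i) (x' := fun i => x' i)
    (fun i => hw i) (fun i => hx i i.2) (fun i => hw' i) (fun i => hx' i i.2)
    (hasSum_subtype_support.2 h1) (hasSum_subtype_support.2 h1') (hs.subtype _) (hs'.subtype _)
    (fun t ht => by
      rw [tsum_support_mul w fun i => x i / (x i + t),
        tsum_support_mul w' fun i => x' i / (x' i + t)]
      exact h t ht)
  rwa [tsum_support_mul w fun i => Real.log (x i),
    tsum_support_mul w' fun i => Real.log (x' i)] at key

end Resolvents

/-! ### A variational formula for averages of resolvents -/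

section Variational

variable {H : Type*} [NormedAddCommGroup H] [InnerProductSpace ℂ H] [CompleteSpace H]
variable {H' : Type*} [NormedAddCommGroup H'] [InnerProductSpace ℂ H'] [CompleteSpace H']
variable {ι κ I : Type*}

/-- Sums of the form `∑ ‖Y vᵢ‖²` only depend on the operator, not on its decomposition. -/
theorem IsMixture.tsum_map_eq {v : ι → H} {v' : κ → H} {T : H →L[ℂ] H} (h : IsMixture v T)
    (h' : IsMixture v' T) (Y : H →L[ℂ] H') : ∑' i, ‖Y (v i)‖ₑ ^ 2 = ∑' i, ‖Y (v' i)‖ₑ ^ 2 := by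
  obtain ⟨w, b, -⟩ := exists_hilbertBasis ℂ H'
  rw [← (h.conj Y).tsum_inner b, ← (h'.conj Y).tsum_inner b]

theorem enorm_sqrt_smul_sq {p : ℝ} (hp : 0 ≤ p) (x : H) :
    ‖((Real.sqrt p : ℝ) : ℂ) • x‖ₑ ^ 2 = ENNReal.ofReal p * ‖x‖ₑ ^ 2 := by
  rw [enorm_smul, mul_pow]
  congr 1
  rw [enorm_sq_eq_ofReal, Complex.norm_real, Real.norm_eq_abs, sq_abs, Real.sq_sqrt hp]

/-- The spectral decomposition, with eigenvectors scaled by the square roots of the eigenvalues.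
-/
theorem isMixture_eigenbasis {T : H →L[ℂ] H} (hT : T.IsPositive) (b : HilbertBasis I ℂ H)
    {p : I → ℝ} (hp : ∀ i, 0 ≤ p i) (hb : ∀ i, T (b i) = (p i : ℂ) • b i) :
    IsMixture (fun i => ((Real.sqrt (p i) : ℝ) : ℂ) • b i) T := by
  refine ⟨hT, fun h => ?_⟩
  have hq : HasSum (fun i => p i * ‖inner ℂ (b i) h‖ ^ 2) (inner ℂ h (T h)).re := by
    refine (Complex.hasSum_re (b.hasSum_inner_mul_inner h (T h))).congr_fun fun i => ?_
    rw [← hT.inner_left_eq_inner_right, hb, inner_smul_left, Complex.conj_ofReal, mul_left_comm,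
      ← inner_conj_symm h (b i), mul_comm ((starRingEnd ℂ) _), Complex.mul_conj,
      Complex.normSq_eq_norm_sq, ← Complex.ofReal_mul, Complex.ofReal_re]
  rw [← hq.tsum_eq, ENNReal.ofReal_tsum_of_nonneg
    (fun i => mul_nonneg (hp i) (by positivity)) hq.summable]
  refine tsum_congr fun i => ?_
  rw [inner_smul_left, Complex.conj_ofReal, ENNReal.ofReal_mul (hp i), ← enorm_sq_eq_ofReal]
  exact (enorm_sqrt_smul_sq (hp i) (inner ℂ (b i) h)).symm

/-- The left-hand side is the minimum over `b` of the right-hand side, attained at `b = p / (p +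
r) * a`. -/
theorem parallel_le {p r : ℝ} (hp : 0 ≤ p) (hr : 0 ≤ r) (a b : ℂ) :
    p * r / (p + r) * ‖a‖ ^ 2 ≤ p * ‖a - b‖ ^ 2 + r * ‖b‖ ^ 2 := by
  rcases (add_nonneg hp hr).eq_or_lt with h | h
  · rw [← h]; simp; positivity
  · have h1 : ‖a‖ ≤ ‖a - b‖ + ‖b‖ := by simpa using norm_add_le (a - b) b
    have h2 : ‖a‖ ^ 2 ≤ (‖a - b‖ + ‖b‖) ^ 2 := by gcongr
    calc _ ≤ p * r / (p + r) * (‖a - b‖ + ‖b‖) ^ 2 := by gcongr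
      _ ≤ _ := by
        rw [div_mul_eq_mul_div, div_le_iff₀ h]
        nlinarith [sq_nonneg (p * ‖a - b‖ - r * ‖b‖)]

/-- The functional `∑_c ‖ψ_c - X ψ_c‖² + s ∑_k q_k ‖X† g_k‖²` of a bounded operator `X`. -/
noncomputable def quadCost (ψ : ι → H) (g : κ → H) (q : κ → ℝ) (s : ℝ) (X : H →L[ℂ] H) : ℝ≥0∞ :=
  ∑' c, ‖ψ c - X (ψ c)‖ₑ ^ 2
    + ENNReal.ofReal s * ∑' k, ENNReal.ofReal (q k) * ‖adjoint X (g k)‖ₑ ^ 2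

variable {ψ : ι → H} {T : H →L[ℂ] H} {u : HilbertBasis I ℂ H} {p : I → ℝ} {g : HilbertBasis κ ℂ H}
  {q : κ → ℝ} {s : ℝ}

/-- In an eigenbasis of `T` and the basis `g`, the functional is a sum over the matrix entries of
`X`, so that each entry can be minimised separately. -/
theorem quadCost_eq (hT : IsMixture ψ T) (hp : ∀ i, 0 ≤ p i) (hu : ∀ i, T (u i) = (p i : ℂ) • u i)
    (hq : ∀ k, 0 ≤ q k) (hs : 0 ≤ s) (X : H →L[ℂ] H) :
    quadCost ψ g q s X = ∑' z : I × κ, ENNReal.ofReal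
      (p z.1 * ‖inner ℂ (g z.2) (u z.1) - inner ℂ (g z.2) (X (u z.1))‖ ^ 2
        + s * q z.2 * ‖inner ℂ (g z.2) (X (u z.1))‖ ^ 2) := by
  have h1 : ∑' c, ‖ψ c - X (ψ c)‖ₑ ^ 2 = ∑' (i) (k), ENNReal.ofReal
      (p i * ‖inner ℂ (g k) (u i) - inner ℂ (g k) (X (u i))‖ ^ 2) := by
    have := hT.tsum_map_eq (isMixture_eigenbasis hT.1 u hp hu) (1 - X)
    refine this.trans (tsum_congr fun i => ?_)
    rw [map_smul, enorm_sqrt_smul_sq (hp i), ← tsum_enorm_inner_sq g, ← ENNReal.tsum_mul_left]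
    refine tsum_congr fun k => ?_
    rw [ENNReal.ofReal_mul (hp i), enorm_sq_eq_ofReal, ← inner_sub_right]
    rfl
  have h2 : ∑' k, ENNReal.ofReal (q k) * ‖adjoint X (g k)‖ₑ ^ 2 = ∑' (i) (k), ENNReal.ofReal
      (q k * ‖inner ℂ (g k) (X (u i))‖ ^ 2) := by
    rw [ENNReal.tsum_comm]
    refine tsum_congr fun k => ?_
    rw [← tsum_enorm_inner_sq u, ← ENNReal.tsum_mul_left]
    refine tsum_congr fun i => ?_
    rw [ENNReal.ofReal_mul (hq k), adjoint_inner_right, enorm_inner_comm, enorm_sq_eq_ofReal]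
  rw [quadCost, h1, h2, ← ENNReal.tsum_mul_left, ← ENNReal.tsum_add, ENNReal.tsum_prod']
  refine tsum_congr fun i => ?_
  rw [← ENNReal.tsum_mul_left, ← ENNReal.tsum_add]
  refine tsum_congr fun k => ?_
  rw [← ENNReal.ofReal_mul hs, ← ENNReal.ofReal_add (mul_nonneg (hp i) (by positivity))
    (mul_nonneg hs (mul_nonneg (hq k) (by positivity))), mul_assoc]

/-- The entrywise minimum is a lower bound of the functional. -/
theorem parallel_le_quadCost (hT : IsMixture ψ T) (hp : ∀ i, 0 ≤ p i)
    (hu : ∀ i, T (u i) = (p i : ℂ) • u i) (hq : ∀ k, 0 ≤ q k) (hs : 0 ≤ s) (X : H →L[ℂ] H) :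
    ∑' z : I × κ, ENNReal.ofReal (p z.1 * (s * q z.2) / (p z.1 + s * q z.2)
      * ‖inner ℂ (g z.2) (u z.1)‖ ^ 2) ≤ quadCost ψ g q s X := by
  rw [quadCost_eq hT hp hu hq hs]
  refine ENNReal.tsum_le_tsum fun z => ENNReal.ofReal_le_ofReal ?_
  exact parallel_le (hp _) (mul_nonneg hs (hq _)) _ _

/-- Finite rank operators almost attain the lower bound of `parallel_le_quadCost`: in the bases
`u` and `g`, they may be chosen to be optimal on finitely many matrix entries. -/
theorem exists_quadCost_le (hT : IsMixture ψ T) (hp : ∀ i, 0 ≤ p i)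
    (hu : ∀ i, T (u i) = (p i : ℂ) • u i) (hq : ∀ k, 0 ≤ q k) (hs : 0 ≤ s) (F : Finset (I × κ)) :
    ∃ X, quadCost ψ g q s X ≤ ∑' z : I × κ, ENNReal.ofReal (p z.1 * (s * q z.2) /
      (p z.1 + s * q z.2) * ‖inner ℂ (g z.2) (u z.1)‖ ^ 2)
      + ∑' z : {z // z ∉ F}, ENNReal.ofReal (p z.1.1 * ‖inner ℂ (g z.1.2) (u z.1.1)‖ ^ 2) := by
  classical
  -- The minimiser in `parallel_le` for the entries in `F`; the other entries are zero.
  let c : I × κ → ℝ := fun z => p z.1 / (p z.1 + s * q z.2)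
  let X : H →L[ℂ] H := ∑ z ∈ F, (innerSL ℂ (u z.1)).smulRight
    (((c z : ℂ) * inner ℂ (g z.2) (u z.1)) • g z.2)
  have hX : ∀ i k, inner ℂ (g k) (X (u i)) =
      if (i, k) ∈ F then (c (i, k) : ℂ) * inner ℂ (g k) (u i) else 0 := by
    intro i k
    have : X (u i)
        = ∑ z ∈ F, inner ℂ (u z.1) (u i) • (((c z : ℂ) * inner ℂ (g z.2) (u z.1)) • g z.2) := by
      simp [X]
    rw [this, inner_sum]
    simp_rw [inner_smul_right, orthonormal_iff_ite.1 u.orthonormal,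
      orthonormal_iff_ite.1 g.orthonormal]
    have : ∀ z ∈ F, ((if z.1 = i then (1 : ℂ) else 0) * ((c z : ℂ) * inner ℂ (g z.2) (u z.1) *
        if k = z.2 then 1 else 0))
        = if z = (i, k) then (c (i, k) : ℂ) * inner ℂ (g k) (u i) else 0 := by
      rintro ⟨i', k'⟩ -
      by_cases h1 : i' = i
      · by_cases h2 : k' = k
        · subst h1 h2; simp
        · simp [h2, Ne.symm h2]
      · simp [h1]
    rw [Finset.sum_congr rfl this, Finset.sum_ite_eq']
  refine ⟨X, ?_⟩
  rw [quadCost_eq hT hp hu hq hs,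
    show (∑' z : {z // z ∉ F}, ENNReal.ofReal (p z.1.1 * ‖inner ℂ (g z.1.2) (u z.1.1)‖ ^ 2))
      = ∑' z : ({z | z ∉ F} : Set (I × κ)),
        (fun z : I × κ => ENNReal.ofReal (p z.1 * ‖inner ℂ (g z.2) (u z.1)‖ ^ 2)) z from rfl,
    tsum_subtype {z | z ∉ F}
      fun z : I × κ => ENNReal.ofReal (p z.1 * ‖inner ℂ (g z.2) (u z.1)‖ ^ 2), ← ENNReal.tsum_add]
  refine ENNReal.tsum_le_tsum fun z => ?_
  obtain ⟨i, k⟩ := z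
  rw [hX]
  by_cases hz : (i, k) ∈ F
  · simp only [hz, if_true]
    refine le_trans (ENNReal.ofReal_le_ofReal (le_of_eq ?_)) le_self_add
    have e : inner ℂ (g k) (u i) - (c (i, k) : ℂ) * inner ℂ (g k) (u i)
        = ((1 - c (i, k) : ℝ) : ℂ) * inner ℂ (g k) (u i) := by push_cast; ring
    rw [e, norm_mul, norm_mul, Complex.norm_real, Complex.norm_real, mul_pow, mul_pow,
      Real.norm_eq_abs, Real.norm_eq_abs, sq_abs, sq_abs]
    simp only [c]
    rcases (add_nonneg (hp i) (mul_nonneg hs (hq k))).eq_or_lt with h | h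
    · have h0 : p i = 0 := by have := hp i; have := mul_nonneg hs (hq k); linarith
      have h0' : s * q k = 0 := by have := hp i; have := mul_nonneg hs (hq k); linarith
      rw [h0, h0']; simp
    · field_simp
      ring
  · simp [hz]

/-- The entrywise minimum is the infimum of the functional over bounded operators. -/
theorem le_parallel_of_forall_le_quadCost (hT : IsMixture ψ T) (hp : ∀ i, 0 ≤ p i)
    (hu : ∀ i, T (u i) = (p i : ℂ) • u i) (hq : ∀ k, 0 ≤ q k) (hs : 0 ≤ s)
    (hfin : ∑' z : I × κ, ENNReal.ofReal (p z.1 * ‖inner ℂ (g z.2) (u z.1)‖ ^ 2) ≠ ⊤) {B : ℝ≥0∞}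
    (hB : ∀ X, B ≤ quadCost ψ g q s X) :
    B ≤ ∑' z : I × κ, ENNReal.ofReal (p z.1 * (s * q z.2) / (p z.1 + s * q z.2)
      * ‖inner ℂ (g z.2) (u z.1)‖ ^ 2) := by
  have h1 := (ENNReal.tendsto_tsum_compl_atTop_zero hfin).const_add (∑' z : I × κ,
    ENNReal.ofReal (p z.1 * (s * q z.2) / (p z.1 + s * q z.2) * ‖inner ℂ (g z.2) (u z.1)‖ ^ 2))
  rw [add_zero] at h1
  refine ge_of_tendsto' h1 fun F => ?_
  obtain ⟨X, hX⟩ := exists_quadCost_le (g := g) hT hp hu hq hs F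
  exact (hB X).trans hX

end Variational

/-! ### Conditional entropy as an average of logarithms -/

section Conditional

variable {X Y Z C : Type u} {J : Type*}

open Classical in
theorem component_slice (e : X ≃ Y × Z) (z z' : Z) (φ : Hilb Y) :
    component e (slice e z φ) z' = if z' = z then φ else 0 := by
  have h : (adjoint (slice e z')).comp (slice e z)
      = if z' = z then ContinuousLinearMap.id ℂ (Hilb Y) else 0 := by
    refine clm_ext_ket fun y => hilb_ext fun y' => ?_
    rw [ContinuousLinearMap.comp_apply, adjoint_inner_right, slice_ket, slice_ket, inner_ket_ket]
    by_cases hz : z' = z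
    · subst hz
      rw [if_pos rfl, ContinuousLinearMap.id_apply, inner_ket_ket]
      simp
    · simp [hz]
  have := DFunLike.congr_fun h φ
  by_cases hz : z' = z <;> simpa [hz, component] using this

/-- The vectors `bⱼ ⊗ |z⟩` form a Hilbert basis. -/
theorem exists_sliceBasis (e : X ≃ Y × Z) (b : HilbertBasis J ℂ (Hilb Y)) :
    ∃ g : HilbertBasis (Z × J) ℂ (Hilb X), ∀ k, g k = slice e k.1 (b k.2) := by
  classical
  have hon : Orthonormal ℂ fun k : Z × J => slice e k.1 (b k.2) := by
    rw [orthonormal_iff_ite]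
    rintro ⟨z, i⟩ ⟨z', j⟩
    dsimp only
    rw [← adjoint_inner_right]
    change inner ℂ (b i) (component e (slice e z' (b j)) z) = _
    rw [component_slice]
    by_cases hz : z = z'
    · simp [hz, orthonormal_iff_ite.1 b.orthonormal]
    · simp [hz]
  have hbot : (Submodule.span ℂ (range fun k : Z × J => slice e k.1 (b k.2)))ᗮ = ⊥ := by
    rw [eq_bot_iff]
    intro φ hφ
    rw [Submodule.mem_orthogonal] at hφ
    rw [Submodule.mem_bot]
    have h0 : ∀ z, component e φ z = 0 := fun z => by
      refine b.repr.injective (lp.ext (funext fun j => ?_))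
      rw [HilbertBasis.repr_apply_apply, map_zero, component, adjoint_inner_right]
      exact hφ _ (Submodule.subset_span ⟨(z, j), rfl⟩)
    refine hilb_ext fun x => ?_
    have := inner_ket_component e φ (e x).2 (e x).1
    rw [h0] at this
    simpa using this.symm
  exact ⟨HilbertBasis.mkOfOrthogonalEqBot hon hbot, fun k => by
    rw [HilbertBasis.coe_mkOfOrthogonalEqBot]⟩

/-- `quadCost` for a mixture of vectors of `Y × Z` and its reduced state on `Y`, without reference
to an eigenbasis of the reduced state. -/
noncomputable def condCost (e : X ≃ Y × Z) (Ψ : C → Hilb X) (s : ℝ) (L : Op X) : ℝ≥0∞ :=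
  ∑' c, ‖Ψ c - L (Ψ c)‖ₑ ^ 2 + ENNReal.ofReal s *
    ∑' z, ∑' p : Z × C, ‖adjoint L (slice e z (component e (Ψ p.2) p.1))‖ₑ ^ 2

/-- The conditional entropy `H(YZ) - H(Y)` is an average `∑ wᵢ log xᵢ`, and the averages
`∑ wᵢ xᵢ / (xᵢ + t)` are infima of the functional `condCost`. -/
theorem exists_weights (e : X ≃ Y × Z) {Ψ : C → Hilb X} {T : Op X} {T' : Op Y}
    (hT : IsMixture Ψ T) (hT' : IsMixture (fun p : Z × C => component e (Ψ p.2) p.1) T')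
    (hΨ : ∑' c, ‖Ψ c‖ₑ ^ 2 = 1) (hH : entropy T ≠ ⊤) (hH' : entropy T' ≠ ⊤) :
    ∃ (M : Type u) (w x : M → ℝ), (∀ i, 0 ≤ w i) ∧ (∀ i, w i ≠ 0 → 0 < x i) ∧ HasSum w 1 ∧
      (Summable fun i => w i * |Real.log (x i)|) ∧
      ∑' i, w i * Real.log (x i) = (entropy T).toReal - (entropy T').toReal ∧
      ∀ t > 0, (∀ L, ENNReal.ofReal (∑' i, w i * (x i / (x i + t))) ≤ condCost e Ψ t⁻¹ L) ∧
        ∀ B, (∀ L, B ≤ condCost e Ψ t⁻¹ L) →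
          B ≤ ENNReal.ofReal (∑' i, w i * (x i / (x i + t))) := by
  have hΨ' : ∑' p : Z × C, ‖component e (Ψ p.2) p.1‖ₑ ^ 2 = 1 := by
    rw [ENNReal.tsum_prod (f := fun z c => ‖component e (Ψ c) z‖ₑ ^ 2), ENNReal.tsum_comm]
    simp_rw [tsum_enorm_component_sq]
    exact hΨ
  obtain ⟨I, u, p, hp0, hp1, hpsum, hu⟩ := hT.exists_eigenbasis hΨ
  obtain ⟨J, v, q, hq0, hq1, -, hv⟩ := hT'.exists_eigenbasis hΨ'
  obtain ⟨g, hg⟩ := exists_sliceBasis e v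
  -- The joint distribution of the eigenvectors of `T` and of the eigenvectors `vⱼ ⊗ |z⟩` of `T' ⊗
  -- 1`.
  let w : I × (Z × J) → ℝ := fun z => p z.1 * ‖inner ℂ (g z.2) (u z.1)‖ ^ 2
  have hw0 : ∀ i, 0 ≤ w i := fun i => mul_nonneg (hp0 _) (by positivity)
  have hwofReal : ∀ z, ENNReal.ofReal (w z)
      = ENNReal.ofReal (p z.1) * ‖inner ℂ (g z.2) (u z.1)‖ₑ ^ 2 := fun z => by
    rw [ENNReal.ofReal_mul (hp0 _), enorm_sq_eq_ofReal]
  -- the marginals of `w` are the two spectra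
  have hmarg1 : ∀ i, ∑' k, ENNReal.ofReal (w (i, k)) = ENNReal.ofReal (p i) := fun i => by
    simp_rw [hwofReal]
    rw [ENNReal.tsum_mul_left, tsum_enorm_inner_sq, enorm_sq_eq_ofReal, u.orthonormal.1]
    simp
  have hmarg2 : ∀ j, ∑' z, ∑' i, ENNReal.ofReal (w (i, (z, j))) = ENNReal.ofReal (q j) :=
      fun j => by
    have h1 : ∀ z, ∑' i, ENNReal.ofReal (w (i, (z, j)))
        = ∑' c, ‖inner ℂ (component e (Ψ c) z) (v j)‖ₑ ^ 2 := fun z => by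
      simp_rw [hwofReal, hg]
      have h2 := (hT.2 (slice e z (v j))).symm.trans ((isMixture_eigenbasis hT.1 u hp0 hu).2 _)
      simp_rw [component, adjoint_inner_left]
      rw [h2]
      refine tsum_congr fun i => ?_
      rw [inner_smul_left, Complex.conj_ofReal, enorm_inner_comm]
      exact (enorm_sqrt_smul_sq (hp0 i) (inner ℂ (u i) (slice e z (v j)))).symm
    simp_rw [h1]
    rw [← ENNReal.tsum_prod (f := fun z c => ‖inner ℂ (component e (Ψ c) z) (v j)‖ₑ ^ 2),
      ← hT'.2 (v j), hv, inner_smul_right, inner_self_eq_ofReal, v.orthonormal.1]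
    simp
  have hwsum : ∑' z, ENNReal.ofReal (w z) = 1 := by
    rw [ENNReal.tsum_prod']
    simp_rw [hmarg1]
    exact hpsum
  have hw1 : HasSum w 1 := by
    have hs := ENNReal.summable_toReal (f := fun z => ENNReal.ofReal (w z)) (by simp [hwsum])
    simp only [ENNReal.toReal_ofReal (hw0 _)] at hs
    rw [← ENNReal.ofReal_tsum_of_nonneg hw0 hs] at hwsum
    have := hs.hasSum
    rwa [show ∑' z, w z = 1 by simpa using hwsum] at this
  have hpos : ∀ z, w z ≠ 0 → 0 < p z.1 ∧ 0 < q z.2.2 := by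
    rintro ⟨i, z, j⟩ hz
    refine ⟨(hp0 i).lt_of_ne fun h => hz (by simp [w, ← h]), (hq0 j).lt_of_ne fun h => hz ?_⟩
    have h1 := hmarg2 j
    change 0 = q j at h
    rw [← h, ENNReal.ofReal_zero, ENNReal.tsum_eq_zero] at h1
    have h2 := ENNReal.tsum_eq_zero.1 (h1 z) i
    exact le_antisymm (by simpa using h2) (hw0 _)
  -- the two entropies as averages
  have hlogp : ∀ i, 0 ≤ - Real.log (p i) := fun i => neg_nonneg.2 (Real.log_nonpos (hp0 i) (hp1 i))
  have hlogq : ∀ i, 0 ≤ - Real.log (q i) := fun i => neg_nonneg.2 (Real.log_nonpos (hq0 i) (hq1 i))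
  have hη : ∀ r : ℝ, 0 ≤ r → ENNReal.ofReal (Real.negMulLog r)
      = ENNReal.ofReal r * ENNReal.ofReal (- Real.log r) := fun r hr => by
    rw [← ENNReal.ofReal_mul hr, Real.negMulLog]; congr 1; ring
  have hS1 : ∑' z, ENNReal.ofReal (w z * (- Real.log (p z.1))) = entropy T := by
    rw [entropy_eq_tsum hT.1.isSelfAdjoint u
      (fun i => Real.negMulLog_nonneg (hp0 i) (hp1 i)) hu, ENNReal.tsum_prod']
    refine tsum_congr fun i => ?_
    simp_rw [ENNReal.ofReal_mul (hw0 _)]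
    rw [ENNReal.tsum_mul_right, hmarg1, hη _ (hp0 i)]
  have hS2 : ∑' z, ENNReal.ofReal (w z * (- Real.log (q z.2.2))) = entropy T' := by
    rw [entropy_eq_tsum hT'.1.isSelfAdjoint v
      (fun i => Real.negMulLog_nonneg (hq0 i) (hq1 i)) hv, ENNReal.tsum_prod', ENNReal.tsum_comm,
      ENNReal.tsum_prod', ENNReal.tsum_comm]
    refine tsum_congr fun j => ?_
    simp_rw [ENNReal.ofReal_mul (hw0 _)]
    simp_rw [ENNReal.tsum_mul_right]
    rw [hmarg2, hη _ (hq0 j)]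
  have hasSum_of : ∀ {f : I × (Z × J) → ℝ} {S : ℝ≥0∞}, (∀ z, 0 ≤ f z) →
      ∑' z, ENNReal.ofReal (f z) = S → S ≠ ⊤ → HasSum f S.toReal := by
    intro f S hf hS hSt
    have hs := ENNReal.summable_toReal (f := fun z => ENNReal.ofReal (f z)) (by rwa [hS])
    simp only [ENNReal.toReal_ofReal (hf _)] at hs
    rw [← hS, ← ENNReal.ofReal_tsum_of_nonneg hf hs, ENNReal.toReal_ofReal (tsum_nonneg hf)]
    exact hs.hasSum
  have hR1 := hasSum_of (fun z => mul_nonneg (hw0 z) (hlogp z.1)) hS1 hH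
  have hR2 := hasSum_of (fun z => mul_nonneg (hw0 z) (hlogq z.2.2)) hS2 hH'
  -- The ratio of the two eigenvalues, so that `log x` is the difference of the logarithms.
  let x : I × (Z × J) → ℝ := fun z => q z.2.2 / p z.1
  have hx : ∀ z, w z ≠ 0 → 0 < x z := fun z hz => div_pos (hpos z hz).2 (hpos z hz).1
  have hwlog : ∀ z, w z * Real.log (x z)
      = w z * (- Real.log (p z.1)) - w z * (- Real.log (q z.2.2)) := fun z => by
    by_cases hz : w z = 0
    · simp [hz]
    · rw [Real.log_div (hpos z hz).2.ne' (hpos z hz).1.ne']; ring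
  have hRx : HasSum (fun z => w z * Real.log (x z)) _ := (hR1.sub hR2).congr_fun hwlog
  refine ⟨_, w, x, hw0, hx, hw1, ?_, hRx.tsum_eq, fun t ht => ?_⟩
  · have := hRx.summable.norm
    simpa only [norm_mul, Real.norm_eq_abs, abs_of_nonneg (hw0 _)] using this
  · have ht' : (0 : ℝ) ≤ t⁻¹ := (inv_pos.2 ht).le
    -- `condCost` is `quadCost` for the eigenbasis of the reduced state, and the entrywise minimum
    -- `p (q / t) / (p + q / t) |⟨g|u⟩|²` is `w x / (x + t)`.
    have hcost : ∀ L, condCost e Ψ t⁻¹ L = quadCost Ψ g (fun k => q k.2) t⁻¹ L := fun L => by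
      rw [condCost, quadCost, ENNReal.tsum_prod']
      congr 3
      ext z
      have := hT'.tsum_map_eq (isMixture_eigenbasis hT'.1 v hq0 hv) ((adjoint L).comp (slice e z))
      refine this.trans (tsum_congr fun j => ?_)
      rw [map_smul, enorm_sqrt_smul_sq (hq0 j), hg]
      rfl
    have hterm : ∀ z : I × (Z × J), p z.1 * (t⁻¹ * q z.2.2) / (p z.1 + t⁻¹ * q z.2.2)
        * ‖inner ℂ (g z.2) (u z.1)‖ ^ 2 = w z * (x z / (x z + t)) := fun z => by
      by_cases hz : p z.1 = 0
      · simp [w, hz]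
      · have hp : 0 < p z.1 := (hp0 _).lt_of_ne (Ne.symm hz)
        have hq := hq0 z.2.2
        simp only [w, x]
        have h1 : 0 < p z.1 + t⁻¹ * q z.2.2 := by positivity
        have h2 : 0 < q z.2.2 / p z.1 + t := by positivity
        field_simp
        ring
    have hnn : ∀ z, 0 ≤ w z * (x z / (x z + t)) := fun z => by
      have : 0 ≤ x z := div_nonneg (hq0 _) (hp0 _)
      have := hw0 z
      positivity
    have hsum : Summable fun z => w z * (x z / (x z + t)) := by
      refine Summable.of_nonneg_of_le hnn (fun z => ?_) hw1.summable
      have : 0 ≤ x z := div_nonneg (hq0 _) (hp0 _)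
      exact mul_le_of_le_one_right (hw0 z) (by rw [div_le_one (by positivity)]; linarith)
    rw [ENNReal.ofReal_tsum_of_nonneg hnn hsum]
    have hE : ∑' z, ENNReal.ofReal (w z * (x z / (x z + t))) = ∑' z : I × (Z × J),
        ENNReal.ofReal (p z.1 * (t⁻¹ * (fun k : Z × J => q k.2) z.2) /
          (p z.1 + t⁻¹ * (fun k : Z × J => q k.2) z.2) * ‖inner ℂ (g z.2) (u z.1)‖ ^ 2) :=
      tsum_congr fun z => by rw [← hterm]
    have hfin : ∑' z : I × (Z × J), ENNReal.ofReal (p z.1 * ‖inner ℂ (g z.2) (u z.1)‖ ^ 2) ≠ ⊤ := by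
      change ∑' z, ENNReal.ofReal (w z) ≠ ⊤
      rw [hwsum]; exact ENNReal.one_ne_top
    rw [hE]
    refine ⟨fun L => ?_, fun B hB => ?_⟩
    · rw [hcost]
      exact parallel_le_quadCost (q := fun k : Z × J => q k.2) hT hp0 hu (fun k => hq0 k.2) ht' L
    · exact le_parallel_of_forall_le_quadCost (q := fun k : Z × J => q k.2) hT hp0 hu
        (fun k => hq0 k.2) ht' hfin fun L => (hB L).trans_eq (hcost L)

end Conditional

/-! ### Operators on one factor of a composite system -/

section Amplification

variable {X X' Y Y' Z : Type u}

/-- A vector is determined by its components. -/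
theorem component_ext (e : X ≃ Y × Z) {φ ψ : Hilb X}
    (h : ∀ z, component e φ z = component e ψ z) : φ = ψ :=
  hilb_ext fun x => by
    have h1 := inner_ket_component e φ (e x).2 (e x).1
    have h2 := inner_ket_component e ψ (e x).2 (e x).1
    rw [h] at h1
    simpa using h1.symm.trans h2

theorem hasSum_inner_component (e : X ≃ Y × Z) (φ ψ : Hilb X) :
    HasSum (fun z => inner ℂ (component e φ z) (component e ψ z)) (inner ℂ φ ψ) := by
  have h1 := (e.trans (Equiv.prodComm Y Z)).symm.hasSum_iff.2 (hasSum_inner_ket φ ψ)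
  refine h1.prod_fiberwise fun z => ?_
  refine (hasSum_inner_ket (component e φ z) (component e ψ z)).congr_fun fun y => ?_
  rw [← inner_conj_symm _ (ket y), inner_ket_component, inner_ket_component, inner_conj_symm]
  rfl

theorem exists_amp (e : X ≃ Y × Z) (e' : X' ≃ Y' × Z) (L : Hilb Y →L[ℂ] Hilb Y') :
    ∃ A : Hilb X →L[ℂ] Hilb X', ∀ ψ z, component e' (A ψ) z = L (component e ψ z) := by
  have hb : ∀ ψ : Hilb X, ∑' z, ‖L (component e ψ z)‖ₑ ^ 2
      ≤ ENNReal.ofReal ((‖L‖ * ‖ψ‖) ^ 2) := fun ψ => by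
    rw [mul_pow, ENNReal.ofReal_mul (by positivity), ← enorm_sq_eq_ofReal ψ,
      ← tsum_enorm_component_sq e, ← ENNReal.tsum_mul_left]
    refine ENNReal.tsum_le_tsum fun z => ?_
    rw [enorm_sq_eq_ofReal, enorm_sq_eq_ofReal, ← ENNReal.ofReal_mul (by positivity), ← mul_pow]
    exact ENNReal.ofReal_le_ofReal (by gcongr; exact L.le_opNorm _)
  choose A hA using fun ψ : Hilb X => exists_vector_of_components
    (fun z => L (component e ψ z)) (ne_top_of_le_ne_top ENNReal.ofReal_ne_top (hb ψ)) e'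
  let A' : Hilb X →ₗ[ℂ] Hilb X' :=
    { toFun := A
      map_add' := fun φ ψ => component_ext e' fun z => by
        rw [hA]
        simp only [component, map_add] at hA ⊢
        rw [hA, hA]
      map_smul' := fun c ψ => component_ext e' fun z => by
        rw [hA]
        simp only [component, map_smul, RingHom.id_apply] at hA ⊢
        rw [hA] }
  refine ⟨A'.mkContinuous ‖L‖ fun ψ => ?_, hA⟩
  have h := hb ψ
  simp_rw [← hA] at h
  rw [tsum_enorm_component_sq, enorm_sq_eq_ofReal, ENNReal.ofReal_le_ofReal_iff (by positivity)] at h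
  exact (pow_le_pow_iff_left₀ (norm_nonneg _) (by positivity) two_ne_zero).1 h

/-- The operator `L ⊗ 1` on a composite system. -/
noncomputable def amp (e : X ≃ Y × Z) (e' : X' ≃ Y' × Z) (L : Hilb Y →L[ℂ] Hilb Y') :
    Hilb X →L[ℂ] Hilb X' := (exists_amp e e' L).choose

theorem component_amp (e : X ≃ Y × Z) (e' : X' ≃ Y' × Z) (L : Hilb Y →L[ℂ] Hilb Y') (ψ : Hilb X)
    (z : Z) : component e' (amp e e' L ψ) z = L (component e ψ z) :=
  (exists_amp e e' L).choose_spec ψ z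

theorem adjoint_amp (e : X ≃ Y × Z) (e' : X' ≃ Y' × Z) (L : Hilb Y →L[ℂ] Hilb Y') :
    adjoint (amp e e' L) = amp e' e (adjoint L) := by
  refine ((ContinuousLinearMap.eq_adjoint_iff _ _).2 fun φ ψ => ?_).symm
  refine (hasSum_inner_component e _ _).unique ?_
  refine (hasSum_inner_component e' _ _).congr_fun fun z => ?_
  rw [component_amp, component_amp, adjoint_inner_left]

/-- The operator `χ ↦ φ ⊗ χ`. -/
noncomputable def tens (e : X ≃ Y × Z) (φ : Hilb Y) : Hilb Z →L[ℂ] Hilb X :=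
  amp (Equiv.punitProd.{u, u} Z).symm e ((innerSL ℂ (ket PUnit.unit)).smulRight φ)

theorem component_tens (e : X ≃ Y × Z) (φ : Hilb Y) (χ : Hilb Z) (z : Z) :
    component e (tens e φ χ) z = inner ℂ (ket z) χ • φ := by
  rw [tens, component_amp, ContinuousLinearMap.smulRight_apply, innerSL_apply_apply,
    inner_ket_component]
  rfl

theorem inner_ket_tens (e : X ≃ Y × Z) (φ : Hilb Y) (χ : Hilb Z) (x : X) :
    inner ℂ (ket x) (tens e φ χ) = inner ℂ (ket (e x).1) φ * inner ℂ (ket (e x).2) χ := by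
  have h := inner_ket_component e (tens e φ χ) (e x).2 (e x).1
  rw [component_tens, inner_smul_right, mul_comm] at h
  simpa using h.symm

theorem tens_swap (e : X ≃ Y × Z) (φ : Hilb Y) (χ : Hilb Z) :
    tens (e.trans (Equiv.prodComm Y Z)) χ φ = tens e φ χ :=
  hilb_ext fun x => by rw [inner_ket_tens, inner_ket_tens, mul_comm]; rfl

theorem inner_tens_tens (e : X ≃ Y × Z) (φ φ' : Hilb Y) (χ χ' : Hilb Z) :
    inner ℂ (tens e φ χ) (tens e φ' χ') = inner ℂ φ φ' * inner ℂ χ χ' := by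
  refine (hasSum_inner_component e _ _).unique ?_
  refine ((hasSum_inner_ket χ χ').mul_left (inner ℂ φ φ')).congr_fun fun z => ?_
  rw [component_tens, component_tens, inner_smul_left, inner_smul_right, inner_conj_symm]
  ring

/-- The partial inner product `(⟨φ| ⊗ 1) ψ`. -/
noncomputable def bra (e : X ≃ Y × Z) (φ : Hilb Y) (ψ : Hilb X) : Hilb Z := adjoint (tens e φ) ψ

theorem inner_ket_bra (e : X ≃ Y × Z) (φ : Hilb Y) (ψ : Hilb X) (z : Z) :
    inner ℂ (ket z) (bra e φ ψ) = inner ℂ φ (component e ψ z) := by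
  rw [bra, adjoint_inner_right]
  refine (hasSum_inner_component e _ _).unique ?_
  classical
  convert hasSum_ite_eq z (inner ℂ φ (component e ψ z)) using 2 with z'
  rw [component_tens, inner_smul_left, inner_conj_symm, inner_ket_ket]
  by_cases h : z' = z
  · subst h; simp
  · simp [h, Ne.symm h]

theorem tsum_enorm_bra_sq (e : X ≃ Y × Z) (φ : Hilb Y) (ψ : Hilb X) :
    ‖bra e φ ψ‖ₑ ^ 2 = ∑' z, ‖inner ℂ (component e ψ z) φ‖ₑ ^ 2 := by
  rw [← tsum_enorm_ket_sq]
  simp_rw [inner_ket_bra, enorm_inner_comm φ]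

end Amplification

/-! ### Strong subadditivity -/

section SSA

variable {A B C D X : Type u}

/-- Strong subadditivity `H(ABD) - H(BD) ≤ H(AB) - H(B)` for a mixture of vectors of `ABD`.  The
functional `condCost` of `ABD` takes the same value at `L ⊗ 1_D` as that of `AB` at `L`, so its
infimum is at most that of the latter. -/
theorem toReal_entropy_sub_le {Ψ : C → Hilb (A × B × D)} (hΨ : ∑' c, ‖Ψ c‖ₑ ^ 2 = 1)
    {T₁ : Op (A × B × D)} {T₂ : Op (B × D)} {T₃ : Op (A × B)} {T₄ : Op B}
    (h₁ : IsMixture Ψ T₁)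
    (h₂ : IsMixture (fun p : A × C => component (Equiv.prodComm A (B × D)) (Ψ p.2) p.1) T₂)
    (h₃ : IsMixture (fun p : D × C => component (Equiv.prodAssoc A B D).symm (Ψ p.2) p.1) T₃)
    (h₄ : IsMixture (fun p : A × (D × C) => component (Equiv.prodComm A B)
      (component (Equiv.prodAssoc A B D).symm (Ψ p.2.2) p.2.1) p.1) T₄)
    (f₁ : entropy T₁ ≠ ⊤) (f₂ : entropy T₂ ≠ ⊤) (f₃ : entropy T₃ ≠ ⊤) (f₄ : entropy T₄ ≠ ⊤) :
    (entropy T₁).toReal - (entropy T₂).toReal ≤ (entropy T₃).toReal - (entropy T₄).toReal := by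
  set eD := (Equiv.prodAssoc A B D).symm
  set eW := Equiv.prodComm A (B × D)
  set eS := Equiv.prodComm A B
  set Ψ₃ : D × C → Hilb (A × B) := fun p => component eD (Ψ p.2) p.1 with hΨ₃
  have hn₃ : ∑' p, ‖Ψ₃ p‖ₑ ^ 2 = 1 := by
    rw [ENNReal.tsum_prod (f := fun d c => ‖component eD (Ψ c) d‖ₑ ^ 2), ENNReal.tsum_comm]
    simp_rw [tsum_enorm_component_sq]
    exact hΨ
  obtain ⟨M, w, x, hw, hx, hw1, hs, hv, ht⟩ := exists_weights eW h₁ h₂ hΨ f₁ f₂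
  obtain ⟨M', w', x', hw', hx', hw1', hs', hv', ht'⟩ := exists_weights eS h₃ h₄ hn₃ f₃ f₄
  rw [← hv, ← hv']
  refine tsum_mul_log_le hw hx hw' hx' hw1 hw1' hs hs' fun t htp => ?_
  have hnn : 0 ≤ ∑' i, w' i * (x' i / (x' i + t)) := tsum_nonneg fun i => by
    by_cases h0 : w' i = 0
    · simp [h0]
    · have := hw' i; have := hx' i h0; positivity
  rw [← ENNReal.ofReal_le_ofReal_iff hnn]
  refine (ht' t htp).2 _ fun L => ((ht t htp).1 (amp eD eD L)).trans (le_of_eq ?_)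
  -- Slices in `A` and components in `D` commute.
  have hsl : ∀ (χ : Hilb (B × D)) a d, component eD (slice eW a χ) d
      = slice eS a (component (Equiv.refl (B × D)) χ d) := fun χ a d => by
    classical
    refine component_ext eS fun a' => ?_
    rw [component_slice]
    have h := component_slice eW a a' χ
    refine hilb_ext fun b => ?_
    have h' := congrArg (fun η => inner ℂ (ket (b, d)) η) h
    simp only [inner_ket_component] at h' ⊢
    refine h'.trans ?_
    split_ifs
    · rw [inner_ket_component]; rfl
    · simp
  have hcomp : ∀ c a d, component (Equiv.refl (B × D)) (component eW (Ψ c) a) d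
      = component eS (component eD (Ψ c) d) a := fun c a d => by
    refine hilb_ext fun b => ?_
    simp only [inner_ket_component]
    rfl
  rw [condCost, condCost]
  congr 1
  · rw [ENNReal.tsum_prod (f := fun d c => ‖component eD (Ψ c) d - L (component eD (Ψ c) d)‖ₑ ^ 2),
      ENNReal.tsum_comm]
    refine tsum_congr fun c => ?_
    rw [← tsum_enorm_component_sq eD]
    refine tsum_congr fun d => ?_
    rw [← component_amp eD eD, component, map_sub]
    rfl
  · congr 1
    refine tsum_congr fun a' => ?_
    rw [ENNReal.tsum_prod', ENNReal.tsum_prod']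
    refine tsum_congr fun a => ?_
    rw [ENNReal.tsum_prod', ENNReal.tsum_comm]
    refine tsum_congr fun c => ?_
    rw [adjoint_amp, ← tsum_enorm_component_sq eD]
    refine tsum_congr fun d => ?_
    rw [component_amp, hsl, hcomp]

end SSA

/-! ### Finiteness of joint entropies -/

section Subadditivity

variable {C X Y Z : Type u}

/-- Products of basis vectors form a Hilbert basis of a composite system. -/
theorem exists_tensBasis {J K : Type*} (e : X ≃ Y × Z) (a : HilbertBasis J ℂ (Hilb Y))
    (b : HilbertBasis K ℂ (Hilb Z)) :
    ∃ g : HilbertBasis (J × K) ℂ (Hilb X), ∀ k, g k = tens e (a k.1) (b k.2) := by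
  classical
  have hon : Orthonormal ℂ fun k : J × K => tens e (a k.1) (b k.2) := by
    rw [orthonormal_iff_ite]
    rintro ⟨i, j⟩ ⟨i', j'⟩
    dsimp only
    rw [inner_tens_tens, orthonormal_iff_ite.1 a.orthonormal, orthonormal_iff_ite.1 b.orthonormal]
    by_cases h : i = i' <;> by_cases h' : j = j' <;> simp [h, h']
  have hbot : (Submodule.span ℂ (range fun k : J × K => tens e (a k.1) (b k.2)))ᗮ = ⊥ := by
    rw [eq_bot_iff]
    intro φ hφ
    rw [Submodule.mem_orthogonal] at hφ
    rw [Submodule.mem_bot]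
    have h0 : ∀ i, bra e (a i) φ = 0 := fun i => by
      refine b.repr.injective (lp.ext (funext fun j => ?_))
      rw [HilbertBasis.repr_apply_apply, map_zero, bra, adjoint_inner_right]
      exact hφ _ (Submodule.subset_span ⟨(i, j), rfl⟩)
    refine component_ext e fun z => ?_
    refine a.repr.injective (lp.ext (funext fun i => ?_))
    rw [HilbertBasis.repr_apply_apply, ← inner_ket_bra, h0]
    simp [component]
  exact ⟨HilbertBasis.mkOfOrthogonalEqBot hon hbot, fun k => by
    rw [HilbertBasis.coe_mkOfOrthogonalEqBot]⟩

/-- This is `log y ≤ y - 1` at `y = α β / p`, multiplied by `p r`. -/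
theorem mul_neg_log_le {p r α β : ℝ} (hp : 0 ≤ p) (hr : 0 ≤ r) (hα : 0 ≤ α) (hβ : 0 ≤ β)
    (hα0 : p * r ≠ 0 → α ≠ 0) (hβ0 : p * r ≠ 0 → β ≠ 0) :
    p * r * (- Real.log p) ≤ p * r * (- Real.log α) + p * r * (- Real.log β) + r * (α * β) := by
  by_cases h : p * r = 0
  · rw [h]; simp only [zero_mul, zero_add]; positivity
  · have hp' : 0 < p := hp.lt_of_ne fun h' => h (by rw [← h']; simp)
    have hα' : 0 < α := hα.lt_of_ne (hα0 h).symm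
    have hβ' : 0 < β := hβ.lt_of_ne (hβ0 h).symm
    have h1 := Real.log_le_sub_one_of_pos (show 0 < α * β / p by positivity)
    rw [Real.log_div (by positivity) hp'.ne', Real.log_mul hα'.ne' hβ'.ne'] at h1
    have h2 := mul_le_mul_of_nonneg_left h1 (mul_nonneg hp hr)
    have h3 : p * r * (α * β / p - 1) = r * (α * β) - p * r := by field_simp
    rw [h3] at h2
    nlinarith [mul_nonneg hp hr]

/-- A weak form of subadditivity of the entropy, which is valid without a finiteness hypothesis.
The term `1` is the trace of the product of the reduced states, from summing `mul_neg_log_le` over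
the eigenvectors of `T` and of this product; the trace of `T`, which would cancel it, is dropped. -/
theorem entropy_le_add_add_one (e : X ≃ Y × Z) {Ψ : C → Hilb X} (hΨ : ∑' c, ‖Ψ c‖ₑ ^ 2 = 1)
    {T : Op X} {T₁ : Op Y} {T₂ : Op Z} (hT : IsMixture Ψ T)
    (h₁ : IsMixture (fun p : Z × C => component e (Ψ p.2) p.1) T₁)
    (h₂ : IsMixture (fun p : Y × C => component (e.trans (Equiv.prodComm Y Z)) (Ψ p.2) p.1) T₂) :
    entropy T ≤ entropy T₁ + entropy T₂ + 1 := by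
  have hn₁ : ∑' p : Z × C, ‖component e (Ψ p.2) p.1‖ₑ ^ 2 = 1 := by
    rw [ENNReal.tsum_prod (f := fun z c => ‖component e (Ψ c) z‖ₑ ^ 2), ENNReal.tsum_comm]
    simp_rw [tsum_enorm_component_sq]
    exact hΨ
  have hn₂ : ∑' p : Y × C, ‖component (e.trans (Equiv.prodComm Y Z)) (Ψ p.2) p.1‖ₑ ^ 2 = 1 := by
    rw [ENNReal.tsum_prod
      (f := fun z c => ‖component (e.trans (Equiv.prodComm Y Z)) (Ψ c) z‖ₑ ^ 2), ENNReal.tsum_comm]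
    simp_rw [tsum_enorm_component_sq]
    exact hΨ
  obtain ⟨I, u, p, hp0, hp1, -, hu⟩ := hT.exists_eigenbasis hΨ
  obtain ⟨J, a, α, hα0, hα1, hαs, ha⟩ := h₁.exists_eigenbasis hn₁
  obtain ⟨K, b, β, hβ0, hβ1, hβs, hb⟩ := h₂.exists_eigenbasis hn₂
  obtain ⟨g, hg⟩ := exists_tensBasis e a b
  let r : I × (J × K) → ℝ := fun z => ‖inner ℂ (g z.2) (u z.1)‖ ^ 2
  have hr0 : ∀ z, 0 ≤ r z := fun z => by positivity
  -- The joint distribution of the eigenvectors of `T` and of `T₁ ⊗ T₂`; its marginals are the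
  -- three spectra.
  let w : I × (J × K) → ℝ := fun z => p z.1 * r z
  have hw0 : ∀ z, 0 ≤ w z := fun z => mul_nonneg (hp0 _) (hr0 z)
  have hwI : ∀ k, ∑' i, ENNReal.ofReal (w (i, k)) = ∑' c, ‖inner ℂ (Ψ c) (g k)‖ₑ ^ 2 := fun k => by
    have h2 := (hT.2 (g k)).symm.trans ((isMixture_eigenbasis hT.1 u hp0 hu).2 _)
    rw [h2]
    refine tsum_congr fun i => ?_
    rw [inner_smul_left, Complex.conj_ofReal, ENNReal.ofReal_mul (hp0 _), ← enorm_sq_eq_ofReal,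
      enorm_inner_comm]
    exact (enorm_sqrt_smul_sq (hp0 i) (inner ℂ (u i) (g k))).symm
  have hmarg : ∀ i, ∑' k, ENNReal.ofReal (w (i, k)) = ENNReal.ofReal (p i) := fun i => by
    simp_rw [w, ENNReal.ofReal_mul (hp0 _)]
    rw [ENNReal.tsum_mul_left]
    simp_rw [r, ← enorm_sq_eq_ofReal]
    rw [tsum_enorm_inner_sq, enorm_sq_eq_ofReal, u.orthonormal.1]
    simp
  have hmarg1 : ∀ j, ∑' k, ∑' i, ENNReal.ofReal (w (i, (j, k))) = ENNReal.ofReal (α j) :=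
      fun j => by
    simp_rw [hwI, hg]
    rw [ENNReal.tsum_comm]
    have h3 : ∀ c, ∑' k, ‖inner ℂ (Ψ c) (tens e (a j) (b k))‖ₑ ^ 2
        = ∑' z, ‖inner ℂ (component e (Ψ c) z) (a j)‖ₑ ^ 2 := fun c => by
      rw [← tsum_enorm_bra_sq, ← tsum_enorm_inner_sq b]
      simp_rw [bra, adjoint_inner_right, enorm_inner_comm (Ψ c)]
    simp_rw [h3]
    rw [ENNReal.tsum_comm, ← ENNReal.tsum_prod
      (f := fun z c => ‖inner ℂ (component e (Ψ c) z) (a j)‖ₑ ^ 2), ← h₁.2 (a j), ha,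
      inner_smul_right, inner_self_eq_ofReal, a.orthonormal.1]
    simp
  have hmarg2 : ∀ k, ∑' j, ∑' i, ENNReal.ofReal (w (i, (j, k))) = ENNReal.ofReal (β k) :=
      fun k => by
    simp_rw [hwI, hg]
    rw [ENNReal.tsum_comm]
    have h3 : ∀ c, ∑' j, ‖inner ℂ (Ψ c) (tens e (a j) (b k))‖ₑ ^ 2
        = ∑' z, ‖inner ℂ (component (e.trans (Equiv.prodComm Y Z)) (Ψ c) z) (b k)‖ₑ ^ 2 :=
        fun c => by
      rw [← tsum_enorm_bra_sq, ← tsum_enorm_inner_sq a]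
      simp_rw [bra, adjoint_inner_right, tens_swap, enorm_inner_comm (Ψ c)]
    simp_rw [h3]
    rw [ENNReal.tsum_comm, ← ENNReal.tsum_prod
      (f := fun z c => ‖inner ℂ (component (e.trans (Equiv.prodComm Y Z)) (Ψ c) z) (b k)‖ₑ ^ 2),
      ← h₂.2 (b k), hb, inner_smul_right, inner_self_eq_ofReal, b.orthonormal.1]
    simp
  have hα' : ∀ z, w z ≠ 0 → α z.2.1 ≠ 0 := by
    rintro ⟨i, j, k⟩ hz h
    have h1 := hmarg1 j
    change α j = 0 at h
    rw [h, ENNReal.ofReal_zero, ENNReal.tsum_eq_zero] at h1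
    have h2 := ENNReal.tsum_eq_zero.1 (h1 k) i
    exact hz (le_antisymm (by simpa using h2) (hw0 _))
  have hβ' : ∀ z, w z ≠ 0 → β z.2.2 ≠ 0 := by
    rintro ⟨i, j, k⟩ hz h
    have h1 := hmarg2 k
    change β k = 0 at h
    rw [h, ENNReal.ofReal_zero, ENNReal.tsum_eq_zero] at h1
    have h2 := ENNReal.tsum_eq_zero.1 (h1 j) i
    exact hz (le_antisymm (by simpa using h2) (hw0 _))
  have hlog : ∀ {r : ℝ}, 0 ≤ r → r ≤ 1 → 0 ≤ - Real.log r := fun h0 h1 =>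
    neg_nonneg.2 (Real.log_nonpos h0 h1)
  have hη : ∀ r : ℝ, 0 ≤ r → ENNReal.ofReal (Real.negMulLog r)
      = ENNReal.ofReal r * ENNReal.ofReal (- Real.log r) := fun r hr => by
    rw [← ENNReal.ofReal_mul hr, Real.negMulLog]; congr 1; ring
  have hS0 : ∑' z, ENNReal.ofReal (w z * (- Real.log (p z.1))) = entropy T := by
    rw [entropy_eq_tsum hT.1.isSelfAdjoint u
      (fun i => Real.negMulLog_nonneg (hp0 i) (hp1 i)) hu, ENNReal.tsum_prod']
    refine tsum_congr fun i => ?_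
    simp_rw [ENNReal.ofReal_mul (hw0 _)]
    rw [ENNReal.tsum_mul_right, hmarg, hη _ (hp0 i)]
  have hS1 : ∑' z, ENNReal.ofReal (w z * (- Real.log (α z.2.1))) = entropy T₁ := by
    rw [entropy_eq_tsum h₁.1.isSelfAdjoint a
      (fun i => Real.negMulLog_nonneg (hα0 i) (hα1 i)) ha, ENNReal.tsum_prod', ENNReal.tsum_comm,
      ENNReal.tsum_prod']
    refine tsum_congr fun j => ?_
    simp_rw [ENNReal.ofReal_mul (hw0 _), ENNReal.tsum_mul_right]
    rw [hmarg1, hη _ (hα0 j)]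
  have hS2 : ∑' z, ENNReal.ofReal (w z * (- Real.log (β z.2.2))) = entropy T₂ := by
    rw [entropy_eq_tsum h₂.1.isSelfAdjoint b
      (fun i => Real.negMulLog_nonneg (hβ0 i) (hβ1 i)) hb, ENNReal.tsum_prod', ENNReal.tsum_comm,
      ENNReal.tsum_prod', ENNReal.tsum_comm]
    refine tsum_congr fun j => ?_
    simp_rw [ENNReal.ofReal_mul (hw0 _), ENNReal.tsum_mul_right]
    rw [hmarg2, hη _ (hβ0 j)]
  have hS3 : ∑' z, ENNReal.ofReal (r z * (α z.2.1 * β z.2.2)) = 1 := by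
    have h1 : ∀ k, ∑' i, ENNReal.ofReal (r (i, k)) = 1 := fun k => by
      simp_rw [r, ← enorm_sq_eq_ofReal, enorm_inner_comm (g k)]
      rw [tsum_enorm_inner_sq, enorm_sq_eq_ofReal, g.orthonormal.1]
      simp
    rw [ENNReal.tsum_prod', ENNReal.tsum_comm]
    simp_rw [ENNReal.ofReal_mul (hr0 _), ENNReal.tsum_mul_right, h1, one_mul]
    rw [ENNReal.tsum_prod']
    simp_rw [ENNReal.ofReal_mul (hα0 _), ENNReal.tsum_mul_left, hβs, mul_one]
    exact hαs
  rw [← hS0, ← hS1, ← hS2, ← hS3, ← ENNReal.tsum_add, ← ENNReal.tsum_add]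
  refine ENNReal.tsum_le_tsum fun z => ?_
  have t1 := mul_nonneg (hw0 z) (hlog (hα0 z.2.1) (hα1 _))
  have t2 := mul_nonneg (hw0 z) (hlog (hβ0 z.2.2) (hβ1 _))
  rw [← ENNReal.ofReal_add t1 t2, ← ENNReal.ofReal_add (add_nonneg t1 t2)
    (mul_nonneg (hr0 z) (mul_nonneg (hα0 _) (hβ0 _)))]
  exact ENNReal.ofReal_le_ofReal
    (mul_neg_log_le (hp0 _) (hr0 z) (hα0 _) (hβ0 _) (hα' z) (hβ' z))

end Subadditivity

/-! ### Entropies of families of systems in a pure state -/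

section Family

variable {A B C D X Y Z : Type u}

/-- Strong subadditivity for the pure state `φ` of four systems. -/
theorem toReal_subEntropy_sub_le {e : X ≃ (A × B × D) × C} {e₂ : X ≃ (B × D) × (A × C)}
    {e₃ : X ≃ (A × B) × (D × C)} {e₄ : X ≃ B × (A × (D × C))}
    (h₂ : ∀ a b d c, e₂.symm ((b, d), (a, c)) = e.symm ((a, b, d), c))
    (h₃ : ∀ a b d c, e₃.symm ((a, b), (d, c)) = e.symm ((a, b, d), c))
    (h₄ : ∀ a b d c, e₄.symm (b, (a, (d, c))) = e.symm ((a, b, d), c)) {φ : Hilb X} (hφ : ‖φ‖ = 1)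
    (f₁ : subEntropy e φ ≠ ⊤) (f₂ : subEntropy e₂ φ ≠ ⊤) (f₃ : subEntropy e₃ φ ≠ ⊤)
    (f₄ : subEntropy e₄ φ ≠ ⊤) :
    (subEntropy e φ).toReal - (subEntropy e₂ φ).toReal
      ≤ (subEntropy e₃ φ).toReal - (subEntropy e₄ φ).toReal := by
  have hφ' : ‖φ‖ₑ ^ 2 = 1 := by simp [enorm_sq_eq_ofReal, hφ]
  refine toReal_entropy_sub_le (Ψ := component e φ) (by rw [tsum_enorm_component_sq, hφ'])
    (isMixture_ptrace_ketbra e φ) ?_ ?_ ?_ f₁ f₂ f₃ f₄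
  · convert isMixture_ptrace_ketbra e₂ φ using 1
    ext ⟨a, c⟩
    refine hilb_ext fun ⟨b, d⟩ => ?_
    rw [inner_ket_component e₂ φ, h₂, inner_ket_component, inner_ket_component]
    rfl
  · convert isMixture_ptrace_ketbra e₃ φ using 1
    ext ⟨d, c⟩
    refine hilb_ext fun ⟨a, b⟩ => ?_
    rw [inner_ket_component e₃ φ, h₃, inner_ket_component, inner_ket_component]
    rfl
  · convert isMixture_ptrace_ketbra e₄ φ using 1
    ext ⟨a, d, c⟩
    refine hilb_ext fun b => ?_
    rw [inner_ket_component e₄ φ, h₄, inner_ket_component, inner_ket_component,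
      inner_ket_component]
    rfl

/-- Weak subadditivity for the pure state `φ` of three systems. -/
theorem subEntropy_le_add_add_one {e : X ≃ (Y × Z) × C} {e₁ : X ≃ Y × (Z × C)}
    {e₂ : X ≃ Z × (Y × C)} (h₁ : ∀ y z c, e₁.symm (y, (z, c)) = e.symm ((y, z), c))
    (h₂ : ∀ y z c, e₂.symm (z, (y, c)) = e.symm ((y, z), c)) {φ : Hilb X} (hφ : ‖φ‖ = 1) :
    subEntropy e φ ≤ subEntropy e₁ φ + subEntropy e₂ φ + 1 := by
  have hφ' : ‖φ‖ₑ ^ 2 = 1 := by simp [enorm_sq_eq_ofReal, hφ]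
  refine entropy_le_add_add_one (Equiv.refl (Y × Z)) (Ψ := component e φ)
    (by rw [tsum_enorm_component_sq, hφ']) (isMixture_ptrace_ketbra e φ) ?_ ?_
  · convert isMixture_ptrace_ketbra e₁ φ using 1
    ext ⟨z, c⟩
    refine hilb_ext fun y => ?_
    rw [inner_ket_component e₁ φ, h₁, inner_ket_component, inner_ket_component]
    rfl
  · convert isMixture_ptrace_ketbra e₂ φ using 1
    ext ⟨y, c⟩
    refine hilb_ext fun z => ?_
    rw [inner_ket_component e₂ φ, h₂, inner_ket_component, inner_ket_component]
    rfl

variable {K : Type} {S : K → Type u}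

/-- The entropy of the systems in `J`, for a pure state of a family of systems. -/
noncomputable def famEntropy (φ : Hilb (∀ k, S k)) (J : Set K) : ℝ≥0∞ :=
  subEntropy (splitEquiv S J) φ

theorem splitEquiv_fst_eq_iff (J : Set K) (x x' : ∀ k, S k) :
    (splitEquiv S J x).1 = (splitEquiv S J x').1 ↔ ∀ k ∈ J, x k = x' k := by
  simp [splitEquiv, funext_iff]

theorem splitEquiv_snd_eq_iff (J : Set K) (x x' : ∀ k, S k) :
    (splitEquiv S J x).2 = (splitEquiv S J x').2 ↔ ∀ k ∉ J, x k = x' k := by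
  simp [splitEquiv, funext_iff]

/-- Recognises a subsystem as the systems in `J` of a family, by the basis labels that agree on
it. -/
theorem subEntropy_eq_famEntropy (e : X ≃ Y × Z) (σ : X ≃ ∀ k, S k) (J : Set K) {ψ : Hilb X}
    {φ : Hilb (∀ k, S k)} (hψ : ‖ψ‖ = 1) (hσ : ∀ x, inner ℂ (ket (σ x)) φ = inner ℂ (ket x) ψ)
    (h₁ : ∀ x x', (e x).1 = (e x').1 ↔ ∀ k ∈ J, σ x k = σ x' k)
    (h₂ : ∀ x x', (e x).2 = (e x').2 ↔ ∀ k ∉ J, σ x k = σ x' k) :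
    subEntropy e ψ = famEntropy φ J :=
  subEntropy_congr e (splitEquiv S J) σ (fun x x' => by rw [h₁, splitEquiv_fst_eq_iff])
    (fun x x' => by rw [h₂, splitEquiv_snd_eq_iff]) hψ hσ

/-- Complementary sets of systems have the same entropy in a pure state. -/
theorem famEntropy_compl {φ : Hilb (∀ k, S k)} (hφ : ‖φ‖ = 1) (J : Set K) :
    famEntropy φ Jᶜ = famEntropy φ J := by
  rw [famEntropy.eq_1 φ J, subEntropy_swap _ hφ]
  symm
  refine subEntropy_eq_famEntropy _ (Equiv.refl _) _ hφ (fun x => rfl) (fun x x' => ?_)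
    (fun x x' => ?_)
  · exact splitEquiv_snd_eq_iff J x x'
  · rw [show (∀ k ∉ Jᶜ, Equiv.refl (∀ k, S k) x k = Equiv.refl (∀ k, S k) x' k)
      ↔ ∀ k ∈ J, x k = x' k by simp]
    exact splitEquiv_fst_eq_iff J x x'

/-- The systems of a family in the four groups `U \ V`, `U ∩ V`, `V \ U` and the rest. -/
theorem exists_splitting (U V : Set K) :
    ∃ e : (∀ k, S k) ≃ ((∀ k : ↥(U \ V), S k) × (∀ k : ↥(U ∩ V), S k) × (∀ k : ↥(V \ U), S k)) ×
      (∀ k : ↥((U ∪ V)ᶜ), S k), ∀ x, e x =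
        ((fun k : ↥(U \ V) => x k, fun k : ↥(U ∩ V) => x k, fun k : ↥(V \ U) => x k),
          fun k : ↥((U ∪ V)ᶜ) => x k) := by
  classical
  refine ⟨Equiv.ofBijective (fun x =>
    ((fun k : ↥(U \ V) => x k, fun k : ↥(U ∩ V) => x k, fun k : ↥(V \ U) => x k),
      fun k : ↥((U ∪ V)ᶜ) => x k)) ⟨fun x x' h => ?_, fun y => ?_⟩, fun x => rfl⟩
  · simp only [Prod.mk.injEq] at h
    obtain ⟨⟨h1, h2, h3⟩, h4⟩ := h
    funext k
    by_cases hU : k ∈ U <;> by_cases hV : k ∈ V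
    · exact congrFun h2 ⟨k, hU, hV⟩
    · exact congrFun h1 ⟨k, hU, hV⟩
    · exact congrFun h3 ⟨k, hV, hU⟩
    · exact congrFun h4 ⟨k, by simp [hU, hV]⟩
  · obtain ⟨⟨a, b, d⟩, c⟩ := y
    refine ⟨fun k => if hU : k ∈ U then if hV : k ∈ V then b ⟨k, hU, hV⟩ else a ⟨k, hU, hV⟩ else
      if hV : k ∈ V then d ⟨k, hV, hU⟩ else c ⟨k, by simp [hU, hV]⟩, ?_⟩
    simp only [Prod.mk.injEq]
    refine ⟨⟨?_, ?_, ?_⟩, ?_⟩ <;> funext ⟨k, hk⟩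
    · simp [hk.1, hk.2]
    · simp [hk.1, hk.2]
    · simp [hk.1, hk.2]
    · simp only [mem_compl_iff, mem_union, not_or] at hk
      simp [hk.1, hk.2]

/-- Strong subadditivity for a pure state of a family of systems. -/
theorem famEntropy_ssa {φ : Hilb (∀ k, S k)} (hφ : ‖φ‖ = 1) {U V : Set K}
    (fU : famEntropy φ U ≠ ⊤) (fV : famEntropy φ V ≠ ⊤) (fUV : famEntropy φ (U ∪ V) ≠ ⊤)
    (fI : famEntropy φ (U ∩ V) ≠ ⊤) :
    (famEntropy φ (U ∪ V)).toReal + (famEntropy φ (U ∩ V)).toReal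
      ≤ (famEntropy φ U).toReal + (famEntropy φ V).toReal := by
  obtain ⟨e, he⟩ := exists_splitting (S := S) U V
  let e₂ := e.trans (⟨fun y => ((y.1.2.1, y.1.2.2), (y.1.1, y.2)),
    fun y => ((y.2.1, y.1.1, y.1.2), y.2.2), fun _ => rfl, fun _ => rfl⟩ :
    _ ≃ ((∀ k : ↥(U ∩ V), S k) × (∀ k : ↥(V \ U), S k)) × ((∀ k : ↥(U \ V), S k) × _))
  let e₃ := e.trans (⟨fun y => ((y.1.1, y.1.2.1), (y.1.2.2, y.2)),
    fun y => ((y.1.1, y.1.2, y.2.1), y.2.2), fun _ => rfl, fun _ => rfl⟩ :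
    _ ≃ ((∀ k : ↥(U \ V), S k) × (∀ k : ↥(U ∩ V), S k)) × ((∀ k : ↥(V \ U), S k) × _))
  let e₄ := e.trans (⟨fun y => (y.1.2.1, (y.1.1, (y.1.2.2, y.2))),
    fun y => ((y.2.1, y.1, y.2.2.1), y.2.2.2), fun _ => rfl, fun _ => rfl⟩ :
    _ ≃ (∀ k : ↥(U ∩ V), S k) × ((∀ k : ↥(U \ V), S k) × ((∀ k : ↥(V \ U), S k) × _)))
  have g₁ : subEntropy e φ = famEntropy φ (U ∪ V) := by
    refine subEntropy_eq_famEntropy _ (Equiv.refl _) _ hφ (fun x => rfl) (fun x x' => ?_)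
      (fun x x' => ?_)
    · simp only [he, Prod.mk.injEq, funext_iff, Subtype.forall, Equiv.refl_apply, mem_union,
        mem_sdiff, mem_inter_iff]
      grind
    · simp only [he, funext_iff, Subtype.forall, Equiv.refl_apply, mem_compl_iff]
  have g₂ : subEntropy e₂ φ = famEntropy φ V := by
    refine subEntropy_eq_famEntropy _ (Equiv.refl _) _ hφ (fun x => rfl) (fun x x' => ?_)
      (fun x x' => ?_) <;>
    · simp only [e₂, Equiv.trans_apply, Equiv.coe_fn_mk, he, Prod.mk.injEq, funext_iff,
        Subtype.forall, Equiv.refl_apply, mem_union, mem_sdiff, mem_inter_iff, mem_compl_iff]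
      grind
  have g₃ : subEntropy e₃ φ = famEntropy φ U := by
    refine subEntropy_eq_famEntropy _ (Equiv.refl _) _ hφ (fun x => rfl) (fun x x' => ?_)
      (fun x x' => ?_) <;>
    · simp only [e₃, Equiv.trans_apply, Equiv.coe_fn_mk, he, Prod.mk.injEq, funext_iff,
        Subtype.forall, Equiv.refl_apply, mem_union, mem_sdiff, mem_inter_iff, mem_compl_iff]
      grind
  have g₄ : subEntropy e₄ φ = famEntropy φ (U ∩ V) := by
    refine subEntropy_eq_famEntropy _ (Equiv.refl _) _ hφ (fun x => rfl) (fun x x' => ?_)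
      (fun x x' => ?_)
    · simp only [e₄, Equiv.trans_apply, Equiv.coe_fn_mk, he, funext_iff, Subtype.forall,
        Equiv.refl_apply, mem_inter_iff]
    · simp only [e₄, Equiv.trans_apply, Equiv.coe_fn_mk, he, Prod.mk.injEq, funext_iff,
        Subtype.forall, Equiv.refl_apply, mem_union, mem_sdiff, mem_inter_iff, mem_compl_iff]
      grind
  have := toReal_subEntropy_sub_le (e := e) (e₂ := e₂) (e₃ := e₃) (e₄ := e₄)
    (fun _ _ _ _ => rfl) (fun _ _ _ _ => rfl) (fun _ _ _ _ => rfl) hφ (by rwa [g₁]) (by rwa [g₂])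
    (by rwa [g₃]) (by rwa [g₄])
  rw [g₁, g₂, g₃, g₄] at this
  linarith

/-- Weak subadditivity for disjoint sets of systems. -/
theorem famEntropy_union_ne_top {φ : Hilb (∀ k, S k)} (hφ : ‖φ‖ = 1) {U V : Set K}
    (h : Disjoint U V) (fU : famEntropy φ U ≠ ⊤) (fV : famEntropy φ V ≠ ⊤) :
    famEntropy φ (U ∪ V) ≠ ⊤ := by
  obtain ⟨e, he⟩ := exists_splitting (S := S) U V
  rw [Set.disjoint_iff] at h
  have h' : ∀ k, k ∈ U → k ∉ V := fun k h1 h2 => h ⟨h1, h2⟩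
  let e₀ := e.trans (⟨fun y => ((y.1.1, y.1.2.2), (y.1.2.1, y.2)),
    fun y => ((y.1.1, y.2.1, y.1.2), y.2.2), fun _ => rfl, fun _ => rfl⟩ :
    _ ≃ ((∀ k : ↥(U \ V), S k) × (∀ k : ↥(V \ U), S k)) × ((∀ k : ↥(U ∩ V), S k) × _))
  let e₁ := e₀.trans (⟨fun y => (y.1.1, (y.1.2, y.2)), fun y => ((y.1, y.2.1), y.2.2),
    fun _ => rfl, fun _ => rfl⟩ : _ ≃ (∀ k : ↥(U \ V), S k) × ((∀ k : ↥(V \ U), S k) × _))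
  let e₂ := e₀.trans (⟨fun y => (y.1.2, (y.1.1, y.2)), fun y => ((y.2.1, y.1), y.2.2),
    fun _ => rfl, fun _ => rfl⟩ : _ ≃ (∀ k : ↥(V \ U), S k) × ((∀ k : ↥(U \ V), S k) × _))
  have g₀ : subEntropy e₀ φ = famEntropy φ (U ∪ V) := by
    refine subEntropy_eq_famEntropy _ (Equiv.refl _) _ hφ (fun x => rfl) (fun x x' => ?_)
      (fun x x' => ?_) <;>
    · simp only [e₀, Equiv.trans_apply, Equiv.coe_fn_mk, he, Prod.mk.injEq, funext_iff,
        Subtype.forall, Equiv.refl_apply, mem_union, mem_sdiff, mem_inter_iff, mem_compl_iff]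
      grind
  have g₁ : subEntropy e₁ φ = famEntropy φ U := by
    refine subEntropy_eq_famEntropy _ (Equiv.refl _) _ hφ (fun x => rfl) (fun x x' => ?_)
      (fun x x' => ?_) <;>
    · simp only [e₁, e₀, Equiv.trans_apply, Equiv.coe_fn_mk, he, Prod.mk.injEq, funext_iff,
        Subtype.forall, Equiv.refl_apply, mem_union, mem_sdiff, mem_inter_iff, mem_compl_iff]
      grind
  have g₂ : subEntropy e₂ φ = famEntropy φ V := by
    refine subEntropy_eq_famEntropy _ (Equiv.refl _) _ hφ (fun x => rfl) (fun x x' => ?_)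
      (fun x x' => ?_) <;>
    · simp only [e₂, e₀, Equiv.trans_apply, Equiv.coe_fn_mk, he, Prod.mk.injEq, funext_iff,
        Subtype.forall, Equiv.refl_apply, mem_union, mem_sdiff, mem_inter_iff, mem_compl_iff]
      grind
  have := subEntropy_le_add_add_one (e := e₀) (e₁ := e₁) (e₂ := e₂)
    (fun _ _ _ => rfl) (fun _ _ _ => rfl) hφ
  rw [g₀, g₁, g₂] at this
  exact ne_top_of_le_ne_top (by simp [fU, fV]) this

end Family

/-! ### Gram matrices of bipartite vectors -/

section Gram

variable {X X' Y Y' Y₁ Y₂ Z Z' : Type u}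

/-- The component `⟨y|ψ` in the second factor of a vector of a composite system. -/
noncomputable def row (e : X ≃ Y × Z) (ψ : Hilb X) (y : Y) : Hilb Z :=
  component (e.trans (Equiv.prodComm Y Z)) ψ y

theorem inner_ket_row (e : X ≃ Y × Z) (ψ : Hilb X) (y : Y) (z : Z) :
    inner ℂ (ket z) (row e ψ y) = inner ℂ (ket (e.symm (y, z))) ψ :=
  inner_ket_component _ _ _ _

theorem row_ext (e : X ≃ Y × Z) {φ ψ : Hilb X} (h : ∀ y, row e φ y = row e ψ y) : φ = ψ :=
  component_ext _ h

/-- The Gram matrix of the rows of `ψ`; it is the matrix of the reduced state on `Y`, transposed. -/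
noncomputable def gram (e : X ≃ Y × Z) (ψ : Hilb X) (y y' : Y) : ℂ :=
  inner ℂ (row e ψ y) (row e ψ y')

theorem hasSum_gram (e : X ≃ Y × Z) (ψ : Hilb X) (y y' : Y) :
    HasSum (fun z => starRingEnd ℂ (inner ℂ (ket (e.symm (y, z))) ψ)
      * inner ℂ (ket (e.symm (y', z))) ψ) (gram e ψ y y') := by
  have := hasSum_inner_ket (row e ψ y) (row e ψ y')
  simp_rw [← inner_conj_symm (row e ψ y), inner_ket_row] at this
  simpa [gram, inner_conj_symm] using this

theorem inner_ket_ptrace_ketbra (e : X ≃ Y × Z) (ψ : Hilb X) (y y' : Y) :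
    inner ℂ (ket y) (ptrace e (ketbra ψ) (ket y')) = gram e ψ y' y := by
  refine ((isMixture_ptrace_ketbra e ψ).hasSum_inner (ket y) (ket y')).unique ?_
  convert hasSum_gram e ψ y' y using 2 with z
  rw [← inner_conj_symm (component e ψ z), inner_ket_component, inner_ket_component, mul_comm]

theorem ptrace_ketbra_eq_iff (e : X ≃ Y × Z) (ψ : Hilb X) (e' : X' ≃ Y × Z') (ψ' : Hilb X') :
    ptrace e (ketbra ψ) = ptrace e' (ketbra ψ') ↔ gram e ψ = gram e' ψ' := by
  refine ⟨fun h => ?_, fun h => ?_⟩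
  · ext y y'
    rw [← inner_ket_ptrace_ketbra, h, inner_ket_ptrace_ketbra]
  · refine clm_ext_ket fun y => hilb_ext fun y' => ?_
    rw [inner_ket_ptrace_ketbra, inner_ket_ptrace_ketbra, h]

/-- Relabelling the two factors permutes the Gram matrix. -/
theorem gram_relabel (e : X ≃ Y × Z) (e' : X' ≃ Y' × Z') (σ : X ≃ X') (α : Y ≃ Y') (β : Z ≃ Z')
    (h : ∀ x, e' (σ x) = (α (e x).1, β (e x).2)) {ψ : Hilb X} {ψ' : Hilb X'}
    (hσ : ∀ x, inner ℂ (ket (σ x)) ψ' = inner ℂ (ket x) ψ) (y y' : Y) :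
    gram e' ψ' (α y) (α y') = gram e ψ y y' := by
  refine (β.hasSum_iff.2 (hasSum_gram e' ψ' (α y) (α y'))).unique ?_
  convert hasSum_gram e ψ y y' using 2 with z
  have h' : ∀ y, e'.symm (α y, β z) = σ (e.symm (y, z)) := fun y => by
    rw [Equiv.symm_apply_eq, h]; simp
  simp only [Function.comp_apply, h', hσ]

theorem gram_congr (e : X ≃ Y × Z) (e' : X ≃ Y' × Z') (α : Y ≃ Y') (β : Z ≃ Z')
    (h : ∀ x, e' x = (α (e x).1, β (e x).2)) (ψ : Hilb X) (y y' : Y) :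
    gram e' ψ (α y) (α y') = gram e ψ y y' :=
  gram_relabel e e' (Equiv.refl X) α β h (fun _ => rfl) y y'

/-- The splitting of `X` into `Y₁` and the rest, obtained from a splitting of `X` into `Y` and `Z`
and one of `Y` into `Y₁` and `Y₂`. -/
def subSplit (e : X ≃ Y × Z) (g : Y ≃ Y₁ × Y₂) : X ≃ Y₁ × (Y₂ × Z) :=
  (e.trans (g.prodCongr (Equiv.refl Z))).trans (Equiv.prodAssoc Y₁ Y₂ Z)

theorem subSplit_apply (e : X ≃ Y × Z) (g : Y ≃ Y₁ × Y₂) (x : X) :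
    subSplit e g x = ((g (e x).1).1, ((g (e x).1).2, (e x).2)) := rfl

theorem subSplit_symm_apply (e : X ≃ Y × Z) (g : Y ≃ Y₁ × Y₂) (y : Y₁) (p : Y₂ × Z) :
    (subSplit e g).symm (y, p) = e.symm (g.symm (y, p.1), p.2) := rfl

/-- The Gram matrix of a part of `Y` is the partial trace of that of `Y`. -/
theorem hasSum_gram_subSplit (e : X ≃ Y × Z) (g : Y ≃ Y₁ × Y₂) (ψ : Hilb X) (y y' : Y₁) :
    HasSum (fun w => gram e ψ (g.symm (y, w)) (g.symm (y', w))) (gram (subSplit e g) ψ y y') := by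
  refine (hasSum_gram (subSplit e g) ψ y y').prod_fiberwise fun w => ?_
  exact hasSum_gram e ψ (g.symm (y, w)) (g.symm (y', w))

theorem gram_subSplit_congr {e : X ≃ Y × Z} {e' : X' ≃ Y × Z'} (g : Y ≃ Y₁ × Y₂) {ψ : Hilb X}
    {ψ' : Hilb X'} (h : gram e ψ = gram e' ψ') :
    gram (subSplit e g) ψ = gram (subSplit e' g) ψ' := by
  ext y y'
  refine (hasSum_gram_subSplit e g ψ y y').unique ?_
  simpa [h] using hasSum_gram_subSplit e' g ψ' y y'

/-- Partial traces may be taken in two steps. -/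
theorem ptrace_ptrace (e : X ≃ Y × Z) (g : Y ≃ Y₁ × Y₂) (ψ : Hilb X) :
    ptrace g (ptrace e (ketbra ψ)) = ptrace (subSplit e g) (ketbra ψ) := by
  have h₁ := (isMixture_ptrace_ketbra e ψ).ptrace g (by simp [tsum_enorm_component_sq])
  refine h₁.unique ?_
  convert isMixture_ptrace_ketbra (subSplit e g) ψ using 2 with p
  refine hilb_ext fun y => ?_
  rw [inner_ket_component, inner_ket_component, inner_ket_component, subSplit_symm_apply]

theorem subEntropy_eq_of_gram_eq {e : X ≃ Y × Z} {e' : X' ≃ Y × Z'} {ψ : Hilb X} {ψ' : Hilb X'}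
    (h : gram e ψ = gram e' ψ') : subEntropy e ψ = subEntropy e' ψ' := by
  rw [subEntropy, (ptrace_ketbra_eq_iff e ψ e' ψ').2 h, subEntropy]

/-- The norm of a vector is the trace of its Gram matrix. -/
theorem norm_eq_one_of_gram_eq {e : X ≃ Y × Z} {e' : X' ≃ Y × Z'} {ψ : Hilb X} {ψ' : Hilb X'}
    (h : gram e ψ = gram e' ψ') (hψ : ‖ψ‖ = 1) : ‖ψ'‖ = 1 := by
  have h' : ∀ y, ‖row e ψ y‖ₑ ^ 2 = ‖row e' ψ' y‖ₑ ^ 2 := fun y => by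
    have := congr_fun (congr_fun h y) y
    rw [gram, gram, inner_self_eq_ofReal, inner_self_eq_ofReal, Complex.ofReal_inj] at this
    rw [enorm_sq_eq_ofReal, enorm_sq_eq_ofReal, this]
  have h1 : ‖ψ‖ₑ ^ 2 = ‖ψ'‖ₑ ^ 2 := by
    rw [← tsum_enorm_component_sq (e.trans (Equiv.prodComm Y Z)),
      ← tsum_enorm_component_sq (e'.trans (Equiv.prodComm Y Z'))]
    exact tsum_congr h'
  rw [enorm_sq_eq_ofReal, enorm_sq_eq_ofReal, hψ, ENNReal.ofReal_eq_ofReal_iff (by norm_num)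
    (by positivity)] at h1
  nlinarith [norm_nonneg ψ']

end Gram

/-! ### Uniqueness of purifications -/

section Purification

variable {X X' Y Z Z' R Z₁ Z₂ Z₁' Z₂' : Type u}

/-- The operator whose matrix is the vector `ψ`. -/
theorem exists_rowMap (e : X ≃ Y × Z) (ψ : Hilb X) :
    ∃ M : Hilb Y →L[ℂ] Hilb Z, ∀ y, M (ket y) = row e ψ y :=
  let ⟨M, hM, _⟩ := (isMixture_ptrace_ketbra (e.trans (Equiv.prodComm Y Z)) ψ).exists_factor
  ⟨M, hM⟩

/-- Two vectors with the same reduced state on `Y` are related by a partial isometry of the other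
factors, in both directions. -/
theorem exists_partialIsometry {e : X ≃ Y × Z} {e' : X' ≃ Y × Z'} {ψ : Hilb X} {ψ' : Hilb X'}
    (hψ : ‖ψ‖ = 1) (h : gram e ψ = gram e' ψ') :
    ∃ V : Hilb Z →L[ℂ] Hilb Z', (∀ y, V (row e ψ y) = row e' ψ' y) ∧
      ∀ y, adjoint V (row e' ψ' y) = row e ψ y := by
  obtain ⟨M, hM⟩ := exists_rowMap e ψ
  obtain ⟨M', hM'⟩ := exists_rowMap e' ψ'
  -- The hypothesis on the reduced states says that `M† M = M'† M'`.
  have hMM : (adjoint M).comp M = (adjoint M').comp M' := by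
    refine clm_ext_ket fun y => hilb_ext fun y' => ?_
    simp only [ContinuousLinearMap.comp_apply, adjoint_inner_right, hM, hM']
    exact congr_fun (congr_fun h y') y
  have hM1 : ∑' z, ‖adjoint M (ket z)‖ₑ ^ 2 = 1 := by
    have := tsum_enorm_apply_sq (stdBasis Y) (stdBasis Z) M
    change ∑' y, ‖M (ket y)‖ₑ ^ 2 = ∑' z, ‖adjoint M (ket z)‖ₑ ^ 2 at this
    rw [← this]
    simp_rw [hM]
    rw [show (∑' y, ‖row e ψ y‖ₑ ^ 2) = ‖ψ‖ₑ ^ 2 from tsum_enorm_component_sq _ ψ,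
      enorm_sq_eq_ofReal, hψ]
    simp
  have hmix := isMixture_comp_adjoint (stdBasis Z) (adjoint M)
  rw [ContinuousLinearMap.adjoint_adjoint] at hmix
  obtain ⟨I, b, p, hp0, -, -, hb⟩ := hmix.exists_eigenbasis hM1
  -- the vectors `M bᵢ` are orthogonal, with squared norms `pᵢ`, and so are the vectors `M' bᵢ`
  have hin : ∀ i j, inner ℂ (M (b i)) (M (b j)) = (p j : ℂ) * inner ℂ (b i) (b j) := fun i j => by
    rw [← adjoint_inner_right, ← inner_smul_right, ← hb]; rfl
  have hin' : ∀ i j, inner ℂ (M' (b i)) (M' (b j)) = (p j : ℂ) * inner ℂ (b i) (b j) :=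
      fun i j => by
    rw [← adjoint_inner_right, ← inner_smul_right, ← hb, hMM]; rfl
  let J := {i : I // p i ≠ 0}
  have hon : ∀ {H : Type u} [NormedAddCommGroup H] [InnerProductSpace ℂ H] (N : Hilb Y →L[ℂ] H)
      (_ : ∀ i j, inner ℂ (N (b i)) (N (b j)) = (p j : ℂ) * inner ℂ (b i) (b j)),
      Orthonormal ℂ (fun i : J => (((√(p i.1))⁻¹ : ℝ) : ℂ) • N (b i.1)) := by
    intro H _ _ N hN
    classical
    rw [orthonormal_iff_ite]
    intro i j
    rw [inner_smul_left, inner_smul_right, hN, Complex.conj_ofReal]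
    rcases eq_or_ne i j with rfl | hij
    · have hpi : 0 < p i.1 := lt_of_le_of_ne (hp0 _) (Ne.symm i.2)
      rw [if_pos rfl, inner_self_eq_norm_sq_to_K, b.orthonormal.1]
      have : (√(p i.1))⁻¹ * ((√(p i.1))⁻¹ * p i.1) = 1 := by
        rw [← mul_assoc, ← mul_inv, Real.mul_self_sqrt hpi.le, inv_mul_cancel₀ hpi.ne']
      simpa using congrArg (fun r : ℝ => (r : ℂ)) this
    · rw [if_neg hij, b.orthonormal.2 (fun h => hij (Subtype.ext h))]
      simp
  have hs := hon M hin
  have ht := hon M' hin'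
  -- `V` maps the normalised vector `M bᵢ` to the normalised vector `M' bᵢ`, for `pᵢ ≠ 0`.
  let V : Hilb Z →L[ℂ] Hilb Z' := (onIso ht).toContinuousLinearMap.comp
    (adjoint (onIso hs).toContinuousLinearMap)
  have hadj : ∀ {H : Type u} [NormedAddCommGroup H] [InnerProductSpace ℂ H] [CompleteSpace H]
      {v : J → H} (hv : Orthonormal ℂ v) (i : J),
      adjoint (onIso hv).toContinuousLinearMap (v i) = ket i := by
    intro H _ _ _ v hv i
    refine hilb_ext fun j => ?_
    rw [adjoint_inner_right]
    change inner ℂ (onIso hv (ket j)) _ = _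
    rw [← onIso_ket hv i, (onIso hv).inner_map_map]
  have key : ∀ {H H' : Type u} [NormedAddCommGroup H] [InnerProductSpace ℂ H]
      [NormedAddCommGroup H'] [InnerProductSpace ℂ H'] [CompleteSpace H] [CompleteSpace H']
      (N : Hilb Y →L[ℂ] H) (N' : Hilb Y →L[ℂ] H')
      (hN : ∀ i j, inner ℂ (N (b i)) (N (b j)) = (p j : ℂ) * inner ℂ (b i) (b j))
      (hN' : ∀ i j, inner ℂ (N' (b i)) (N' (b j)) = (p j : ℂ) * inner ℂ (b i) (b j)),
      ((onIso (hon N' hN')).toContinuousLinearMap.comp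
        (adjoint (onIso (hon N hN)).toContinuousLinearMap)).comp N = N' := by
    intro H H' _ _ _ _ _ _ N N' hN hN'
    refine hilbertBasis_clm_ext b fun i => ?_
    by_cases hi : p i = 0
    · have h0 : ∀ {H : Type u} [NormedAddCommGroup H] [InnerProductSpace ℂ H]
          (N : Hilb Y →L[ℂ] H)
          (_ : ∀ i j, inner ℂ (N (b i)) (N (b j)) = (p j : ℂ) * inner ℂ (b i) (b j)),
          N (b i) = 0 := fun N hN => by
        rw [← inner_self_eq_zero (𝕜 := ℂ), hN, hi]; simp
      rw [ContinuousLinearMap.comp_apply, h0 N hN, h0 N' hN', map_zero]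
    · have hpi : √(p i) ≠ 0 := Real.sqrt_ne_zero'.2 (lt_of_le_of_ne (hp0 _) (Ne.symm hi))
      have hsc : ∀ {H : Type u} [NormedAddCommGroup H] [InnerProductSpace ℂ H]
          (N : Hilb Y →L[ℂ] H), N (b i) = ((√(p i) : ℝ) : ℂ) • (((√(p i))⁻¹ : ℝ) : ℂ) • N (b i) :=
        fun N => by
          rw [smul_smul, ← Complex.ofReal_mul, mul_inv_cancel₀ hpi, Complex.ofReal_one, one_smul]
      rw [ContinuousLinearMap.comp_apply, hsc N, hsc N', map_smul, ContinuousLinearMap.comp_apply,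
        hadj (hon N hN) ⟨i, hi⟩]
      congr 1
      exact onIso_ket (hon N' hN') ⟨i, hi⟩
  refine ⟨V, fun y => ?_, fun y => ?_⟩
  · rw [← hM, ← hM', ← key M M' hin hin']; rfl
  · have hV : adjoint V = (onIso hs).toContinuousLinearMap.comp
        (adjoint (onIso ht).toContinuousLinearMap) := by
      rw [ContinuousLinearMap.adjoint_comp, ContinuousLinearMap.adjoint_adjoint]
    rw [← hM, ← hM', hV]
    exact congrArg (fun f => f (ket y)) (key M' M hin' hin)

/-- The operator `1 ⊗ V` on the second factor. -/
noncomputable def ampRight (e : X ≃ Y × Z) (e' : X' ≃ Y × Z') (V : Hilb Z →L[ℂ] Hilb Z') :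
    Hilb X →L[ℂ] Hilb X' :=
  amp (e.trans (Equiv.prodComm Y Z)) (e'.trans (Equiv.prodComm Y Z')) V

theorem row_ampRight (e : X ≃ Y × Z) (e' : X' ≃ Y × Z') (V : Hilb Z →L[ℂ] Hilb Z') (ψ : Hilb X)
    (y : Y) : row e' (ampRight e e' V ψ) y = V (row e ψ y) :=
  component_amp _ _ V ψ y

theorem row_tens (e : X ≃ Y × Z) (φ : Hilb Y) (χ : Hilb Z) (y : Y) :
    row e (tens e φ χ) y = inner ℂ (ket y) φ • χ := by
  rw [row, ← tens_swap e φ χ, component_tens]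

theorem ampRight_tens (e : X ≃ Y × Z) (e' : X' ≃ Y × Z') (V : Hilb Z →L[ℂ] Hilb Z') (φ : Hilb Y)
    (χ : Hilb Z) : ampRight e e' V (tens e φ χ) = tens e' φ (V χ) :=
  row_ext e' fun y => by rw [row_ampRight, row_tens, row_tens, map_smul]

/-- Basis vectors are product vectors. -/
theorem tens_ket_ket (e : X ≃ Y × Z) (x : X) : tens e (ket (e x).1) (ket (e x).2) = ket x := by
  classical
  refine hilb_ext fun x' => ?_
  rw [inner_ket_tens, inner_ket_ket, inner_ket_ket, inner_ket_ket, ← e.apply_eq_iff_eq,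
    Prod.ext_iff]
  split_ifs <;> simp_all

/-- The splitting of a tripartite system into the first and third factor and the second one. -/
def splitMid (e : X ≃ R × Z₁ × Z₂) : X ≃ (R × Z₂) × Z₁ :=
  e.trans ⟨fun x => ((x.1, x.2.2), x.2.1), fun x => (x.1.1, x.2, x.1.2), fun _ => rfl, fun _ => rfl⟩

/-- The splitting of a tripartite system into the first two factors and the third one. -/
def splitLast (e : X ≃ R × Z₁ × Z₂) : X ≃ (R × Z₁) × Z₂ :=
  e.trans (Equiv.prodAssoc R Z₁ Z₂).symm

/-- Operators on different factors commute. -/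
theorem ampRight_comm {X₀ X₁ X₂ X₃ : Type u} (e₀ : X₀ ≃ R × Z₁ × Z₂) (e₁ : X₁ ≃ R × Z₁' × Z₂)
    (e₂ : X₂ ≃ R × Z₁ × Z₂') (e₃ : X₃ ≃ R × Z₁' × Z₂') (V₁ : Hilb Z₁ →L[ℂ] Hilb Z₁')
    (V₂ : Hilb Z₂ →L[ℂ] Hilb Z₂') (ψ : Hilb X₀) :
    ampRight (splitLast e₁) (splitLast e₃) V₂ (ampRight (splitMid e₀) (splitMid e₁) V₁ ψ)
      = ampRight (splitMid e₂) (splitMid e₃) V₁ (ampRight (splitLast e₀) (splitLast e₂) V₂ ψ) := by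
  -- both sides agree on product vectors
  suffices h : (ampRight (splitLast e₁) (splitLast e₃) V₂).comp
      (ampRight (splitMid e₀) (splitMid e₁) V₁) = (ampRight (splitMid e₂) (splitMid e₃) V₁).comp
        (ampRight (splitLast e₀) (splitLast e₂) V₂) from congrArg (fun f => f ψ) h
  have hswap : ∀ {X Z₁ Z₂ : Type u} (e : X ≃ R × Z₁ × Z₂) (r : Hilb R) (φ : Hilb Z₁) (χ : Hilb Z₂),
      tens (splitMid e) (tens (Equiv.refl _) r χ) φ
        = tens (splitLast e) (tens (Equiv.refl _) r φ) χ := fun e r φ χ => by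
    refine hilb_ext fun x => ?_
    simp only [inner_ket_tens, splitMid, splitLast, Equiv.trans_apply, Equiv.coe_fn_mk,
      Equiv.prodAssoc_symm_apply, Equiv.refl_apply]
    ring
  refine clm_ext_ket fun x => ?_
  have hk₁ : ket x = tens (splitMid e₀) (tens (Equiv.refl _) (ket (e₀ x).1) (ket (e₀ x).2.2))
      (ket (e₀ x).2.1) := by
    rw [show tens (Equiv.refl _) (ket (e₀ x).1) (ket (e₀ x).2.2) = ket ((e₀ x).1, (e₀ x).2.2) from
      tens_ket_ket (Equiv.refl (R × Z₂)) ((e₀ x).1, (e₀ x).2.2)]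
    exact (tens_ket_ket (splitMid e₀) x).symm
  have hk₂ := hk₁.trans (hswap _ _ _ _)
  rw [ContinuousLinearMap.comp_apply, ContinuousLinearMap.comp_apply, hk₁, ampRight_tens, hswap,
    ampRight_tens, ← hk₁, hk₂, ampRight_tens, ← hswap, ← hswap,
    ampRight_tens]

/-- Let `Φ₁` and `Φ₂` arise from `ψ` by exchanging the purifying system `Z₁` of the other two for
`Z₁'`, and `Z₂` for `Z₂'`.  Both exchanges can be made at the same time: they are partial isometries
`V₁` and `V₂` of different factors, and `(V₁ ⊗ V₂) ψ` is the required vector. -/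
theorem exists_glue {X₀ X₁ X₂ X₃ : Type u} (e₀ : X₀ ≃ R × Z₁ × Z₂) (e₁ : X₁ ≃ R × Z₁' × Z₂)
    (e₂ : X₂ ≃ R × Z₁ × Z₂') (e₃ : X₃ ≃ R × Z₁' × Z₂') {ψ : Hilb X₀} {Φ₁ : Hilb X₁} {Φ₂ : Hilb X₂}
    (hψ : ‖ψ‖ = 1) (h₁ : gram (splitMid e₀) ψ = gram (splitMid e₁) Φ₁)
    (h₂ : gram (splitLast e₀) ψ = gram (splitLast e₂) Φ₂) :
    ∃ Ψ : Hilb X₃, gram (splitLast e₁) Φ₁ = gram (splitLast e₃) Ψ ∧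
      gram (splitMid e₂) Φ₂ = gram (splitMid e₃) Ψ := by
  obtain ⟨V₁, hV₁, hV₁'⟩ := exists_partialIsometry hψ h₁
  obtain ⟨V₂, hV₂, hV₂'⟩ := exists_partialIsometry hψ h₂
  have hΦ₁ : Φ₁ = ampRight (splitMid e₀) (splitMid e₁) V₁ ψ :=
    row_ext (splitMid e₁) fun y => by rw [row_ampRight, hV₁]
  have hΦ₂ : Φ₂ = ampRight (splitLast e₀) (splitLast e₂) V₂ ψ :=
    row_ext (splitLast e₂) fun y => by rw [row_ampRight, hV₂]
  -- The vectors lie in the initial spaces of the partial isometries.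
  have hψ₁ : ampRight (splitMid e₀) (splitMid e₀) ((adjoint V₁).comp V₁) ψ = ψ :=
    row_ext (splitMid e₀) fun y => by
      rw [row_ampRight, ContinuousLinearMap.comp_apply, hV₁, hV₁']
  have hψ₂ : ampRight (splitLast e₀) (splitLast e₀) ((adjoint V₂).comp V₂) ψ = ψ :=
    row_ext (splitLast e₀) fun y => by
      rw [row_ampRight, ContinuousLinearMap.comp_apply, hV₂, hV₂']
  have hinv₁ : ampRight (splitLast e₁) (splitLast e₁) ((adjoint V₂).comp V₂) Φ₁ = Φ₁ := by
    conv_lhs => rw [hΦ₁]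
    rw [ampRight_comm e₀ e₁ e₀ e₁, hψ₂, hΦ₁]
  have hinv₂ : ampRight (splitMid e₂) (splitMid e₂) ((adjoint V₁).comp V₁) Φ₂ = Φ₂ := by
    conv_lhs => rw [hΦ₂]
    rw [← ampRight_comm e₀ e₀ e₂ e₂, hψ₁, hΦ₂]
  -- A vector in the initial space of `V` and its image have the same reduced state.
  have hgram : ∀ {X X' Y Z Z' : Type u} (e : X ≃ Y × Z) (e' : X' ≃ Y × Z')
      (V : Hilb Z →L[ℂ] Hilb Z') (φ : Hilb X), ampRight e e ((adjoint V).comp V) φ = φ →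
      gram e φ = gram e' (ampRight e e' V φ) := fun e e' V φ h => by
    ext y y'
    have h' : adjoint V (V (row e φ y')) = row e φ y' := by
      conv_rhs => rw [← h, row_ampRight]
      rfl
    rw [gram, gram, row_ampRight, row_ampRight, ← adjoint_inner_right, h']
  refine ⟨ampRight (splitLast e₁) (splitLast e₃) V₂ Φ₁, hgram _ _ _ _ hinv₁, ?_⟩
  have hcomm : ampRight (splitLast e₁) (splitLast e₃) V₂ Φ₁
      = ampRight (splitMid e₂) (splitMid e₃) V₁ Φ₂ := by
    rw [hΦ₁, hΦ₂, ampRight_comm e₀ e₁ e₂ e₃]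
  rw [hcomm]
  exact hgram _ _ _ _ hinv₂

end Purification

/-! ### Purifications of extensions -/

section Extensions

variable {X X' Y Y₁ Y₂ Z Z' C C' D D' : Type u}

theorem norm_eq_one_of_enorm_sq {H : Type*} [SeminormedAddCommGroup H] {x : H}
    (h : ‖x‖ₑ ^ 2 = 1) : ‖x‖ = 1 := by
  rw [enorm_sq_eq_ofReal, ENNReal.ofReal_eq_one] at h
  nlinarith [norm_nonneg x]

/-- Every state is the reduced state of a pure state. -/
theorem IsState.exists_purification {T : Op X} (hT : IsState T) :
    ∃ Φ : Hilb (X × X), ‖Φ‖ = 1 ∧ ptrace (Equiv.refl (X × X)) (ketbra Φ) = T := by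
  obtain ⟨v, hv, hv1⟩ := hT.exists_isMixture
  obtain ⟨Φ, hΦ⟩ := exists_vector_of_components v (by simp [hv1]) (Equiv.refl (X × X))
  refine ⟨Φ, ?_, ?_⟩
  · refine norm_eq_one_of_enorm_sq ?_
    rw [← tsum_enorm_component_sq (Equiv.refl (X × X)) Φ]
    simp_rw [hΦ, hv1]
  · have := isMixture_ptrace_ketbra (Equiv.refl (X × X)) Φ
    rw [show component (Equiv.refl (X × X)) Φ = v from funext hΦ] at this
    exact this.unique hv

theorem isState_ptrace_ketbra (e : X ≃ Y × Z) {ψ : Hilb X} (hψ : ‖ψ‖ = 1) :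
    IsState (ptrace e (ketbra ψ)) :=
  (isMixture_ptrace_ketbra e ψ).isState (by
    rw [tsum_enorm_component_sq, enorm_sq_eq_ofReal, hψ]; simp)

/-- If two vectors have the same reduced state on `Y`, then they have the same entropy on every part
of `Y`. -/
theorem subEntropy_eq_of_kernel {e : X ≃ Y × Z} {e' : X' ≃ Y × Z'} {ψ : Hilb X} {ψ' : Hilb X'}
    (hψ : ‖ψ‖ = 1) (h : gram e ψ = gram e' ψ') (g : Y ≃ Y₁ × Y₂) (c : X ≃ C × D)
    (c' : X' ≃ C' × D')
    (h₁ : ∀ x x', (c x).1 = (c x').1 ↔ (g (e x).1).1 = (g (e x').1).1)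
    (h₂ : ∀ x x', (c x).2 = (c x').2 ↔ (g (e x).1).2 = (g (e x').1).2 ∧ (e x).2 = (e x').2)
    (h₁' : ∀ x x', (c' x).1 = (c' x').1 ↔ (g (e' x).1).1 = (g (e' x').1).1)
    (h₂' : ∀ x x', (c' x).2 = (c' x').2 ↔ (g (e' x).1).2 = (g (e' x').1).2 ∧ (e' x).2 = (e' x').2) :
    subEntropy c ψ = subEntropy c' ψ' := by
  rw [subEntropy_congr c (subSplit e g) (Equiv.refl X) h₁ (fun x x' => by
      rw [h₂, subSplit_apply, subSplit_apply, Prod.mk.injEq]; rfl) hψ (fun _ => rfl),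
    subEntropy_eq_of_gram_eq (gram_subSplit_congr g h)]
  exact (subEntropy_congr c' (subSplit e' g) (Equiv.refl X') h₁' (fun x x' => by
      rw [h₂', subSplit_apply, subSplit_apply, Prod.mk.injEq]; rfl)
      (norm_eq_one_of_gram_eq h hψ) (fun _ => rfl)).symm

/-- The family `A` with two more systems, `E` and `F`. -/
def extFam {K : Type} (A : K → Type u) (E F : Type u) : K ⊕ Bool → Type u
  | .inl k => A k
  | .inr false => E
  | .inr true => F

/-- The product of the systems of `extFam`. -/
def extFamEquiv {K : Type} (A : K → Type u) (E F : Type u) :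
    (∀ k, A k) × (E × F) ≃ ∀ i, extFam A E F i where
  toFun x
    | .inl k => x.1 k
    | .inr false => x.2.1
    | .inr true => x.2.2
  invFun y := (fun k => y (.inl k), (y (.inr false), y (.inr true)))
  left_inv _ := rfl
  right_inv y := by
    funext i
    rcases i with k | (_ | _) <;> rfl

/-- The splitting into the systems in `J`, `E` if `e`, and `F` if `f`, and the other ones. -/
theorem exists_split_extFam {K : Type} (A : K → Type u) (E F : Type u) (J : Set K)
    (e f : Prop) : ∃ (Y₁ Y₂ : Type u) (g : (∀ k, A k) × (E × F) ≃ Y₁ × Y₂),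
      (∀ x x', (g x).1 = (g x').1 ↔ (∀ k ∈ J, x.1 k = x'.1 k) ∧ (e → x.2.1 = x'.2.1)
        ∧ (f → x.2.2 = x'.2.2)) ∧
      (∀ x x', (g x).2 = (g x').2 ↔ (∀ k ∉ J, x.1 k = x'.1 k) ∧ (¬ e → x.2.1 = x'.2.1)
        ∧ (¬ f → x.2.2 = x'.2.2)) := by
  let T : Set (K ⊕ Bool) := {i | i.elim (· ∈ J) (fun b => bif b then f else e)}
  refine ⟨_, _, (extFamEquiv A E F).trans (splitEquiv _ T), fun x x' => ?_, fun x x' => ?_⟩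
  · rw [Equiv.trans_apply, Equiv.trans_apply, splitEquiv_fst_eq_iff]
    simp only [Sum.forall, Bool.forall_bool]
    rfl
  · rw [Equiv.trans_apply, Equiv.trans_apply, splitEquiv_snd_eq_iff]
    simp only [Sum.forall, Bool.forall_bool]
    rfl

variable {K L : Type} {A : K → Type u} {S : L → Type u} {E F : Type u}

theorem entropyExt_ptrace_ketbra (Φ : Hilb (((∀ k, A k) × E) × F)) (J : Set K) :
    entropyExt (ptrace (Equiv.refl _) (ketbra Φ)) J
      = subEntropy (subSplit (Equiv.refl _) (splitEquivExt A E J)) Φ := by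
  rw [entropyExt, ptrace_ptrace, subEntropy]

theorem splitEquivExt_fst_eq_iff (J : Set K) (x x' : (∀ k, A k) × E) :
    (splitEquivExt A E J x).1 = (splitEquivExt A E J x').1
      ↔ (∀ k ∈ J, x.1 k = x'.1 k) ∧ x.2 = x'.2 := by
  rw [← splitEquiv_fst_eq_iff]
  exact (Prod.mk.injEq _ _ _ _).to_iff

theorem splitEquivExt_snd_eq_iff (J : Set K) (x x' : (∀ k, A k) × E) :
    (splitEquivExt A E J x).2 = (splitEquivExt A E J x').2 ↔ ∀ k ∉ J, x.1 k = x'.1 k := by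
  rw [← splitEquiv_snd_eq_iff]
  rfl

theorem subSplit_splitEquivExt_fst_eq_iff (J : Set K) (x x' : ((∀ k, A k) × E) × F) :
    (subSplit (Equiv.refl _) (splitEquivExt A E J) x).1
      = (subSplit (Equiv.refl _) (splitEquivExt A E J) x').1
      ↔ (∀ k ∈ J, x.1.1 k = x'.1.1 k) ∧ x.1.2 = x'.1.2 :=
  splitEquivExt_fst_eq_iff J x.1 x'.1

theorem subSplit_splitEquivExt_snd_eq_iff (J : Set K) (x x' : ((∀ k, A k) × E) × F) :
    (subSplit (Equiv.refl _) (splitEquivExt A E J) x).2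
      = (subSplit (Equiv.refl _) (splitEquivExt A E J) x').2
      ↔ (∀ k ∉ J, x.1.1 k = x'.1.1 k) ∧ x.2 = x'.2 := by
  rw [subSplit_apply, subSplit_apply, ← splitEquivExt_snd_eq_iff]
  exact (Prod.mk.injEq _ _ _ _).to_iff

/-- Every extension is the reduced state of a pure state of the family with one more system. -/
theorem IsState.exists_famEntropy {ω : Op ((∀ k, A k) × E)} (hω : IsState ω) :
    ∃ (F : Type u) (Φ : Hilb (∀ i, extFam A E F i)), ‖Φ‖ = 1 ∧ ∀ J : Set K,
      entropyExt ω J = famEntropy Φ {i | i.elim (· ∈ J) (· = false)} := by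
  obtain ⟨Φ, hΦ, rfl⟩ := hω.exists_purification
  let σ := (Equiv.prodAssoc _ _ _).trans (extFamEquiv A E ((∀ k, A k) × E))
  obtain ⟨Φ', hΦ'⟩ := exists_hilb (fun i => inner ℂ (ket (σ.symm i)) Φ)
    ((σ.symm.summable_iff (f := fun x => ‖inner ℂ (ket x) Φ‖ ^ 2)).2 (summable_coef_sq Φ))
  have hσ : ∀ x, inner ℂ (ket (σ x)) Φ' = inner ℂ (ket x) Φ := fun x => by simp [hΦ']
  refine ⟨_, Φ', ?_, fun J => ?_⟩
  · have h := tsum_enorm_ket_sq Φ'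
    rw [← σ.tsum_eq] at h
    simp_rw [hσ, tsum_enorm_ket_sq] at h
    rw [enorm_sq_eq_ofReal, hΦ] at h
    exact norm_eq_one_of_enorm_sq (by simpa using h.symm)
  · rw [entropyExt_ptrace_ketbra]
    refine subEntropy_eq_famEntropy _ σ _ hΦ hσ (fun x x' => ?_) (fun x x' => ?_)
    · rw [subSplit_splitEquivExt_fst_eq_iff]
      simp only [Sum.forall, Bool.forall_bool, σ, extFamEquiv, Equiv.trans_apply, mem_ofPred_eq,
        Sum.elim_inl, Sum.elim_inr, Equiv.coe_fn_mk]
      simp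
      exact Iff.rfl
    · rw [subSplit_splitEquivExt_snd_eq_iff]
      simp only [Sum.forall, Bool.forall_bool, σ, extFamEquiv, Equiv.trans_apply, mem_ofPred_eq,
        Sum.elim_inl, Sum.elim_inr, Equiv.coe_fn_mk]
      simp
      exact Iff.rfl

/-- The splitting of the systems in `U` into those in `U₀ ⊆ W` and those outside `W`. -/
theorem exists_splitUnion {U U₀ W : Set K} (h : ∀ k, k ∈ U ↔ k ∈ U₀ ∨ k ∉ W)
    (hd : U₀ ⊆ W) :
    ∃ s : (∀ k : {k // k ∈ U}, A k) ≃ (∀ k : {k // k ∈ U₀}, A k) × (∀ k : {k // k ∉ W}, A k),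
      ∀ x, s x = (fun k : {k // k ∈ U₀} => x ⟨k, (h k).2 (Or.inl k.2)⟩,
      fun k : {k // k ∉ W} => x ⟨k, (h k).2 (Or.inr k.2)⟩) := by
  classical
  refine ⟨Equiv.ofBijective (fun x => (fun k => x ⟨k, (h k).2 (Or.inl k.2)⟩,
    fun k => x ⟨k, (h k).2 (Or.inr k.2)⟩)) ⟨fun x x' hx => ?_, fun y => ?_⟩, fun x => rfl⟩
  · rw [Prod.mk.injEq] at hx
    funext k
    rcases (h k).1 k.2 with hk | hk
    · exact congr_fun hx.1 ⟨k, hk⟩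
    · exact congr_fun hx.2 ⟨k, hk⟩
  · refine ⟨fun k => if hk : k.1 ∈ U₀ then y.1 ⟨k, hk⟩ else y.2 ⟨k, ((h k).1 k.2).resolve_left hk⟩,
      Prod.ext (funext fun k => dif_pos k.2) (funext fun k => dif_neg fun hk => k.2 (hd hk))⟩

/-- The splitting of a purified extension of the systems in `U` that corresponds to a splitting `s`
of these systems. -/
def splitPurified {V R Z : Type u} (E F : Type u) (s : V ≃ R × Z) :
    (V × E) × F ≃ R × (E × F) × Z where
  toFun x := ((s x.1.1).1, (x.1.2, x.2), (s x.1.1).2)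
  invFun y := ((s.symm (y.1, y.2.2), y.2.1.1), y.2.1.2)
  left_inv x := by simp
  right_inv y := by simp

/-- Entropies of an extension `ω` of the systems in `U`, expressed by a pure state `Ψ` that has the
same reduced state as a purification of `ω` on the systems in `U₀` and the purifying systems. -/
theorem entropyExt_eq_famEntropy {U U₀ W J : Set K} (h : ∀ k, k ∈ U ↔ k ∈ U₀ ∨ k ∉ W)
    {s : (∀ k : {k // k ∈ U}, A k) ≃ (∀ k : {k // k ∈ U₀}, A k) × (∀ k : {k // k ∉ W}, A k)}
    (hs : ∀ x, s x = (fun k : {k // k ∈ U₀} => x ⟨k, (h k).2 (Or.inl k.2)⟩,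
      fun k : {k // k ∉ W} => x ⟨k, (h k).2 (Or.inr k.2)⟩))
    {Φ : Hilb (((∀ k : {k // k ∈ U}, A k) × E) × F)} (hΦ : ‖Φ‖ = 1)
    {Ψ : Hilb (∀ i, S i)} {q : (∀ i, S i) ≃ (∀ k : {k // k ∈ U₀}, A k) × (E × F) × Z}
    (hg : gram (splitLast (splitPurified E F s)) Φ = gram (splitLast q) Ψ) (hJ : J ⊆ W)
    (T : Set L)
    (h₁ : ∀ x x', (∀ i ∈ T, x i = x' i) ↔ (∀ k : {k // k ∈ U₀}, k.1 ∈ J → (q x).1 k = (q x').1 k) ∧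
      (q x).2.1.1 = (q x').2.1.1)
    (h₂ : ∀ x x', (∀ i ∉ T, x i = x' i) ↔ (∀ k : {k // k ∈ U₀}, k.1 ∉ J → (q x).1 k = (q x').1 k) ∧
      (q x).2.1.2 = (q x').2.1.2 ∧ (q x).2.2 = (q x').2.2) :
    entropyExt (ptrace (Equiv.refl _) (ketbra Φ)) {k : {k // k ∈ U} | k.1 ∈ J}
      = famEntropy Ψ T := by
  rw [entropyExt_ptrace_ketbra, famEntropy]
  obtain ⟨Y₁, Y₂, g, hg₁, hg₂⟩ := exists_split_extFam (fun k : {k // k ∈ U₀} => A k) E F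
    {k | k.1 ∈ J} True False
  refine subEntropy_eq_of_kernel hΦ hg g _ _ (fun x x' => ?_) (fun x x' => ?_) (fun x x' => ?_)
    (fun x x' => ?_)
  · rw [subSplit_splitEquivExt_fst_eq_iff, hg₁]
    simp [splitLast, splitPurified, hs]
    grind
  · rw [subSplit_splitEquivExt_snd_eq_iff, hg₂]
    simp [splitLast, splitPurified, hs, funext_iff]
    grind
  · rw [splitEquiv_fst_eq_iff, hg₁, h₁]
    simp [splitLast]
  · rw [splitEquiv_snd_eq_iff, hg₂, h₂]
    simp [splitLast, and_assoc]

/-- The same for sets `J` that contain the systems not in `W`; these are complements of sets of the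
kind considered in `entropyExt_eq_famEntropy`, up to exchanging `E` and `F`. -/
theorem entropyExt_eq_famEntropy_of_compl_subset {U U₀ W J : Set K}
    (h : ∀ k, k ∈ U ↔ k ∈ U₀ ∨ k ∉ W)
    {s : (∀ k : {k // k ∈ U}, A k) ≃ (∀ k : {k // k ∈ U₀}, A k) × (∀ k : {k // k ∉ W}, A k)}
    (hs : ∀ x, s x = (fun k : {k // k ∈ U₀} => x ⟨k, (h k).2 (Or.inl k.2)⟩,
      fun k : {k // k ∉ W} => x ⟨k, (h k).2 (Or.inr k.2)⟩))
    {Φ : Hilb (((∀ k : {k // k ∈ U}, A k) × E) × F)} (hΦ : ‖Φ‖ = 1)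
    {Ψ : Hilb (∀ i, S i)} {q : (∀ i, S i) ≃ (∀ k : {k // k ∈ U₀}, A k) × (E × F) × Z}
    (hg : gram (splitLast (splitPurified E F s)) Φ = gram (splitLast q) Ψ) (hJ : Wᶜ ⊆ J)
    (T : Set L)
    (h₁ : ∀ x x', (∀ i ∉ T, x i = x' i) ↔ (∀ k : {k // k ∈ U₀}, k.1 ∉ J → (q x).1 k = (q x').1 k) ∧
      (q x).2.1.2 = (q x').2.1.2)
    (h₂ : ∀ x x', (∀ i ∈ T, x i = x' i) ↔ (∀ k : {k // k ∈ U₀}, k.1 ∈ J → (q x).1 k = (q x').1 k) ∧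
      (q x).2.1.1 = (q x').2.1.1 ∧ (q x).2.2 = (q x').2.2) :
    entropyExt (ptrace (Equiv.refl _) (ketbra Φ)) {k : {k // k ∈ U} | k.1 ∈ J}
      = famEntropy Ψ T := by
  rw [entropyExt_ptrace_ketbra, famEntropy, subEntropy_swap _ hΦ,
    subEntropy_swap _ (norm_eq_one_of_gram_eq hg hΦ)]
  obtain ⟨Y₁, Y₂, g, hg₁, hg₂⟩ := exists_split_extFam (fun k : {k // k ∈ U₀} => A k) E F
    {k | k.1 ∉ J} False True
  refine subEntropy_eq_of_kernel hΦ hg g _ _ (fun x x' => ?_) (fun x x' => ?_) (fun x x' => ?_)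
    (fun x x' => ?_)
  · rw [Equiv.trans_apply, Equiv.trans_apply, Equiv.prodComm_apply, Equiv.prodComm_apply,
      Prod.fst_swap, Prod.fst_swap, subSplit_splitEquivExt_snd_eq_iff, hg₁]
    simp [splitLast, splitPurified, hs]
    grind
  · rw [Equiv.trans_apply, Equiv.trans_apply, Equiv.prodComm_apply, Equiv.prodComm_apply,
      Prod.snd_swap, Prod.snd_swap, subSplit_splitEquivExt_fst_eq_iff, hg₂]
    simp [splitLast, splitPurified, hs, funext_iff]
    grind
  · rw [Equiv.trans_apply, Equiv.trans_apply, Equiv.prodComm_apply, Equiv.prodComm_apply,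
      Prod.fst_swap, Prod.fst_swap, splitEquiv_snd_eq_iff, hg₁, h₁]
    simp [splitLast]
  · rw [Equiv.trans_apply, Equiv.trans_apply, Equiv.prodComm_apply, Equiv.prodComm_apply,
      Prod.snd_swap, Prod.snd_swap, splitEquiv_fst_eq_iff, hg₂, h₂]
    simp [splitLast, and_assoc]

end Extensions

/-! ### The common purification of two extensions -/

section Glue

variable {K : Type} {A : K → Type u}

/-- The systems `A` with four more systems.  The first Boolean says which of two extensions a new
system comes from, the second one whether it is the purifying system (`true`) or the extension
itself (`false`). -/
def gluedFam {K : Type} (A : K → Type u) (E₁ F₁ E₂ F₂ : Type u) : K ⊕ Bool × Bool → Type u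
  | .inl k => A k
  | .inr (false, false) => E₁
  | .inr (false, true) => F₁
  | .inr (true, false) => E₂
  | .inr (true, true) => F₂

/-- The product of the systems of `gluedFam`. -/
def gluedFamEquiv {K : Type} (A : K → Type u) (E₁ F₁ E₂ F₂ : Type u) :
    (∀ i, gluedFam A E₁ F₁ E₂ F₂ i) ≃ (∀ k, A k) × (E₁ × F₁) × (E₂ × F₂) where
  toFun y := (fun k => y (.inl k), (y (.inr (false, false)), y (.inr (false, true))),
    (y (.inr (true, false)), y (.inr (true, true))))
  invFun x
    | .inl k => x.1 k
    | .inr (false, false) => x.2.1.1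
    | .inr (false, true) => x.2.1.2
    | .inr (true, false) => x.2.2.1
    | .inr (true, true) => x.2.2.2
  left_inv y := by
    funext i
    rcases i with k | ⟨(_ | _), (_ | _)⟩ <;> rfl
  right_inv _ := rfl

/-- The set of the systems in `J` and of the additional systems in `s`. -/
def gluedSet {K L : Type} {U : Set K} (J : Set K) (s : Set L) : Set ({k // k ∈ U} ⊕ L) :=
  {i | i.elim (fun k => k.1 ∈ J) (· ∈ s)}

theorem compl_gluedSet {K L : Type} {U : Set K} (J : Set K) (s : Set L) :
    (gluedSet J s : Set ({k // k ∈ U} ⊕ L))ᶜ = gluedSet Jᶜ sᶜ := by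
  ext (k | l) <;> rfl

theorem forall_mem_gluedSet_iff {U : Set K} {E₁ F₁ E₂ F₂ : Type u} (J : Set K)
    (s : Set (Bool × Bool)) (x x' : ∀ i, gluedFam (fun k : {k // k ∈ U} => A k) E₁ F₁ E₂ F₂ i) :
    (∀ i ∈ (gluedSet J s : Set ({k // k ∈ U} ⊕ Bool × Bool)), x i = x' i) ↔
      (∀ k : {k // k ∈ U}, k.1 ∈ J → (gluedFamEquiv _ _ _ _ _ x).1 k
        = (gluedFamEquiv _ _ _ _ _ x').1 k) ∧
      ((false, false) ∈ s →
        (gluedFamEquiv _ _ _ _ _ x).2.1.1 = (gluedFamEquiv _ _ _ _ _ x').2.1.1) ∧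
      ((false, true) ∈ s →
        (gluedFamEquiv _ _ _ _ _ x).2.1.2 = (gluedFamEquiv _ _ _ _ _ x').2.1.2) ∧
      ((true, false) ∈ s →
        (gluedFamEquiv _ _ _ _ _ x).2.2.1 = (gluedFamEquiv _ _ _ _ _ x').2.2.1) ∧
      ((true, true) ∈ s →
        (gluedFamEquiv _ _ _ _ _ x).2.2.2 = (gluedFamEquiv _ _ _ _ _ x').2.2.2) := by
  rw [Sum.forall, Prod.forall, Bool.forall_bool, Bool.forall_bool, Bool.forall_bool, and_assoc]
  exact Iff.rfl

theorem forall_notMem_gluedSet_iff {U : Set K} {E₁ F₁ E₂ F₂ : Type u} (J : Set K)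
    (s : Set (Bool × Bool)) (x x' : ∀ i, gluedFam (fun k : {k // k ∈ U} => A k) E₁ F₁ E₂ F₂ i) :
    (∀ i ∉ (gluedSet J s : Set ({k // k ∈ U} ⊕ Bool × Bool)), x i = x' i) ↔
      (∀ k : {k // k ∈ U}, k.1 ∉ J → (gluedFamEquiv _ _ _ _ _ x).1 k
        = (gluedFamEquiv _ _ _ _ _ x').1 k) ∧
      ((false, false) ∉ s →
        (gluedFamEquiv _ _ _ _ _ x).2.1.1 = (gluedFamEquiv _ _ _ _ _ x').2.1.1) ∧
      ((false, true) ∉ s →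
        (gluedFamEquiv _ _ _ _ _ x).2.1.2 = (gluedFamEquiv _ _ _ _ _ x').2.1.2) ∧
      ((true, false) ∉ s →
        (gluedFamEquiv _ _ _ _ _ x).2.2.1 = (gluedFamEquiv _ _ _ _ _ x').2.2.1) ∧
      ((true, true) ∉ s →
        (gluedFamEquiv _ _ _ _ _ x).2.2.2 = (gluedFamEquiv _ _ _ _ _ x').2.2.2) := by
  have := forall_mem_gluedSet_iff Jᶜ sᶜ x x'
  rwa [← compl_gluedSet] at this

/-- Exchanges the last two factors of a splitting into three factors. -/
def swapLast {X R Y Z : Type u} (e : X ≃ R × Y × Z) : X ≃ R × Z × Y :=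
  e.trans ⟨fun x => (x.1, x.2.2, x.2.1), fun x => (x.1, x.2.2, x.2.1), fun _ => rfl, fun _ => rfl⟩

/-- A purification of an extension of a reduced state of `ψ` has the same reduced state as `ψ` on
the systems that were not traced out. -/
theorem gram_eq_of_isExtension {U : Set K} {ψ : Hilb (∀ k, A k)} {E F Z R : Type u}
    (s : (∀ k : {k // k ∈ U}, A k) ≃ R × Z)
    {Φ : Hilb (((∀ k : {k // k ∈ U}, A k) × E) × F)}
    (hΦ : IsExtension (reduced U (ketbra ψ)) (ptrace (Equiv.refl _) (ketbra Φ)))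
    (e : (∀ k, A k) ≃ (R × Z) × (∀ k : {k // k ∉ U}, A k))
    (he : ∀ x, e x = (s (splitEquiv A U x).1, (splitEquiv A U x).2)) :
    gram e ψ = gram (splitMid (splitPurified E F s)) Φ := by
  have h := hΦ.2
  rw [reduced, ptrace_ptrace, ptrace_ketbra_eq_iff] at h
  ext y y'
  obtain ⟨y, rfl⟩ := s.surjective y
  obtain ⟨y', rfl⟩ := s.surjective y'
  rw [gram_congr (splitEquiv A U) e s (Equiv.refl _) (fun x => he x) ψ, ← h]
  exact (gram_congr _ _ s (Equiv.refl _) (fun x => rfl) Φ y y').symm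

/-- Two extensions, of overlapping parts `U₁` and `U₂` of a pure state, have a common purification:
a pure state of the systems in `U₀ = U₁ ∩ U₂` and of both extensions with their purifying systems,
which yields all the entropies of the two extensions, and whose reduced state on the systems in `U₀`
and the two extensions is an extension of the reduced state on `U₀`. -/
theorem exists_common_purification {ψ : Hilb (∀ k, A k)} (hψ : ‖ψ‖ = 1) {U₀ U₁ U₂ : Set K}
    (h₀ : U₀ = U₁ ∩ U₂) (h₁₂ : U₁ ∪ U₂ = univ) {E₁ E₂ : Type u}
    {ω₁ : Op ((∀ k : {k // k ∈ U₁}, A k) × E₁)} {ω₂ : Op ((∀ k : {k // k ∈ U₂}, A k) × E₂)}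
    (hω₁ : IsExtension (reduced U₁ (ketbra ψ)) ω₁) (hω₂ : IsExtension (reduced U₂ (ketbra ψ)) ω₂) :
    ∃ (S : {k // k ∈ U₀} ⊕ Bool × Bool → Type u) (Ψ : Hilb (∀ i, S i)) (E : Type u)
      (ω : Op ((∀ k : {k // k ∈ U₀}, A k) × E)), ‖Ψ‖ = 1 ∧
      IsExtension (reduced U₀ (ketbra ψ)) ω ∧
      (∀ J : Set K, entropyExt ω {k : {k // k ∈ U₀} | k.1 ∈ J}
        = famEntropy Ψ (gluedSet J {(false, false), (true, false)})) ∧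
      (∀ J ⊆ U₂, entropyExt ω₁ {k : {k // k ∈ U₁} | k.1 ∈ J}
        = famEntropy Ψ (gluedSet J {(false, false)})) ∧
      (∀ J, U₂ᶜ ⊆ J → entropyExt ω₁ {k : {k // k ∈ U₁} | k.1 ∈ J}
        = famEntropy Ψ (gluedSet J {(false, false), (true, false), (true, true)})) ∧
      (∀ J ⊆ U₁, entropyExt ω₂ {k : {k // k ∈ U₂} | k.1 ∈ J}
        = famEntropy Ψ (gluedSet J {(true, false)})) ∧
      (∀ J, U₁ᶜ ⊆ J → entropyExt ω₂ {k : {k // k ∈ U₂} | k.1 ∈ J}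
        = famEntropy Ψ (gluedSet J {(true, false), (false, false), (false, true)})) := by
  subst h₀
  have hU : ∀ k, k ∈ U₁ ∨ k ∈ U₂ := fun k =>
    (mem_union _ _ _).1 (h₁₂.symm ▸ mem_univ k)
  have hc₁ : ∀ k, k ∈ U₁ ↔ k ∈ U₁ ∩ U₂ ∨ k ∉ U₂ := fun k => by have := hU k; grind
  have hc₂ : ∀ k, k ∈ U₂ ↔ k ∈ U₁ ∩ U₂ ∨ k ∉ U₁ := fun k => by have := hU k; grind
  have hc₀ : ∀ k, k ∈ (U₁ ∩ U₂)ᶜ ↔ k ∈ U₁ᶜ ∨ k ∉ U₂ := fun k => by grind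
  obtain ⟨s₁, hs₁⟩ := exists_splitUnion (A := A) hc₁ inter_subset_right
  obtain ⟨s₂, hs₂⟩ := exists_splitUnion (A := A) hc₂ inter_subset_left
  obtain ⟨s₀, hs₀⟩ := exists_splitUnion (A := A) hc₀ (fun k hk => (hU k).resolve_left hk)
  obtain ⟨Φ₁, hΦ₁, rfl⟩ := hω₁.1.exists_purification
  obtain ⟨Φ₂, hΦ₂, rfl⟩ := hω₂.1.exists_purification
  let F₁ := (∀ k : {k // k ∈ U₁}, A k) × E₁
  let F₂ := (∀ k : {k // k ∈ U₂}, A k) × E₂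
  -- `ψ` as a vector of the systems in both `U₁` and `U₂`, those outside `U₁`, which `Φ₁` replaces
  -- by `E₁ F₁`, and those outside `U₂`, which `Φ₂` replaces by `E₂ F₂`.
  let e₀ : (∀ k, A k) ≃ (∀ k : {k // k ∈ U₁ ∩ U₂}, A k) × (∀ k : {k // k ∉ U₁}, A k) ×
      (∀ k : {k // k ∉ U₂}, A k) :=
    swapLast (((splitEquiv A U₁).trans (s₁.prodCongr (Equiv.refl _))).trans (Equiv.prodAssoc _ _ _))
  let e₁ := splitPurified E₁ F₁ s₁
  let e₂ := splitPurified E₂ F₂ s₂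
  let e₃ := gluedFamEquiv (fun k : {k // k ∈ U₁ ∩ U₂} => A k) E₁ F₁ E₂ F₂
  have g₁ : gram (splitMid e₀) ψ = gram (splitMid e₁) Φ₁ :=
    gram_eq_of_isExtension s₁ hω₁ _ (fun x => rfl)
  have g₂ : gram (splitLast e₀) ψ = gram (splitMid e₂) Φ₂ :=
    gram_eq_of_isExtension s₂ hω₂ _ (fun x => by
      refine Prod.ext (Prod.ext ?_ ?_) ?_
      · simp only [e₀, swapLast, splitLast, Equiv.trans_apply, hs₂]
        simp [hs₁]; rfl
      · simp only [e₀, swapLast, splitLast, Equiv.trans_apply, hs₂]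
        rfl
      · simp only [e₀, swapLast, splitLast, Equiv.trans_apply]
        simp [hs₁]; rfl)
  obtain ⟨Ψ, k₁, k₂⟩ := exists_glue e₀ e₁ (swapLast e₂) e₃ hψ g₁ g₂
  have hΨ := norm_eq_one_of_gram_eq k₁ hΦ₁
  -- The splitting of the systems of `Ψ` that leaves the purifying systems `F₁` and `F₂` to be
  -- traced out.
  let q : (∀ i, gluedFam (fun k : {k // k ∈ U₁ ∩ U₂} => A k) E₁ F₁ E₂ F₂ i) ≃
      ((∀ k : {k // k ∈ U₁ ∩ U₂}, A k) × (E₁ × E₂)) × (F₁ × F₂) :=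
    e₃.trans ⟨fun x => ((x.1, (x.2.1.1, x.2.2.1)), (x.2.1.2, x.2.2.2)),
      fun x => (x.1.1, (x.1.2.1, x.2.1), (x.1.2.2, x.2.2)), fun _ => rfl, fun _ => rfl⟩
  refine ⟨_, Ψ, E₁ × E₂, ptrace q (ketbra Ψ), hΨ, ⟨isState_ptrace_ketbra q hΨ, ?_⟩, fun J => ?_,
    fun J hJ => ?_, fun J hJ => ?_, fun J hJ => ?_, fun J hJ => ?_⟩
  · rw [reduced, ptrace_ptrace, ptrace_ketbra_eq_iff]
    ext y y'
    -- On the systems in `U₁ ∩ U₂`, the reduced states of `Ψ`, `Φ₁` and `ψ` agree.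
    have a₁ := gram_congr (splitEquiv A (U₁ ∩ U₂)) (subSplit (splitMid e₀) (Equiv.refl _))
      (Equiv.refl _) (s₀.trans (Equiv.prodComm _ _)) (fun x => by
        refine Prod.ext ?_ (Prod.ext ?_ ?_)
        · simp [e₀, swapLast, splitMid, subSplit, hs₁]; rfl
        · simp [e₀, swapLast, splitMid, subSplit, hs₁, hs₀]; rfl
        · simp [e₀, swapLast, splitMid, subSplit, hs₁, hs₀]; rfl) ψ y y'
    have a₂ := gram_congr (subSplit (splitLast e₁) (Equiv.refl _))
      (subSplit (splitMid e₁) (Equiv.refl _)) (Equiv.refl _) (Equiv.prodComm _ _) (fun x => rfl)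
      Φ₁ y y'
    have a₃ := gram_congr (subSplit (splitLast e₃) (Equiv.refl _))
      (subSplit q (Equiv.refl _)) (Equiv.refl _) (Equiv.prodProdProdComm _ _ _ _) (fun x => rfl)
      Ψ y y'
    rw [Equiv.refl_apply, Equiv.refl_apply] at a₁ a₂ a₃
    rw [a₃, ← gram_subSplit_congr _ k₁, ← a₂, ← gram_subSplit_congr _ g₁, a₁]
  · rw [entropyExt, ptrace_ptrace]
    refine subEntropy_eq_famEntropy _ (Equiv.refl _) _ hΨ (fun _ => rfl) (fun x x' => ?_)
      (fun x x' => ?_)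
    · rw [subSplit_apply, subSplit_apply, splitEquivExt_fst_eq_iff]
      refine Iff.trans ?_ (forall_mem_gluedSet_iff _ _ _ _).symm
      simp [q, e₃, Prod.ext_iff]
    · rw [subSplit_apply, subSplit_apply, Prod.mk.injEq, splitEquivExt_snd_eq_iff]
      refine Iff.trans ?_ (forall_notMem_gluedSet_iff _ _ _ _).symm
      simp [q, e₃, Prod.ext_iff]
  · refine entropyExt_eq_famEntropy hc₁ hs₁ hΦ₁ k₁ hJ _ (fun x x' => ?_)
      (fun x x' => ?_)
    · rw [forall_mem_gluedSet_iff]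
      simp only [e₃]
      generalize gluedFamEquiv _ _ _ _ _ x = y
      generalize gluedFamEquiv _ _ _ _ _ x' = y'
      simp
    · rw [forall_notMem_gluedSet_iff]
      simp only [e₃]
      generalize gluedFamEquiv _ _ _ _ _ x = y
      generalize gluedFamEquiv _ _ _ _ _ x' = y'
      obtain ⟨r₁, ⟨e₁, f₁⟩, ⟨e₂, f₂⟩⟩ := y
      obtain ⟨r₁', ⟨e₁', f₁'⟩, ⟨e₂', f₂'⟩⟩ := y'
      simp
  · refine entropyExt_eq_famEntropy_of_compl_subset hc₁ hs₁ hΦ₁ k₁ hJ _ (fun x x' => ?_)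
      (fun x x' => ?_)
    · rw [forall_notMem_gluedSet_iff]
      simp only [e₃]
      generalize gluedFamEquiv _ _ _ _ _ x = y
      generalize gluedFamEquiv _ _ _ _ _ x' = y'
      simp
    · rw [forall_mem_gluedSet_iff]
      simp only [e₃]
      generalize gluedFamEquiv _ _ _ _ _ x = y
      generalize gluedFamEquiv _ _ _ _ _ x' = y'
      obtain ⟨r₁, ⟨e₁, f₁⟩, ⟨e₂, f₂⟩⟩ := y
      obtain ⟨r₁', ⟨e₁', f₁'⟩, ⟨e₂', f₂'⟩⟩ := y'
      simp
  · refine entropyExt_eq_famEntropy (q := swapLast e₃) hc₂ hs₂ hΦ₂ k₂ hJ _ (fun x x' => ?_)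
      (fun x x' => ?_)
    · rw [forall_mem_gluedSet_iff]
      simp only [swapLast, Equiv.trans_apply, Equiv.coe_fn_mk, e₃]
      generalize gluedFamEquiv _ _ _ _ _ x = y
      generalize gluedFamEquiv _ _ _ _ _ x' = y'
      simp
    · rw [forall_notMem_gluedSet_iff]
      simp only [swapLast, Equiv.trans_apply, Equiv.coe_fn_mk, e₃]
      generalize gluedFamEquiv _ _ _ _ _ x = y
      generalize gluedFamEquiv _ _ _ _ _ x' = y'
      obtain ⟨r₁, ⟨e₁, f₁⟩, ⟨e₂, f₂⟩⟩ := y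
      obtain ⟨r₁', ⟨e₁', f₁'⟩, ⟨e₂', f₂'⟩⟩ := y'
      simp
      tauto
  · refine entropyExt_eq_famEntropy_of_compl_subset (q := swapLast e₃) hc₂ hs₂ hΦ₂ k₂ hJ _
      (fun x x' => ?_) (fun x x' => ?_)
    · rw [forall_notMem_gluedSet_iff]
      simp only [swapLast, Equiv.trans_apply, Equiv.coe_fn_mk, e₃]
      generalize gluedFamEquiv _ _ _ _ _ x = y
      generalize gluedFamEquiv _ _ _ _ _ x' = y'
      simp
    · rw [forall_mem_gluedSet_iff]
      simp only [swapLast, Equiv.trans_apply, Equiv.coe_fn_mk, e₃]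
      generalize gluedFamEquiv _ _ _ _ _ x = y
      generalize gluedFamEquiv _ _ _ _ _ x' = y'
      obtain ⟨r₁, ⟨e₁, f₁⟩, ⟨e₂, f₂⟩⟩ := y
      obtain ⟨r₁', ⟨e₁', f₁'⟩, ⟨e₂', f₂'⟩⟩ := y'
      simp
      tauto

end Glue

/-! ### Conditional multipartite information is nonnegative -/

section Nonneg

variable {ι : Type}

/-- A submodular function, normalised to vanish at `∅`, is subadditive. -/
theorem sub_le_sum_of_submodular {f : Set ι → ℝ}
    (hf : ∀ s t, f (s ∪ t) + f (s ∩ t) ≤ f s + f t) (t : Finset ι) :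
    f t - f ∅ ≤ ∑ i ∈ t, (f {i} - f ∅) := by
  classical
  induction t using Finset.induction_on with
  | empty => simp
  | insert i t hi ih =>
    rw [Finset.sum_insert hi, Finset.coe_insert, insert_eq]
    have := hf {i} t
    rw [singleton_inter_eq_empty.2 (by simpa using hi)] at this
    linarith

variable {K : Type} {A : K → Type u} {E : Type u}

/-- The entropies of the collections of parties, together with `E`, are submodular. -/
theorem toReal_entropyExt_submodular {ω : Op ((∀ k, A k) × E)} (hω : IsState ω) {G : ι → Set K}
    (hG : Pairwise (Function.onFun Disjoint G)) (hfin : FiniteEntropies G ω) (s t : Set ι) :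
    (entropyExt ω (⋃ i ∈ s ∪ t, G i)).toReal + (entropyExt ω (⋃ i ∈ s ∩ t, G i)).toReal
      ≤ (entropyExt ω (⋃ i ∈ s, G i)).toReal + (entropyExt ω (⋃ i ∈ t, G i)).toReal := by
  -- Strong subadditivity for a purification; as the parties are disjoint, intersections of index
  -- sets give intersections of sets of systems.
  obtain ⟨F, Φ, hΦ, h⟩ := hω.exists_famEntropy
  have hfin' := fun t => (hfin t).ne
  simp_rw [h] at hfin' ⊢
  have hu : ∀ s t : Set ι, ({i | i.elim (· ∈ ⋃ j ∈ s, G j) (· = false)} ∪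
      {i | i.elim (· ∈ ⋃ j ∈ t, G j) (· = false)} : Set (K ⊕ Bool))
      = {i | i.elim (· ∈ ⋃ j ∈ s ∪ t, G j) (· = false)} := fun s t => by
    ext (k | b)
    · simp only [biUnion_union]; rfl
    · exact or_self_iff
  have hi : ∀ s t : Set ι, ({i | i.elim (· ∈ ⋃ j ∈ s, G j) (· = false)} ∩
      {i | i.elim (· ∈ ⋃ j ∈ t, G j) (· = false)} : Set (K ⊕ Bool))
      = {i | i.elim (· ∈ ⋃ j ∈ s ∩ t, G j) (· = false)} := fun s t => by
    ext (k | b)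
    · have : k ∈ ⋃ j ∈ s ∩ t, G j ↔ k ∈ ⋃ j ∈ s, G j ∧ k ∈ ⋃ j ∈ t, G j := by
        simp only [mem_iUnion, exists_prop]
        refine ⟨fun ⟨j, hj, hk⟩ => ⟨⟨j, hj.1, hk⟩, ⟨j, hj.2, hk⟩⟩,
          fun ⟨⟨j, hj, hk⟩, j', hj', hk'⟩ => ?_⟩
        have : j = j' := by
          by_contra hne
          exact (Set.disjoint_left.1 (hG hne)) hk hk'
        subst this
        exact ⟨j, ⟨hj, hj'⟩, hk⟩
      exact this.symm
    · exact and_self_iff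
  have := famEntropy_ssa hΦ (hfin' s) (hfin' t) (by rw [hu]; exact hfin' _)
    (by rw [hi]; exact hfin' _)
  rwa [hu, hi] at this

variable [Fintype ι]

theorem condInfo_nonneg {ω : Op ((∀ k, A k) × E)} (hω : IsState ω) {G : ι → Set K}
    (hG : Pairwise (Function.onFun Disjoint G)) (hfin : FiniteEntropies G ω) :
    0 ≤ condInfo G ω := by
  have := sub_le_sum_of_submodular (f := fun t => (entropyExt ω (⋃ i ∈ t, G i)).toReal)
    (toReal_entropyExt_submodular hω hG hfin) Finset.univ
  simp only [Finset.coe_univ, biUnion_univ, biUnion_empty, biUnion_singleton] at this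
  simpa [condInfo, condEntropy] using this

/-- The function `t ↦ H(A_{tᶜ} E)` is submodular, too. -/
theorem condInfoTilde_nonneg {ω : Op ((∀ k, A k) × E)} (hω : IsState ω) {G : ι → Set K}
    (hG : Pairwise (Function.onFun Disjoint G)) (hfin : FiniteEntropies G ω) :
    0 ≤ condInfoTilde G ω := by
  have h := toReal_entropyExt_submodular hω hG hfin
  have := sub_le_sum_of_submodular (f := fun t => (entropyExt ω (⋃ i ∈ tᶜ, G i)).toReal)
    (fun s t => by
      have := h sᶜ tᶜ
      rw [← compl_inter, ← compl_union] at this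
      linarith) Finset.univ
  simp only [Finset.coe_univ, compl_univ, compl_empty, biUnion_univ, biUnion_empty,
    Finset.sum_sub_distrib, Finset.sum_const, Finset.card_univ, nsmul_eq_mul] at this
  simp only [condInfoTilde, condEntropy, Finset.sum_sub_distrib, Finset.sum_const,
    Finset.card_univ, nsmul_eq_mul]
  linarith

end Nonneg

/-! ### Finiteness of all entropies of a pure state -/

section Finite

variable {K : Type} {S : K → Type u} {φ : Hilb (∀ k, S k)}

/-- The qualitative form of the triangle inequality: the complement of `U` is the disjoint union
of `V \ U` and the complement of `V`, whose entropy is that of `V`. -/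
theorem famEntropy_ne_top_of_sdiff (hφ : ‖φ‖ = 1) {U V : Set K} (h : U ⊆ V)
    (hV : famEntropy φ V ≠ ⊤) (hVU : famEntropy φ (V \ U) ≠ ⊤) : famEntropy φ U ≠ ⊤ := by
  have := famEntropy_union_ne_top hφ (U := Vᶜ) (V := V \ U)
    (disjoint_compl_left.mono_right sdiff_subset) (by rwa [famEntropy_compl hφ]) hVU
  rwa [show Vᶜ ∪ V \ U = Uᶜ by ext k; have := @h k; simp; tauto, famEntropy_compl hφ] at this

/-- If all but one of finitely many systems have finite entropy, then so does every part of the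
pure state. -/
theorem famEntropy_ne_top [Finite K] (hφ : ‖φ‖ = 1) (a : K) (h₀ : famEntropy φ ∅ ≠ ⊤)
    (h : ∀ k, k ≠ a → famEntropy φ {k} ≠ ⊤) (T : Set K) : famEntropy φ T ≠ ⊤ := by
  have key : ∀ T : Set K, a ∉ T → famEntropy φ T ≠ ⊤ := fun T hT => by
    induction T, T.toFinite using Set.Finite.induction_on with
    | empty => exact h₀
    | @insert k T hk _ ih =>
      rw [mem_insert_iff, not_or] at hT
      rw [insert_eq]
      exact famEntropy_union_ne_top hφ (by simpa using hk) (h k (Ne.symm hT.1)) (ih hT.2)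
  by_cases hT : a ∈ T
  · rw [← famEntropy_compl hφ]
    exact key _ (by simpa using hT)
  · exact key _ hT

end Finite

/-! ### The entropy inequality -/

section Inequality

variable {m : ℕ}

/-- The combination of entropies that underlies the theorem.  The arguments of `g` say whether `S`
is present, which of the `Pᵢ` and of the `Qᵢ` are present, and whether the system `E₁` of the first
extension, its purifying system `F₁`, the system `E₂` of the second extension and its purifying
system `F₂` are. -/
theorem info_le_info_add_info
    {g : Bool → Set (Fin m) → Set (Fin m) → Bool → Bool → Bool → Bool → ℝ}
    (hg : ∀ s p q a b c d s' p' q' a' b' c' d',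
      g (s || s') (p ∪ p') (q ∪ q') (a || a') (b || b') (c || c') (d || d')
        + g (s && s') (p ∩ p') (q ∩ q') (a && a') (b && b') (c && c') (d && d')
      ≤ g s p q a b c d + g s' p' q' a' b' c' d') :
    (g true ∅ ∅ true false true false - g false ∅ ∅ true false true false)
        + ∑ i, (g false {i} {i} true false true false - g false ∅ ∅ true false true false)
        - (g true univ univ true false true false - g false ∅ ∅ true false true false)
      ≤ ((g true ∅ univ true false true true - g false ∅ ∅ true false false false)
          + ∑ i, (g false {i} ∅ true false false false - g false ∅ ∅ true false false false)
          - (g true univ univ true false true true - g false ∅ ∅ true false false false))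
        + ((g true univ ∅ true true true false - g false ∅ ∅ false false true false)
          + ∑ i, (g false ∅ {i} false false true false - g false ∅ ∅ false false true false)
          - (g true univ univ true true true false - g false ∅ ∅ false false true false)) := by
  -- `H(SPQE₁E₂) + H(SE₁E₂) ≤ H(SPE₁E₂) + H(SQE₁E₂)`
  have h₁ := hg true univ ∅ true false true false true ∅ univ true false true false
  -- `H(SPQE₁E₂F₂) + H(SQE₁E₂) ≤ H(SPQE₁E₂) + H(SQE₁E₂F₂)`
  have h₂ := hg true univ univ true false true false true ∅ univ true false true true
  -- `H(SPQE₁F₁E₂) + H(SPE₁E₂) ≤ H(SPQE₁E₂) + H(SPE₁F₁E₂)`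
  have h₃ := hg true univ univ true false true false true univ ∅ true true true false
  have h₄ : ∑ i, (g false {i} {i} true false true false - g false ∅ ∅ true false true false)
      ≤ ∑ i, ((g false {i} ∅ true false false false - g false ∅ ∅ true false false false)
        + (g false ∅ {i} false false true false - g false ∅ ∅ false false true false)) :=
    Finset.sum_le_sum fun i _ => by
      -- `H(PᵢQᵢE₁E₂) + H(E₁) ≤ H(PᵢE₁) + H(QᵢE₁E₂)`
      have h₅ := hg false {i} ∅ true false false false false ∅ {i} true false true false
      -- `H(QᵢE₁E₂) + H(E₂) ≤ H(QᵢE₂) + H(E₁E₂)`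
      have h₆ := hg false ∅ {i} false false true false false ∅ ∅ true false true false
      simp at h₅ h₆
      linarith
  rw [Finset.sum_add_distrib] at h₄
  simp at h₁ h₂ h₃
  linarith

/-- The same for the other combination of entropies; complements exchange the two. -/
theorem infoTilde_le_infoTilde_add_infoTilde
    {g : Bool → Set (Fin m) → Set (Fin m) → Bool → Bool → Bool → Bool → ℝ}
    (hg : ∀ s p q a b c d s' p' q' a' b' c' d',
      g (s || s') (p ∪ p') (q ∪ q') (a || a') (b || b') (c || c') (d || d')
        + g (s && s') (p ∩ p') (q ∩ q') (a && a') (b && b') (c && c') (d && d')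
      ≤ g s p q a b c d + g s' p' q' a' b' c' d')
    (hc : ∀ s p q a b c d, g (!s) pᶜ qᶜ (!a) (!b) (!c) (!d) = g s p q a b c d) :
    (g false univ univ true false true false - g false ∅ ∅ true false true false)
        + ∑ i, (g true {i}ᶜ {i}ᶜ true false true false - g false ∅ ∅ true false true false)
        - m * (g true univ univ true false true false - g false ∅ ∅ true false true false)
      ≤ ((g false univ ∅ true false false false - g false ∅ ∅ true false false false)
          + ∑ i, (g true {i}ᶜ univ true false true true - g false ∅ ∅ true false false false)
          - m * (g true univ univ true false true true - g false ∅ ∅ true false false false))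
        + ((g false ∅ univ false false true false - g false ∅ ∅ false false true false)
          + ∑ i, (g true univ {i}ᶜ true true true false - g false ∅ ∅ false false true false)
          - m * (g true univ univ true true true false - g false ∅ ∅ false false true false)) := by
  -- The other inequality, with `E₁` and `F₁` exchanged, and `E₂` and `F₂`; taking complements
  -- exchanges them back.
  have h := info_le_info_add_info (g := fun s p q a b c d => g s p q b a d c)
    (fun s p q a b c d s' p' q' a' b' c' d' => hg s p q b a d c s' p' q' b' a' d' c')
  have c₁ := hc false univ univ true false true false
  have c₂ := hc false ∅ ∅ true false true false
  have c₃ := hc true univ univ true false true false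
  have c₄ := hc false univ ∅ true false false false
  have c₅ := hc false ∅ ∅ true false false false
  have c₆ := hc true univ univ true false true true
  have c₇ := hc false ∅ univ false false true false
  have c₈ := hc false ∅ ∅ false false true false
  have c₉ := hc true univ univ true true true false
  have d₁ : ∀ i, g false {i} {i} false true false true = g true {i}ᶜ {i}ᶜ true false true false :=
    fun i => by simpa using hc true {i}ᶜ {i}ᶜ true false true false
  have d₂ : ∀ i, g false {i} ∅ false true false false = g true {i}ᶜ univ true false true true :=
    fun i => by simpa using hc true {i}ᶜ univ true false true true
  have d₃ : ∀ i, g false ∅ {i} false false false true = g true univ {i}ᶜ true true true false :=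
    fun i => by simpa using hc true univ {i}ᶜ true true true false
  simp only [compl_univ, compl_empty, Bool.not_true, Bool.not_false] at c₁ c₂ c₃ c₄ c₅ c₆ c₇ c₈ c₉
  simp only [d₁, d₂, d₃, c₁, c₃, c₄, c₆, c₇, c₉, Finset.sum_sub_distrib, Finset.sum_const,
    Finset.card_univ, Fintype.card_fin, nsmul_eq_mul] at h ⊢
  simp only [c₂, c₅, c₈] at h
  linarith

end Inequality

/-! ### Squashed entanglement of families of parties -/

section Parties

variable {K : Type} {A : K → Type u} {m : ℕ} {B U : Set K} {C : Fin m → Set K}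

/-- The set of the systems held by some party may be replaced by an equal set `U`. -/
theorem Esq_eq_of_iUnion_eq {ι : Type} [Fintype ι] {G : ι → Set K} (h : ⋃ i, G i = U)
    (ρ : Op (∀ k, A k)) :
    Esq G ρ = sqState (fun i => {k : {k // k ∈ U} | k.1 ∈ G i}) (reduced U ρ) := by
  subst h; rfl

theorem EsqTilde_eq_of_iUnion_eq {ι : Type} [Fintype ι] {G : ι → Set K} (h : ⋃ i, G i = U)
    (ρ : Op (∀ k, A k)) :
    EsqTilde G ρ = sqTildeState (fun i => {k : {k // k ∈ U} | k.1 ∈ G i}) (reduced U ρ) := by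
  subst h; rfl

theorem pairwise_disjoint_parties (hB : ∀ i, Disjoint B (C i))
    (hC : Pairwise (Function.onFun Disjoint C)) :
    Pairwise (Function.onFun Disjoint fun i => {k : {k // k ∈ U} | k.1 ∈ parties B C i}) := by
  have h : Pairwise (Function.onFun Disjoint (parties B C)) := fun i j => by
    refine Fin.cases ?_ (fun i => ?_) i <;> refine Fin.cases ?_ (fun j => ?_) j
    · exact fun h => (h rfl).elim
    · exact fun _ => hB j
    · exact fun _ => (hB i).symm
    · exact fun h => hC fun h' => h (congrArg Fin.succ h')
  exact fun i j hij => (h hij).preimage Subtype.val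

theorem biUnion_coe_parties (G : Fin m → Set K) (t : Set (Fin m)) :
    ⋃ i ∈ t, {k : {k // k ∈ U} | k.1 ∈ G i} = {k : {k // k ∈ U} | k.1 ∈ ⋃ i ∈ t, G i} := by
  ext k
  simp

variable {E : Type u} {ω : Op ((∀ k : {k // k ∈ U}, A k) × E)}

/-- The entropies of an extension of a state of the systems in `U`, as a function of sets of systems
of the whole family: this is `H(A_J E)` for `J ⊆ U`.  It is `0` if the entropy is infinite. -/
noncomputable def entropyOn (ω : Op ((∀ k : {k // k ∈ U}, A k) × E)) (J : Set K) : ℝ :=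
  (entropyExt ω {k : {k // k ∈ U} | k.1 ∈ J}).toReal

theorem condEntropy_coe (J : Set K) :
    condEntropy ω {k : {k // k ∈ U} | k.1 ∈ J} = entropyOn ω J - entropyOn ω ∅ := rfl

theorem condInfo_parties :
    condInfo (fun i => {k : {k // k ∈ U} | k.1 ∈ parties B C i}) ω
      = (entropyOn ω B - entropyOn ω ∅) + ∑ i, (entropyOn ω (C i) - entropyOn ω ∅)
        - (entropyOn ω (B ∪ ⋃ i, C i) - entropyOn ω ∅) := by
  have h := biUnion_coe_parties (U := U) (parties B C) univ
  simp only [biUnion_univ] at h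
  have h' : ⋃ i, parties B C i = B ∪ ⋃ i, C i := by
    ext k; simp [parties]
  rw [condInfo, Fin.sum_univ_succ, h, h']
  rfl

theorem condInfoTilde_parties :
    condInfoTilde (fun i => {k : {k // k ∈ U} | k.1 ∈ parties B C i}) ω
      = (entropyOn ω (⋃ i, C i) - entropyOn ω ∅)
        + ∑ i, (entropyOn ω (B ∪ ⋃ j ∈ ({i}ᶜ : Set (Fin m)), C j) - entropyOn ω ∅)
        - m * (entropyOn ω (B ∪ ⋃ i, C i) - entropyOn ω ∅) := by
  have h := biUnion_coe_parties (U := U) (parties B C) univ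
  simp only [biUnion_univ] at h
  have h' : ⋃ i, parties B C i = B ∪ ⋃ i, C i := by
    ext k; simp [parties]
  have h₀ : ⋃ i ∈ ({0}ᶜ : Set (Fin (m + 1))), parties B C i = ⋃ i, C i := by
    ext k; simp [parties, Fin.exists_fin_succ]
  have h₁ : ∀ i : Fin m, ⋃ j ∈ ({i.succ}ᶜ : Set (Fin (m + 1))), parties B C j
      = B ∪ ⋃ j ∈ ({i}ᶜ : Set (Fin m)), C j := fun i => by
    ext k; simp [parties, Fin.exists_fin_succ, (Fin.succ_ne_zero i).symm]
  simp only [condInfoTilde, biUnion_coe_parties, h, h', Fin.sum_univ_succ, h₀, h₁, Fintype.card_fin,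
    condEntropy_coe]
  push_cast
  ring

theorem FiniteEntropies.entropyExt_lt_top {G : Fin m → Set K}
    (h : FiniteEntropies (fun i => {k : {k // k ∈ U} | k.1 ∈ G i}) ω) {J : Set K} (t : Set (Fin m))
    (hJ : J = ⋃ i ∈ t, G i) : entropyExt ω {k : {k // k ∈ U} | k.1 ∈ J} ≠ ⊤ := by
  rw [hJ, ← biUnion_coe_parties]
  exact (h t).ne

variable {ι ι' : Type} [Fintype ι] [Fintype ι'] {K' : Type} {A' : K' → Type u}

theorem sqState_nonneg {G : ι → Set K} (hG : Pairwise (Function.onFun Disjoint G))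
    (ρ : Op (∀ k, A k)) : 0 ≤ sqState G ρ := by
  refine le_iInf fun E => le_iInf fun ω => le_iInf fun hω => le_iInf fun hf => ?_
  exact EReal.coe_nonneg.2 (by have := condInfo_nonneg hω.1 hG hf; positivity)

theorem sqTildeState_nonneg {G : ι → Set K} (hG : Pairwise (Function.onFun Disjoint G))
    (ρ : Op (∀ k, A k)) : 0 ≤ sqTildeState G ρ := by
  refine le_iInf fun E => le_iInf fun ω => le_iInf fun hω => le_iInf fun hf => ?_
  exact EReal.coe_nonneg.2 (by have := condInfoTilde_nonneg hω.1 hG hf; positivity)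

/-- A lower bound for all pairs of extensions is a lower bound for the sum of the infima.  The
infima are nonnegative, so that no sum `∞ - ∞` occurs. -/
theorem le_sqState_add_sqState {G : ι → Set K} {G' : ι' → Set K'}
    (hG : Pairwise (Function.onFun Disjoint G)) (hG' : Pairwise (Function.onFun Disjoint G'))
    {ρ : Op (∀ k, A k)} {ρ' : Op (∀ k, A' k)} {c : EReal}
    (h : ∀ (E : Type u) (ω : Op ((∀ k, A k) × E)) (E' : Type u) (ω' : Op ((∀ k, A' k) × E')),
      IsExtension ρ ω → FiniteEntropies G ω → IsExtension ρ' ω' → FiniteEntropies G' ω' →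
      c ≤ ((1 / 2 * condInfo G ω : ℝ) : EReal) + ((1 / 2 * condInfo G' ω' : ℝ) : EReal)) :
    c ≤ sqState G ρ + sqState G' ρ' := by
  refine EReal.le_add_of_forall_gt
    (Or.inl (lt_of_lt_of_le EReal.bot_lt_zero (sqState_nonneg hG ρ)).ne')
    (Or.inr (lt_of_lt_of_le EReal.bot_lt_zero (sqState_nonneg hG' ρ')).ne') fun a ha b hb => ?_
  simp only [sqState, gt_iff_lt, iInf_lt_iff] at ha hb
  obtain ⟨E, ω, hω, hf, ha⟩ := ha
  obtain ⟨E', ω', hω', hf', hb⟩ := hb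
  exact (h E ω E' ω' hω hf hω' hf').trans (add_le_add ha.le hb.le)

theorem le_sqTildeState_add_sqTildeState {G : ι → Set K} {G' : ι' → Set K'}
    (hG : Pairwise (Function.onFun Disjoint G)) (hG' : Pairwise (Function.onFun Disjoint G'))
    {ρ : Op (∀ k, A k)} {ρ' : Op (∀ k, A' k)} {c : EReal}
    (h : ∀ (E : Type u) (ω : Op ((∀ k, A k) × E)) (E' : Type u) (ω' : Op ((∀ k, A' k) × E')),
      IsExtension ρ ω → FiniteEntropies G ω → IsExtension ρ' ω' → FiniteEntropies G' ω' →
      c ≤ ((1 / 2 * condInfoTilde G ω : ℝ) : EReal)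
        + ((1 / 2 * condInfoTilde G' ω' : ℝ) : EReal)) :
    c ≤ sqTildeState G ρ + sqTildeState G' ρ' := by
  refine EReal.le_add_of_forall_gt
    (Or.inl (lt_of_lt_of_le EReal.bot_lt_zero (sqTildeState_nonneg hG ρ)).ne')
    (Or.inr (lt_of_lt_of_le EReal.bot_lt_zero (sqTildeState_nonneg hG' ρ')).ne') fun a ha b hb => ?_
  simp only [sqTildeState, gt_iff_lt, iInf_lt_iff] at ha hb
  obtain ⟨E, ω, hω, hf, ha⟩ := ha
  obtain ⟨E', ω', hω', hf', hb⟩ := hb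
  exact (h E ω E' ω' hω hf hω' hf').trans (add_le_add ha.le hb.le)

end Parties

/-! ### The systems `S`, `P`, `Q`, `E₁`, `E₂` -/

section Systems

variable {m : ℕ} {A : Sys m → Type u}

instance : Finite (Sys m) := by
  refine Finite.of_injective (β := Fin m ⊕ Fin m ⊕ Fin 3) (fun
    | .S => .inr (.inr 0)
    | .P i => .inl i
    | .Q i => .inr (.inl i)
    | .E₁ => .inr (.inr 1)
    | .E₂ => .inr (.inr 2)) ?_
  rintro (_ | i | i | _ | _) (_ | j | j | _ | _) h <;> simp_all

theorem iUnion_parties_SPQ :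
    ⋃ i, parties {Sys.S} (fun i : Fin m => {Sys.P i, Sys.Q i}) i = {Sys.E₁}ᶜ ∩ {Sys.E₂}ᶜ := by
  ext (_ | i | i | _ | _) <;> simp [parties]

theorem iUnion_parties_P :
    ⋃ i, parties ({Sys.S} ∪ range Sys.Q ∪ {Sys.E₂}) (fun i : Fin m => {Sys.P i}) i
      = {Sys.E₁}ᶜ := by
  ext (_ | i | i | _ | _) <;> simp [parties]

theorem iUnion_parties_Q :
    ⋃ i, parties ({Sys.S} ∪ range Sys.P ∪ {Sys.E₁}) (fun i : Fin m => {Sys.Q i}) i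
      = {Sys.E₂}ᶜ := by
  ext (_ | i | i | _ | _) <;> simp [parties]

/-- The set of the systems `S` (if `s`), `Pᵢ` with `i ∈ p` and `Qᵢ` with `i ∈ q`, and of the
additional systems: `a` and `b` refer to the first extension and its purifying system, `c` and `d`
to the second one. -/
def sysSet (s : Bool) (p q : Set (Fin m)) (a b c d : Bool) :
    Set ({k : Sys m // k ∈ ({Sys.E₁}ᶜ ∩ {Sys.E₂}ᶜ : Set (Sys m))} ⊕ Bool × Bool) :=
  gluedSet {k | match k with
    | .S => s
    | .P i => i ∈ p
    | .Q i => i ∈ q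
    | .E₁ => False
    | .E₂ => False} {x | match x with
    | (false, false) => a
    | (false, true) => b
    | (true, false) => c
    | (true, true) => d}

theorem sysSet_union (s p q a b c d s' p' q' a' b' c' d') :
    sysSet (m := m) s p q a b c d ∪ sysSet s' p' q' a' b' c' d'
      = sysSet (s || s') (p ∪ p') (q ∪ q') (a || a') (b || b') (c || c') (d || d') := by
  ext (⟨(_ | i | i | _ | _), hk⟩ | ⟨(_ | _), (_ | _)⟩) <;> simp [sysSet, gluedSet]

theorem sysSet_inter (s p q a b c d s' p' q' a' b' c' d') :
    sysSet (m := m) s p q a b c d ∩ sysSet s' p' q' a' b' c' d'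
      = sysSet (s && s') (p ∩ p') (q ∩ q') (a && a') (b && b') (c && c') (d && d') := by
  ext (⟨(_ | i | i | _ | _), hk⟩ | ⟨(_ | _), (_ | _)⟩) <;> simp [sysSet, gluedSet]

theorem compl_sysSet (s p q a b c d) :
    (sysSet (m := m) s p q a b c d)ᶜ = sysSet (!s) pᶜ qᶜ (!a) (!b) (!c) (!d) := by
  ext (⟨(_ | i | i | _ | _), hk⟩ | ⟨(_ | _), (_ | _)⟩)
  all_goals simp [sysSet, gluedSet]
  all_goals simp at hk

open Classical in
/-- Sets as they occur in `exists_common_purification`, in terms of `sysSet`. -/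
theorem gluedSet_eq_sysSet (J : Set (Sys m)) (a b c d : Bool) {t : Set (Bool × Bool)}
    (h₁ : (false, false) ∈ t ↔ a) (h₂ : (false, true) ∈ t ↔ b) (h₃ : (true, false) ∈ t ↔ c)
    (h₄ : (true, true) ∈ t ↔ d) :
    gluedSet J t = sysSet (decide (Sys.S ∈ J)) {i | Sys.P i ∈ J} {i | Sys.Q i ∈ J} a b c d := by
  ext (⟨(_ | i | i | _ | _), hk⟩ | ⟨(_ | _), (_ | _)⟩)
  all_goals simp [sysSet, gluedSet, h₁, h₂, h₃, h₄]
  all_goals simp at hk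

end Systems

/-! ### Subadditivity for a pair of extensions -/

section Main

variable {m : ℕ} {A : Sys m → Type u}

/-- Every pair of extensions as in the infima on the right-hand side yields an extension as in those
on the left-hand side. -/
theorem exists_extension_condInfo_le {ψ : Hilb (∀ k, A k)} (hψ : ‖ψ‖ = 1) {E₁ E₂ : Type u}
    {ω₁ : Op ((∀ k : {k // k ∈ ({Sys.E₁}ᶜ : Set (Sys m))}, A k) × E₁)}
    {ω₂ : Op ((∀ k : {k // k ∈ ({Sys.E₂}ᶜ : Set (Sys m))}, A k) × E₂)}
    (hω₁ : IsExtension (reduced _ (ketbra ψ)) ω₁) (hω₂ : IsExtension (reduced _ (ketbra ψ)) ω₂)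
    (hf₁ : FiniteEntropies (fun i => {k : {k // k ∈ ({Sys.E₁}ᶜ : Set (Sys m))} | k.1 ∈
      parties ({Sys.S} ∪ range Sys.Q ∪ {Sys.E₂}) (fun i => {Sys.P i}) i}) ω₁)
    (hf₂ : FiniteEntropies (fun i => {k : {k // k ∈ ({Sys.E₂}ᶜ : Set (Sys m))} | k.1 ∈
      parties ({Sys.S} ∪ range Sys.P ∪ {Sys.E₁}) (fun i => {Sys.Q i}) i}) ω₂) :
    ∃ (E : Type u)
      (ω : Op ((∀ k : {k // k ∈ ({Sys.E₁}ᶜ ∩ {Sys.E₂}ᶜ : Set (Sys m))}, A k) × E)),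
      IsExtension (reduced _ (ketbra ψ)) ω ∧
      FiniteEntropies (fun i => {k : {k // k ∈ ({Sys.E₁}ᶜ ∩ {Sys.E₂}ᶜ : Set (Sys m))} | k.1 ∈
        parties {Sys.S} (fun i => {Sys.P i, Sys.Q i}) i}) ω ∧
      condInfo (fun i => {k : {k // k ∈ ({Sys.E₁}ᶜ ∩ {Sys.E₂}ᶜ : Set (Sys m))} | k.1 ∈
        parties {Sys.S} (fun i => {Sys.P i, Sys.Q i}) i}) ω
        ≤ condInfo (fun i => {k : {k // k ∈ ({Sys.E₁}ᶜ : Set (Sys m))} | k.1 ∈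
          parties ({Sys.S} ∪ range Sys.Q ∪ {Sys.E₂}) (fun i => {Sys.P i}) i}) ω₁
        + condInfo (fun i => {k : {k // k ∈ ({Sys.E₂}ᶜ : Set (Sys m))} | k.1 ∈
          parties ({Sys.S} ∪ range Sys.P ∪ {Sys.E₁}) (fun i => {Sys.Q i}) i}) ω₂ ∧
      condInfoTilde (fun i => {k : {k // k ∈ ({Sys.E₁}ᶜ ∩ {Sys.E₂}ᶜ : Set (Sys m))} | k.1 ∈
        parties {Sys.S} (fun i => {Sys.P i, Sys.Q i}) i}) ω
        ≤ condInfoTilde (fun i => {k : {k // k ∈ ({Sys.E₁}ᶜ : Set (Sys m))} | k.1 ∈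
          parties ({Sys.S} ∪ range Sys.Q ∪ {Sys.E₂}) (fun i => {Sys.P i}) i}) ω₁
        + condInfoTilde (fun i => {k : {k // k ∈ ({Sys.E₂}ᶜ : Set (Sys m))} | k.1 ∈
          parties ({Sys.S} ∪ range Sys.P ∪ {Sys.E₁}) (fun i => {Sys.Q i}) i}) ω₂ := by
  classical
  obtain ⟨T, Ψ, E, ω, hΨ, hω, h₀, h₁, h₁', h₂, h₂'⟩ := exists_common_purification hψ rfl
    (by ext (_ | i | i | _ | _) <;> simp) hω₁ hω₂
  -- Every system of `Ψ` other than `S` has finite entropy.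
  have hfin : ∀ W, famEntropy Ψ W ≠ ⊤ := by
    -- the systems `E₁`, `E₂` alone, then with one `Pᵢ` or `Qᵢ`, and the complements of `F₁`, `F₂`
    have a₁ := hf₁.entropyExt_lt_top ∅ (J := ∅) (by simp)
    have a₂ := hf₂.entropyExt_lt_top ∅ (J := ∅) (by simp)
    have b₁ := fun i : Fin m => hf₁.entropyExt_lt_top {i.succ} (J := {Sys.P i}) (by simp [parties])
    have b₂ := fun i : Fin m => hf₂.entropyExt_lt_top {i.succ} (J := {Sys.Q i}) (by simp [parties])
    have d₁ := hf₁.entropyExt_lt_top univ (J := {Sys.E₁}ᶜ) (by rw [biUnion_univ, iUnion_parties_P])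
    have d₂ := hf₂.entropyExt_lt_top univ (J := {Sys.E₂}ᶜ) (by rw [biUnion_univ, iUnion_parties_Q])
    rw [h₁ _ (by simp), show gluedSet ∅ {(false, false)} = {Sum.inr (false, false)} by
      ext (k | b) <;> simp [gluedSet]] at a₁
    rw [h₂ _ (by simp), show gluedSet ∅ {(true, false)} = {Sum.inr (true, false)} by
      ext (k | b) <;> simp [gluedSet]] at a₂
    have s₁ : (gluedSet {Sys.E₁}ᶜ {(false, false), (true, false), (true, true)} : Set
        ({k : Sys m // k ∈ ({Sys.E₁}ᶜ ∩ {Sys.E₂}ᶜ : Set (Sys m))} ⊕ Bool × Bool))ᶜ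
        = {Sum.inr (false, true)} := by
      ext (⟨k, hk⟩ | ⟨(_ | _), (_ | _)⟩)
      · simpa [gluedSet] using hk.1
      all_goals simp [gluedSet]
    have s₂ : (gluedSet {Sys.E₂}ᶜ {(true, false), (false, false), (false, true)} : Set
        ({k : Sys m // k ∈ ({Sys.E₁}ᶜ ∩ {Sys.E₂}ᶜ : Set (Sys m))} ⊕ Bool × Bool))ᶜ
        = {Sum.inr (true, true)} := by
      ext (⟨k, hk⟩ | ⟨(_ | _), (_ | _)⟩)
      · simpa [gluedSet] using hk.2
      all_goals simp [gluedSet]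
    rw [h₁' _ (by simp), ← famEntropy_compl hΨ, s₁] at d₁
    rw [h₂' _ (by simp), ← famEntropy_compl hΨ, s₂] at d₂
    refine famEntropy_ne_top hΨ (.inl ⟨Sys.S, by simp⟩)
      (famEntropy_ne_top_of_sdiff hΨ (empty_subset _) a₁ (by simpa using a₁)) ?_
    rintro (⟨(_ | i | i | _ | _), hk⟩ | ⟨(_ | _), (_ | _)⟩) hne
    · exact (hne rfl).elim
    · have hb := b₁ i
      rw [h₁ _ (by simp)] at hb
      refine famEntropy_ne_top_of_sdiff hΨ (V := gluedSet {Sys.P i} {(false, false)})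
        (by simp [gluedSet]) hb ?_
      convert a₁
      ext (k | b) <;> simp [gluedSet, Subtype.ext_iff]
    · have hb := b₂ i
      rw [h₂ _ (by simp)] at hb
      refine famEntropy_ne_top_of_sdiff hΨ (V := gluedSet {Sys.Q i} {(true, false)})
        (by simp [gluedSet]) hb ?_
      convert a₂
      ext (k | b) <;> simp [gluedSet, Subtype.ext_iff]
    · exact (hk.1 rfl).elim
    · exact (hk.2 rfl).elim
    · exact a₁
    · exact d₁
    · exact a₂
    · exact d₂
  let g := fun s p q a b c d => (famEntropy Ψ (sysSet s p q a b c d)).toReal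
  have hg : ∀ s p q a b c d s' p' q' a' b' c' d',
      g (s || s') (p ∪ p') (q ∪ q') (a || a') (b || b') (c || c') (d || d')
        + g (s && s') (p ∩ p') (q ∩ q') (a && a') (b && b') (c && c') (d && d')
      ≤ g s p q a b c d + g s' p' q' a' b' c' d' := fun s p q a b c d s' p' q' a' b' c' d' => by
    have := famEntropy_ssa hΨ (hfin (sysSet s p q a b c d)) (hfin (sysSet s' p' q' a' b' c' d'))
      (hfin _) (hfin _)
    rwa [sysSet_union, sysSet_inter] at this
  have hc : ∀ s p q a b c d, g (!s) pᶜ qᶜ (!a) (!b) (!c) (!d) = g s p q a b c d :=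
    fun s p q a b c d => by
      simp only [g, ← compl_sysSet, famEntropy_compl hΨ]
  -- The entropies of the three extensions, as entropies of `Ψ`.
  have k₀ : ∀ J : Set (Sys m), entropyOn ω J
      = g (decide (Sys.S ∈ J)) {i | Sys.P i ∈ J} {i | Sys.Q i ∈ J} true false true false :=
    fun J => by
      rw [entropyOn, h₀, gluedSet_eq_sysSet J true false true false (by simp) (by simp) (by simp)
        (by simp)]
  have k₁ : ∀ J : Set (Sys m), Sys.E₂ ∉ J → entropyOn ω₁ J
      = g (decide (Sys.S ∈ J)) {i | Sys.P i ∈ J} {i | Sys.Q i ∈ J} true false false false :=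
    fun J hJ => by
      rw [entropyOn, h₁ J (by simpa using hJ), gluedSet_eq_sysSet J true false false false (by simp)
        (by simp) (by simp) (by simp)]
  have k₁' : ∀ J : Set (Sys m), Sys.E₂ ∈ J → entropyOn ω₁ J
      = g (decide (Sys.S ∈ J)) {i | Sys.P i ∈ J} {i | Sys.Q i ∈ J} true false true true :=
    fun J hJ => by
      rw [entropyOn, h₁' J (by simpa using hJ), gluedSet_eq_sysSet J true false true true (by simp)
        (by simp) (by simp) (by simp)]
  have k₂ : ∀ J : Set (Sys m), Sys.E₁ ∉ J → entropyOn ω₂ J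
      = g (decide (Sys.S ∈ J)) {i | Sys.P i ∈ J} {i | Sys.Q i ∈ J} false false true false :=
    fun J hJ => by
      rw [entropyOn, h₂ J (by simpa using hJ), gluedSet_eq_sysSet J false false true false (by simp)
        (by simp) (by simp) (by simp)]
  have k₂' : ∀ J : Set (Sys m), Sys.E₁ ∈ J → entropyOn ω₂ J
      = g (decide (Sys.S ∈ J)) {i | Sys.P i ∈ J} {i | Sys.Q i ∈ J} true true true false :=
    fun J hJ => by
      rw [entropyOn, h₂' J (by simpa using hJ), gluedSet_eq_sysSet J true true true false (by simp)
        (by simp) (by simp) (by simp)]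
  have u₁ : ∀ i : Fin m, {j | ¬ j = i} = ({i}ᶜ : Set (Fin m)) := fun i => rfl
  refine ⟨E, ω, hω, fun t => ?_, ?_, ?_⟩
  · rw [biUnion_coe_parties, h₀]
    exact (hfin _).lt_top
  · have key := info_le_info_add_info hg
    rw [condInfo_parties, condInfo_parties, condInfo_parties]
    simp (disch := simp) only [k₀, k₁, k₁', k₂, k₂']
    convert key using 1
    · simp
    · simp
  · have key := infoTilde_le_infoTilde_add_infoTilde hg hc
    rw [condInfoTilde_parties, condInfoTilde_parties, condInfoTilde_parties]
    simp (disch := simp) only [k₀, k₁, k₁', k₂, k₂']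
    convert key using 1
    · simp [u₁]
    · simp [u₁]

end Main

end Squashed

theorem mainTheorem5 (m : ℕ) (A : Sys m → Type*) (ψ : Hilb (∀ k, A k)) (hψ : ‖ψ‖ = 1) :
    Esq (parties {Sys.S} (fun i => {Sys.P i, Sys.Q i})) (ketbra ψ)
        ≤ Esq (parties ({Sys.S} ∪ range Sys.Q ∪ {Sys.E₂}) (fun i => {Sys.P i})) (ketbra ψ)
          + Esq (parties ({Sys.S} ∪ range Sys.P ∪ {Sys.E₁}) (fun i => {Sys.Q i}))
              (ketbra ψ) ∧
      EsqTilde (parties {Sys.S} (fun i => {Sys.P i, Sys.Q i})) (ketbra ψ)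
        ≤ EsqTilde (parties ({Sys.S} ∪ range Sys.Q ∪ {Sys.E₂}) (fun i => {Sys.P i}))
              (ketbra ψ)
          + EsqTilde (parties ({Sys.S} ∪ range Sys.P ∪ {Sys.E₁}) (fun i => {Sys.Q i}))
              (ketbra ψ) := by
  have hP : Pairwise (Function.onFun Disjoint fun i : Fin m => ({Sys.P i} : Set (Sys m))) :=
    fun i j hij => by simpa [Function.onFun] using hij
  have hQ : Pairwise (Function.onFun Disjoint fun i : Fin m => ({Sys.Q i} : Set (Sys m))) :=
    fun i j hij => by simpa [Function.onFun] using hij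
  rw [Esq_eq_of_iUnion_eq iUnion_parties_SPQ, Esq_eq_of_iUnion_eq iUnion_parties_P,
    Esq_eq_of_iUnion_eq iUnion_parties_Q, EsqTilde_eq_of_iUnion_eq iUnion_parties_SPQ,
    EsqTilde_eq_of_iUnion_eq iUnion_parties_P, EsqTilde_eq_of_iUnion_eq iUnion_parties_Q]
  constructor
  · refine le_sqState_add_sqState (pairwise_disjoint_parties (by simp) hP)
      (pairwise_disjoint_parties (by simp) hQ) fun E₁ ω₁ E₂ ω₂ hω₁ hf₁ hω₂ hf₂ => ?_
    obtain ⟨E, ω, hω, hf, h, -⟩ := exists_extension_condInfo_le hψ hω₁ hω₂ hf₁ hf₂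
    refine (iInf_le_of_le E (iInf_le_of_le ω (iInf_le_of_le hω (iInf_le _ hf)))).trans ?_
    rw [← EReal.coe_add, EReal.coe_le_coe_iff]
    linarith
  · refine le_sqTildeState_add_sqTildeState (pairwise_disjoint_parties (by simp) hP)
      (pairwise_disjoint_parties (by simp) hQ) fun E₁ ω₁ E₂ ω₂ hω₁ hf₁ hω₂ hf₂ => ?_
    obtain ⟨E, ω, hω, hf, -, h⟩ := exists_extension_condInfo_le hψ hω₁ hω₂ hf₁ hf₂
    refine (iInf_le_of_le E (iInf_le_of_le ω (iInf_le_of_le hω (iInf_le _ hf)))).trans ?_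
    rw [← EReal.coe_add, EReal.coe_le_coe_iff]
    linarith
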